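/- **Model.** Let $V$ be a set of $n$ vertices with degrees $d(v)\ge 2$, $v\in V$, such that $\ell=\sum_{v}d(v)$ is even, and put $m=\ell/2$. Let $H$ be the set of half-edges, $d(v)$ of them being incident to $v$; $|H|=\ell$. Two distinct half-edges incident to the same vertex are called siblings. A configuration is a fixed-point free involution $\eta$ of $H$; its edges are the pairs $\{x,\eta(x)\}$. Let $2\le k\le m$ and $\alpha_n=k/m$. Given an initial configuration $C_0=\eta$ and half-edge $X_0=x$, at each time $t=1,2,\dots$: - $k$ edges of $C_{t-1}$ are chosen uniformly at random without replacement and cut; $R_t$ denotes the set of the resulting $2k$ half-edges; - these $2k$ half-edges are paired uniformly at random, which together with the edges that were kept gives $C_t$; - the walk jumps from $X_{t-1}$ to a uniformly chosen sibling $X_t$ of $C_t(X_{t-1})$. Write $\mathbb P_{\eta,x}$ for the law of this process, $R_{\le t}=R_1\cup\dots\cup R_t$, and let $$\tau=\min\{t\ge 1: X_{t-1}\in R_{\le t}\}$$ be the first time the walk moves along a previously rewired edge ($\tau = \infty$ if there is no such time). Let $U_H$ be the uniform distribution on $H$, let $\mu_n$ be the uniform distribution on pairs $(\eta,x)$ of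 a configuration and a half-edge, and let $\|\cdot\|_{\mathrm{TV}}$ be the total variation distance. **Proposition (closeness to stationarity and tail behaviour of the stopping time).** Consider a sequence of such models with $n\to\infty$, where all of the above may depend on $n$, and suppose that $\ell=\Theta(n)$, that $$\limsup_{n\to\infty}\ \frac{\sum_{v}d(v)(d(v)-1)}{\sum_v d(v)}<\infty ,$$ and that $\alpha_n(\log n)^2\to\infty$. Let $t=t(n)\in\mathbb N_0$ with $t(n)=o(\log n)$. Then there is a deterministic sequence $\varepsilon_n\to 0$ such that the $\mu_n$-probability of the set of pairs $(\eta,x)$ for which all three of the following hold tends to $1$ as $n\to\infty$: 1. $\|\mathbb P_{\eta,x}(X_t\in\cdot\mid \tau\le t)-U_H\|_{\mathrm{TV}}\le\varepsilon_n$, provided $t\ge 1$; 2. $\|\mathbb P_{\eta,x}(X_t\in\cdot\mid \tau> t)-U_H\|_{\mathrm{TV}}\ge 1-\varepsilon_n$, provided $\mathbb P_{\eta,x}(\tau>t)>0$; 3. $\bigl|\mathbb P_{\eta,x}(\tau>t)-(1-\alpha_n)^{t(t+1)/2}\bigr|\le\varepsilon_n$. -/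

import Mathlib

open Filter Topology Asymptotics

/-- Data of the dynamic configuration model on the vertex set `Fin n`: degrees `d v ≥ 2` with an even
sum `2m`, and the number `k` of edges rewired at each time step, `2 ≤ k ≤ m`. -/
structure DynConfModel (n : ℕ) where
  d : Fin n → ℕ
  k : ℕ
  two_le_d : ∀ v, 2 ≤ d v
  even_sum : Even (∑ v, d v)
  two_le_k : 2 ≤ k
  k_le : k ≤ (∑ v, d v) / 2

namespace DynConfModel

variable {n : ℕ} (M : DynConfModel n)

/-- Half-edges; the half-edge `x` is incident to the vertex `x.1`. -/
abbrev HalfEdge : Type := Σ v : Fin n, Fin (M.d v)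

/-- Number of half-edges. -/
def ell : ℕ := ∑ v, M.d v

/-- Number of edges. -/
def m : ℕ := M.ell / 2

/-- Proportion of edges rewired at each time step. -/
noncomputable def alpha : ℝ := (M.k : ℝ) / (M.m : ℝ)

/-- Expected degree `ν` of a uniformly chosen half-edge, the degree of `x` being `d (v(x)) - 1`. -/
noncomputable def nu : ℝ := (∑ x : M.HalfEdge, ((M.d x.1 : ℝ) - 1)) / (M.ell : ℝ)

/-- Configurations: fixed-point free involutions of the set of half-edges. -/
abbrev Conf : Type :=
  {η : Equiv.Perm M.HalfEdge // (∀ x, η (η x) = x) ∧ ∀ x, η x ≠ x}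

/-- The edges of a configuration. -/
def edges (η : M.Conf) : Finset (Sym2 M.HalfEdge) :=
  Finset.univ.image fun x => s(x, η.1 x)

/-- The half-edges obtained by cutting the edges in `E`. -/
def cut (E : Finset (Sym2 M.HalfEdge)) : Finset M.HalfEdge :=
  Finset.univ.filter fun x => ∃ e ∈ E, x ∈ e

/-- The configurations obtained from `η` by keeping the pairs outside `R` and pairing the half-edges
of `R` among themselves arbitrarily (used when `R` is a union of edges of `η`; a configuration that
agrees with `η` outside such an `R` automatically maps `R` to `R`). -/
def repairings (η : M.Conf) (R : Finset M.HalfEdge) : Finset M.Conf :=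
  Finset.univ.filter fun ζ => ∀ x, x ∉ R → ζ.1 x = η.1 x

/-- Siblings of a half-edge: the other half-edges at the same vertex. -/
def siblings (x : M.HalfEdge) : Finset M.HalfEdge :=
  Finset.univ.filter fun y => y.1 = x.1 ∧ y ≠ x

theorem card_edges (η : M.Conf) : (M.edges η).card = M.m := by
  have h1 : (Finset.univ : Finset M.HalfEdge).card = 2 * (M.edges η).card := by
    rw [Finset.card_eq_sum_card_image (fun x => s(x, η.1 x)) Finset.univ, mul_comm,
      ← smul_eq_mul]
    refine Finset.sum_const_nat ?_ |>.trans (by rfl)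
    intro e he
    obtain ⟨x, -, rfl⟩ := Finset.mem_image.1 he
    have : (Finset.univ.filter fun y => s(y, η.1 y) = s(x, η.1 x)) = {x, η.1 x} := by
      ext y
      simp only [Finset.mem_filter, Finset.mem_univ, true_and, Finset.mem_insert,
        Finset.mem_singleton, Sym2.eq_iff]
      constructor
      · rintro (h | h)
        · exact Or.inl h.1
        · exact Or.inr h.1
      · rintro (h | h)
        · subst h; exact Or.inl ⟨rfl, rfl⟩
        · subst h; exact Or.inr ⟨rfl, η.2.1 x⟩
    rw [this, Finset.card_pair (η.2.2 x).symm]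
  have h2 : (Finset.univ : Finset M.HalfEdge).card = M.ell := by
    simp [ell]
  unfold m
  omega

theorem edgeChoices_nonempty (η : M.Conf) : ((M.edges η).powersetCard M.k).Nonempty :=
  Finset.powersetCard_nonempty.2 (by rw [card_edges]; exact M.k_le)

theorem repairings_nonempty (η : M.Conf) (R : Finset M.HalfEdge) : (M.repairings η R).Nonempty :=
  ⟨η, by simp [repairings]⟩

theorem siblings_nonempty (x : M.HalfEdge) : (M.siblings x).Nonempty := by
  obtain ⟨v, a⟩ := x
  have : Nontrivial (Fin (M.d v)) := Fin.nontrivial_iff_two_le.2 (M.two_le_d v)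
  obtain ⟨b, hb⟩ := exists_ne a
  exact ⟨⟨v, b⟩, by simp [siblings, hb]⟩

/-- State at time `s`: the configuration `C_s`, the set `R_s` of half-edges rewired at time `s`, and
the position `X_s` of the walk. -/
abbrev State : Type := M.Conf × Finset M.HalfEdge × M.HalfEdge

/-- One time step from configuration `ξ` and position `y`: choose `k` edges of `ξ` uniformly, cut
them, pair the resulting half-edges uniformly to get the new configuration `ζ`, and then let the
walk jump to a uniform sibling of `ζ y`. -/
noncomputable def step (ξ : M.Conf) (y : M.HalfEdge) : PMF M.State :=
  (PMF.uniformOfFinset _ (M.edgeChoices_nonempty ξ)).bind fun E =>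
    (PMF.uniformOfFinset _ (M.repairings_nonempty ξ (M.cut E))).bind fun ζ =>
      (PMF.uniformOfFinset _ (M.siblings_nonempty (ζ.1 y))).map fun z => (ζ, M.cut E, z)

/-- Trajectories up to time `t`. -/
abbrev Path (t : ℕ) : Type := Fin (t + 1) → M.State

/-- Law of the trajectory up to time `t` of the chain started from `(η, x)` (with `R_0 = ∅`). -/
noncomputable def pathLaw (η : M.Conf) (x : M.HalfEdge) : (t : ℕ) → PMF (M.Path t)
  | 0 => PMF.pure fun _ => (η, ∅, x)
  | t + 1 => (pathLaw η x t).bind fun w =>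
      (M.step (w (Fin.last t)).1 (w (Fin.last t)).2.2).map fun s =>
        (Fin.snoc w s : Fin (t + 2) → M.State)

variable {M}

/-- The set `R_s` of half-edges rewired at time `s`. -/
def Path.rewired {t : ℕ} (w : M.Path t) (s : Fin (t + 1)) : Finset M.HalfEdge := (w s).2.1

/-- The position `X_s` of the walk at time `s`. -/
def Path.pos {t : ℕ} (w : M.Path t) (s : Fin (t + 1)) : M.HalfEdge := (w s).2.2

/-- `R_{≤ s} = R_1 ∪ ⋯ ∪ R_s`. -/
def Path.rewiredUpTo {t : ℕ} (w : M.Path t) (s : Fin (t + 1)) : Set M.HalfEdge :=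
  {h | ∃ r : Fin (t + 1), 0 < r ∧ r ≤ s ∧ h ∈ Path.rewired w r}

/-- The first time `s ≥ 1` with `X_{s-1} ∈ R_{≤ s}`, and `⊤` if there is none up to the horizon `t`
of the trajectory. The events `τ ≤ t` and `τ > t` depend on the trajectory up to time `t` only. -/
noncomputable def Path.tau {t : ℕ} (w : M.Path t) : ℕ∞ :=
  sInf {r : ℕ∞ | ∃ s : Fin t,
    Path.pos w s.castSucc ∈ Path.rewiredUpTo w s.succ ∧ r = ((s : ℕ) + 1 : ℕ)}

variable (M)

/-- Probability, for the chain started from `(η, x)`, of an event determined by time `t`. -/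
noncomputable def prob (η : M.Conf) (x : M.HalfEdge) (t : ℕ) (A : Set (M.Path t)) : ℝ :=
  ((M.pathLaw η x t).toOuterMeasure A).toReal

/-- Conditional law of `X_t` given the event `A` (meaningful if `A` has positive probability). -/
noncomputable def condLaw (η : M.Conf) (x : M.HalfEdge) (t : ℕ) (A : Set (M.Path t)) :
    M.HalfEdge → ℝ :=
  fun y => M.prob η x t ({w | Path.pos w (Fin.last t) = y} ∩ A) / M.prob η x t A

/-- The uniform distribution on half-edges. -/
noncomputable def unif : M.HalfEdge → ℝ := fun _ => 1 / (M.ell : ℝ)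

/-- Measure of a set of initial conditions `(η, x)` under the uniform distribution `μ_n`. -/
noncomputable def initMeasure (S : Set (M.Conf × M.HalfEdge)) : ℝ :=
  (S.ncard : ℝ) / (Nat.card (M.Conf × M.HalfEdge) : ℝ)

end DynConfModel

/-- Total variation distance of two probability mass functions on a finite set. -/
noncomputable def tvDist {S : Type*} [Fintype S] (p q : S → ℝ) : ℝ :=
  (1 / 2) * ∑ x, |p x - q x|

/-!
All estimates are for fixed `n`. When the walk first crosses an edge rewired at an earlier or the
present time, the partner of its position is nearly exchangeable among the half-edges it has not
used. Exchanging the edge `{a, ξ a}` of the partner with the edge `{b, ξ b}` of a uniform half-edge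
`b` changes the later steps only if the walk returns to one of these two edges. Hence, up to the
probability of such a return, the walk is uniform from that step on. By exchangeability of the
half-edges under the uniform initial law, returns have probability `O(t² / ℓ)` on average.

On `τ > t` the walk follows the edges of the initial configuration: it stays in a ball that contains
on average at most `(2 ν + 3) ^ t = n ^ {o(1)}` half-edges, up to constants. As long as it uses
distinct edges, the probability that none of the `j` edges it meets in the first `j` steps have been
rewired by then is computed by successive choices of the rewired edges, and gives the factors
`(1 - α) ^ j`.

Markov's inequality for the mean of the errors over the initial pair yields the typical pairs.
-/

open scoped BigOperators

section Averages

variable {α : Type*}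

theorem sum_expect_of_symm {T : Finset α} {s : α → Finset α} (hne : ∀ x ∈ T, (s x).Nonempty)
    (hsub : ∀ x ∈ T, s x ⊆ T) (hsymm : ∀ x ∈ T, ∀ y ∈ s x, x ∈ s y)
    (hcard : ∀ x ∈ T, ∀ y ∈ s x, (s y).card = (s x).card) (g : α → ℝ) :
    ∑ x ∈ T, 𝔼 y ∈ s x, g y = ∑ y ∈ T, g y := by
  calc ∑ x ∈ T, 𝔼 y ∈ s x, g y
      = ∑ x ∈ T, ∑ y ∈ s x, g y / (s y).card := by
        refine Finset.sum_congr rfl fun x hx => ?_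
        rw [Finset.expect_eq_sum_div_card, Finset.sum_div]
        exact Finset.sum_congr rfl fun y hy => by rw [hcard x hx y hy]
    _ = ∑ y ∈ T, ∑ _x ∈ s y, g y / (s y).card :=
        Finset.sum_comm' fun x y =>
          ⟨fun h => ⟨hsymm x h.1 y h.2, hsub x h.1 h.2⟩,
            fun h => ⟨hsub y h.2 h.1, hsymm y h.2 x h.1⟩⟩
    _ = ∑ y ∈ T, g y := by
        refine Finset.sum_congr rfl fun y hy => ?_
        have hy0 : ((s y).card : ℝ) ≠ 0 := by exact_mod_cast (hne y hy).card_pos.ne'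
        rw [Finset.sum_const, nsmul_eq_mul, mul_div_cancel₀ _ hy0]

theorem expect_mem_Icc {s : Finset α} (hs : s.Nonempty) {f : α → ℝ}
    (h : ∀ x ∈ s, f x ∈ Set.Icc (0 : ℝ) 1) : 𝔼 x ∈ s, f x ∈ Set.Icc (0 : ℝ) 1 :=
  ⟨Finset.expect_nonneg fun x hx => (h x hx).1, Finset.expect_le hs fun x hx => (h x hx).2⟩

theorem abs_expect_le_of_forall_abs_le {s : Finset α} (hs : s.Nonempty) {f : α → ℝ} {K : ℝ}
    (h : ∀ x ∈ s, |f x| ≤ K) : |𝔼 x ∈ s, f x| ≤ K :=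
  (Finset.abs_expect_le _ _).trans (Finset.expect_le hs h)

theorem ncard_mul_le_sum [Fintype α] {f : α → ℝ} (hf : ∀ x, 0 ≤ f x) {a : ℝ} {B : Set α}
    (hB : ∀ x ∈ B, a ≤ f x) : (B.ncard : ℝ) * a ≤ ∑ x, f x := by
  classical
  rw [Set.ncard_eq_toFinset_card', ← nsmul_eq_mul]
  exact (Finset.card_nsmul_le_sum _ f a fun x hx => hB x (Set.mem_toFinset.1 hx)).trans
    (Finset.sum_le_univ_sum_of_nonneg hf)

theorem abs_sum_compl_le [Fintype α] [DecidableEq α] {g h : α → ℝ} {K : ℝ}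
    (hK : ∀ x, |g x| ≤ K) (hg : ∑ x, g x = 0) (s : Finset α) :
    |∑ x ∈ sᶜ, h x| ≤ K * s.card + ∑ x, |h x - g x| := by
  have hsplit : ∑ x ∈ sᶜ, h x = -∑ x ∈ s, g x + ∑ x ∈ sᶜ, (h x - g x) := by
    rw [Finset.sum_sub_distrib]
    linarith [Finset.sum_add_sum_compl s g]
  rw [hsplit]
  refine (abs_add_le _ _).trans (add_le_add ?_ ?_)
  · rw [abs_neg, mul_comm, ← nsmul_eq_mul]
    exact (Finset.abs_sum_le_sum_abs _ _).trans (Finset.sum_le_card_nsmul _ _ _ fun x _ => hK x)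
  · exact (Finset.abs_sum_le_sum_abs _ _).trans
      (Finset.sum_le_univ_sum_of_nonneg fun _ => abs_nonneg _)

theorem exists_sum_abs_eq_sum_mul {ι : Type*} [Fintype ι] {g : ι → ℝ} (hg : ∑ y, g y = 0) :
    ∃ f : ι → ℝ, (∀ y, |f y| ≤ 2) ∧ ∑ y, f y = 0 ∧ ∑ y, |g y| = ∑ y, f y * g y := by
  set σ : ι → ℝ := fun y => SignType.sign (g y) with hσ
  have hσ1 : ∀ y, |σ y| ≤ 1 := fun y => by
    rcases lt_trichotomy (g y) 0 with h | h | h <;> simp [hσ, h]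
  refine ⟨fun y => σ y - 𝔼 z, σ z, fun y => ?_, by simp [Finset.sum_sub_distrib], ?_⟩
  · have hmean : |𝔼 z, σ z| ≤ 1 := by
      have : Nonempty ι := ⟨y⟩
      exact abs_expect_le_of_forall_abs_le Finset.univ_nonempty fun z _ => hσ1 z
    exact (abs_sub _ _).trans (by linarith [hσ1 y])
  · simp only [sub_mul, Finset.sum_sub_distrib]
    rw [← Finset.mul_sum, hg, mul_zero, sub_zero]
    exact Finset.sum_congr rfl fun y _ => (sign_mul_self (g y)).symm

theorem one_sub_sum_le_tvDist {S : Type*} [Fintype S] {p q : S → ℝ} (hp : ∑ x, p x = 1)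
    (hq : ∑ x, q x = 1) {s : Finset S} (hs : ∀ x ∉ s, p x = 0) :
    1 - ∑ x ∈ s, q x ≤ tvDist p q := by
  classical
  have hp' : ∑ x ∈ s, p x = 1 := by
    rw [Finset.sum_subset s.subset_univ fun x _ hx => hs x hx, hp]
  have hin : 1 - ∑ x ∈ s, q x ≤ ∑ x ∈ s, |p x - q x| := by
    rw [← hp', ← Finset.sum_sub_distrib]
    exact Finset.sum_le_sum fun x _ => le_abs_self _
  have hout : 1 - ∑ x ∈ s, q x ≤ ∑ x ∈ sᶜ, |p x - q x| := by
    rw [← hq, ← Finset.sum_add_sum_compl s q, add_sub_cancel_left]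
    refine Finset.sum_le_sum fun x hx => ?_
    rw [hs x (Finset.mem_compl.1 hx), zero_sub, abs_neg]
    exact le_abs_self _
  rw [tvDist, ← Finset.sum_add_sum_compl s]
  linarith

end Averages

theorem abs_mul_sub_mul_le {a b c d : ℝ} (ha : |a| ≤ 1) (hd : |d| ≤ 1) :
    |a * b - c * d| ≤ |a - c| + |b - d| := by
  calc |a * b - c * d| = |a * (b - d) + (a - c) * d| := by ring_nf
    _ ≤ |a| * |b - d| + |a - c| * |d| := by
        simpa only [abs_mul] using abs_add_le (a * (b - d)) ((a - c) * d)
    _ ≤ |a - c| + |b - d| := by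
        nlinarith [abs_nonneg (b - d), abs_nonneg (a - c)]

/-- Linear operators on real functions on `α`, used for (sub-)Markov transition operators. -/
abbrev FunOp (α : Type*) := Module.End ℝ (α → ℝ)

namespace FunOp

variable {α : Type*} (P : FunOp α) {Q : FunOp α}

theorem apply_add (φ ψ : α → ℝ) (x : α) : P (fun y => φ y + ψ y) x = P φ x + P ψ x :=
  congrFun (map_add P φ ψ) x

theorem apply_sub (φ ψ : α → ℝ) (x : α) : P (fun y => φ y - ψ y) x = P φ x - P ψ x :=
  congrFun (map_sub P φ ψ) x

theorem apply_const_mul (a : ℝ) (φ : α → ℝ) (x : α) : P (fun y => a * φ y) x = a * P φ x :=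
  congrFun (map_smul P a φ) x

theorem apply_congr {φ ψ : α → ℝ} (h : ∀ y, φ y = ψ y) (x : α) : P φ x = P ψ x := by
  rw [funext h]

theorem apply_sum {ι : Type*} (s : Finset ι) (φ : ι → α → ℝ) (x : α) :
    P (fun y => ∑ i ∈ s, φ i y) x = ∑ i ∈ s, P (φ i) x := by
  rw [← Finset.sum_apply, ← map_sum]
  exact apply_congr P (fun y => by simp) x

theorem apply_expect {ι : Type*} (s : Finset ι) (φ : ι → α → ℝ) (x : α) :
    P (fun y => 𝔼 i ∈ s, φ i y) x = 𝔼 i ∈ s, P (φ i) x := by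
  simp only [Finset.expect_eq_sum_div_card, div_eq_inv_mul, apply_const_mul, apply_sum]

/-- Positive operators: those preserving nonnegativity. -/
def IsPositive : Prop :=
  ∀ φ : α → ℝ, (∀ y, 0 ≤ φ y) → ∀ x, 0 ≤ P φ x

variable {P}

theorem IsPositive.mono (hP : P.IsPositive) {φ ψ : α → ℝ} (h : ∀ y, φ y ≤ ψ y) (x : α) :
    P φ x ≤ P ψ x := by
  have := hP (fun y => ψ y - φ y) (fun y => sub_nonneg.2 (h y)) x
  rw [apply_sub] at this
  linarith

theorem IsPositive.abs_le (hP : P.IsPositive) {φ ψ : α → ℝ} (h : ∀ y, |φ y| ≤ ψ y) (x : α) :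
    |P φ x| ≤ P ψ x := by
  rw [_root_.abs_le]
  constructor
  · have := hP.mono (φ := fun y => (-1) * ψ y) (ψ := φ)
      (fun y => by linarith [(_root_.abs_le.1 (h y)).1]) x
    rw [apply_const_mul] at this
    linarith
  · exact hP.mono (fun y => (_root_.abs_le.1 (h y)).2) x

theorem IsPositive.mul (hP : P.IsPositive) (hQ : Q.IsPositive) : IsPositive (P * Q) :=
  fun φ h x => hP _ (hQ φ h) x

variable (P) in
/-- Markov operators: positive operators that fix the constant functions. -/
structure IsMarkov : Prop where
  nonneg : P.IsPositive
  one : ∀ x, P (fun _ => 1) x = 1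

namespace IsMarkov

theorem mono (hP : P.IsMarkov) {φ ψ : α → ℝ} (h : ∀ y, φ y ≤ ψ y) (x : α) : P φ x ≤ P ψ x :=
  hP.nonneg.mono h x

theorem const (hP : P.IsMarkov) (a : ℝ) (x : α) : P (fun _ => a) x = a := by
  simpa [hP.one] using P.apply_const_mul a (fun _ => 1) x

theorem le_const (hP : P.IsMarkov) {φ : α → ℝ} {a : ℝ} (h : ∀ y, φ y ≤ a) (x : α) : P φ x ≤ a :=
  (hP.mono h x).trans (hP.const a x).le

theorem mem_Icc (hP : P.IsMarkov) {φ : α → ℝ} (h : ∀ y, φ y ∈ Set.Icc (0 : ℝ) 1) (x : α) :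
    P φ x ∈ Set.Icc (0 : ℝ) 1 :=
  ⟨hP.nonneg φ (fun y => (h y).1) x, hP.le_const (fun y => (h y).2) x⟩

theorem abs_le (hP : P.IsMarkov) (φ : α → ℝ) (x : α) : |P φ x| ≤ P (fun y => |φ y|) x :=
  hP.nonneg.abs_le (fun _ => le_rfl) x

theorem one_isMarkov : IsMarkov (1 : FunOp α) where
  nonneg _ h x := h x
  one _ := rfl

theorem mul (hP : P.IsMarkov) (hQ : Q.IsMarkov) : IsMarkov (P * Q) where
  nonneg := hP.nonneg.mul hQ.nonneg
  one x := by rw [Module.End.mul_apply, funext hQ.one, hP.one]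

end IsMarkov

end FunOp

section PMFExpectation

/-- Expectation with respect to a probability mass function on a finite type. -/
noncomputable def pmfExp {α : Type*} [Fintype α] (p : PMF α) (F : α → ℝ) : ℝ :=
  ∑ a, (p a).toReal * F a

variable {α β : Type*} [Fintype α] [Fintype β]

theorem pmfExp_congr {p : PMF α} {F G : α → ℝ} (h : ∀ a ∈ p.support, F a = G a) :
    pmfExp p F = pmfExp p G := by
  refine Finset.sum_congr rfl fun a _ => ?_
  by_cases ha : p a = 0
  · simp [ha]
  · rw [h a ((p.mem_support_iff a).2 ha)]

theorem pmfExp_bind (p : PMF α) (f : α → PMF β) (F : β → ℝ) :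
    pmfExp (p.bind f) F = pmfExp p fun a => pmfExp (f a) F := by
  simp only [pmfExp, PMF.bind_apply, tsum_fintype]
  have h : ∀ b, (∑ a, p a * f a b).toReal = ∑ a, (p a).toReal * (f a b).toReal := by
    intro b
    rw [ENNReal.toReal_sum fun a _ => ENNReal.mul_ne_top (p.apply_ne_top a) ((f a).apply_ne_top b)]
    simp only [ENNReal.toReal_mul]
  simp only [h, Finset.sum_mul, Finset.mul_sum]
  rw [Finset.sum_comm]
  simp only [mul_assoc]

theorem pmfExp_pure (a : α) (F : α → ℝ) : pmfExp (PMF.pure a) F = F a := by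
  classical
  rw [pmfExp, Finset.sum_eq_single a]
  · simp
  · intro b _ hb
    simp [PMF.pure_apply, hb]
  · simp

theorem pmfExp_map (p : PMF α) (f : α → β) (F : β → ℝ) :
    pmfExp (p.map f) F = pmfExp p fun a => F (f a) := by
  rw [← PMF.bind_pure_comp, pmfExp_bind]
  simp only [Function.comp, pmfExp_pure]

theorem pmfExp_uniformOfFinset {s : Finset α} (hs : s.Nonempty) (F : α → ℝ) :
    pmfExp (PMF.uniformOfFinset s hs) F = 𝔼 a ∈ s, F a := by
  classical
  rw [pmfExp, Finset.expect_eq_sum_div_card, Finset.sum_div,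
    ← Finset.sum_subset (Finset.subset_univ s)]
  · refine Finset.sum_congr rfl fun a ha => ?_
    rw [PMF.uniformOfFinset_apply_of_mem hs ha, ENNReal.toReal_inv, ENNReal.toReal_natCast,
      div_eq_inv_mul]
  · intro a _ ha
    rw [PMF.uniformOfFinset_apply_of_notMem hs ha]
    simp

theorem pmfExp_add (p : PMF α) (F G : α → ℝ) :
    pmfExp p (fun a => F a + G a) = pmfExp p F + pmfExp p G := by
  simp only [pmfExp, mul_add, Finset.sum_add_distrib]

theorem pmfExp_sub (p : PMF α) (F G : α → ℝ) :
    pmfExp p (fun a => F a - G a) = pmfExp p F - pmfExp p G := by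
  simp only [pmfExp, mul_sub, Finset.sum_sub_distrib]

theorem pmfExp_sum {ι : Type*} (s : Finset ι) (p : PMF α) (F : ι → α → ℝ) :
    pmfExp p (fun a => ∑ i ∈ s, F i a) = ∑ i ∈ s, pmfExp p (F i) := by
  simp only [pmfExp, Finset.mul_sum]
  exact Finset.sum_comm

theorem pmfExp_const_mul (p : PMF α) (c : ℝ) (F : α → ℝ) :
    pmfExp p (fun a => c * F a) = c * pmfExp p F := by
  simp only [pmfExp, Finset.mul_sum]
  exact Finset.sum_congr rfl fun a _ => by ring

theorem pmfExp_const (p : PMF α) (c : ℝ) : pmfExp p (fun _ => c) = c := by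
  rw [pmfExp, ← Finset.sum_mul]
  have h : ∑ a, (p a).toReal = 1 := by
    rw [← ENNReal.toReal_sum fun a _ => p.apply_ne_top a, ← tsum_fintype (L := .unconditional α),
      p.tsum_coe, ENNReal.toReal_one]
  rw [h, one_mul]

end PMFExpectation

namespace DynConfModel

variable {n : ℕ} (M : DynConfModel n)

/-! ### Half-edges and configurations -/

theorem card_halfEdge : Fintype.card M.HalfEdge = M.ell := by
  simp [ell]

theorem ell_eq : M.ell = 2 * M.m := by
  obtain ⟨r, hr⟩ := M.even_sum
  unfold m ell
  omega

theorem k_le_m : M.k ≤ M.m := M.k_le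

theorem m_pos : 0 < M.m := lt_of_lt_of_le (by have := M.two_le_k; omega) M.k_le_m

theorem ell_pos : 0 < M.ell := by
  have := M.m_pos
  have := M.ell_eq
  omega

theorem mem_siblings {x y : M.HalfEdge} : y ∈ M.siblings x ↔ y.1 = x.1 ∧ y ≠ x := by
  simp [siblings]

theorem mem_siblings_comm {x y : M.HalfEdge} : y ∈ M.siblings x ↔ x ∈ M.siblings y := by
  simp only [mem_siblings, eq_comm, ne_comm]

theorem card_filter_vertex_eq (v : Fin n) :
    (Finset.univ.filter fun y : M.HalfEdge => y.1 = v).card = M.d v := by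
  rw [← Fintype.card_subtype, Fintype.card_congr (Equiv.sigmaSubtype v), Fintype.card_fin]

theorem card_siblings (x : M.HalfEdge) : (M.siblings x).card = M.d x.1 - 1 := by
  have h : M.siblings x = (Finset.univ.filter fun y : M.HalfEdge => y.1 = x.1).erase x := by
    ext y
    simp [mem_siblings, and_comm]
  rw [h, Finset.card_erase_of_mem (by simp), card_filter_vertex_eq]

variable {M}

theorem sum_expect_siblings (g : M.HalfEdge → ℝ) : ∑ z, 𝔼 w ∈ M.siblings z, g w = ∑ w, g w :=
  sum_expect_of_symm (fun z _ => M.siblings_nonempty z) (fun _ _ => Finset.subset_univ _)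
    (fun _ _ _ hw => M.mem_siblings_comm.1 hw)
    (fun z _ w hw => by rw [card_siblings, card_siblings, (M.mem_siblings.1 hw).1]) g

@[simp] theorem conf_conf (ξ : M.Conf) (x : M.HalfEdge) : ξ.1 (ξ.1 x) = x := ξ.2.1 x

theorem conf_ne (ξ : M.Conf) (x : M.HalfEdge) : ξ.1 x ≠ x := ξ.2.2 x

theorem conf_eq_iff (ξ : M.Conf) {x y : M.HalfEdge} : ξ.1 x = y ↔ ξ.1 y = x := by
  constructor <;> rintro rfl <;> simp

theorem sum_conf (ξ : M.Conf) (g : M.HalfEdge → ℝ) : ∑ x, g (ξ.1 x) = ∑ x, g x :=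
  Equiv.sum_comp ξ.1 g

/-- Relabelling of a configuration by a permutation of the half-edges. -/
def conj (π : Equiv.Perm M.HalfEdge) : M.Conf ≃ M.Conf where
  toFun ξ := ⟨π * ξ.1 * π⁻¹, fun x => by simp, fun x h => by
    have h' : ξ.1 (π⁻¹ x) = π⁻¹ x := by
      rw [Equiv.Perm.eq_inv_iff_eq]; simpa using h
    exact ξ.2.2 _ h'⟩
  invFun ξ := ⟨π⁻¹ * ξ.1 * π, fun x => by simp, fun x h => by
    have h' : ξ.1 (π x) = π x := by
      rw [← Equiv.Perm.inv_eq_iff_eq]; simpa using h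
    exact ξ.2.2 _ h'⟩
  left_inv ξ := by
    apply Subtype.ext; simp [mul_assoc]
  right_inv ξ := by
    apply Subtype.ext; simp [mul_assoc]

theorem conj_apply (π : Equiv.Perm M.HalfEdge) (ξ : M.Conf) (x : M.HalfEdge) :
    (conj π ξ).1 x = π (ξ.1 (π⁻¹ x)) := rfl

theorem conj_apply_perm (π : Equiv.Perm M.HalfEdge) (ξ : M.Conf) (x : M.HalfEdge) :
    (conj π ξ).1 (π x) = π (ξ.1 x) := by simp [conj_apply]

theorem conj_apply_of_fixed {π : Equiv.Perm M.HalfEdge} (ξ : M.Conf) {x : M.HalfEdge}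
    (h : π x = x) : (conj π ξ).1 x = π (ξ.1 x) := by
  conv_lhs => rw [← h]
  exact conj_apply_perm π ξ x

theorem conj_eq_self {π : Equiv.Perm M.HalfEdge} {ξ : M.Conf} (h : ∀ x, π (ξ.1 x) = ξ.1 (π x)) :
    conj π ξ = ξ := by
  apply Subtype.ext
  ext1 x
  rw [conj_apply, h]
  simp

/-! ### Rewired half-edges -/

variable (M) in
/-- The possible values, from the configuration `ξ`, of the set of rewired half-edges. They
correspond to the choices of `k` edges through `cut`. -/
def rewirings (ξ : M.Conf) : Finset (Finset M.HalfEdge) :=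
  Finset.univ.filter fun R => R.card = 2 * M.k ∧ ∀ x ∈ R, ξ.1 x ∈ R

theorem mem_rewirings {ξ : M.Conf} {R : Finset M.HalfEdge} :
    R ∈ M.rewirings ξ ↔ R.card = 2 * M.k ∧ ∀ x ∈ R, ξ.1 x ∈ R := by simp [rewirings]

theorem mem_repairings {ξ ζ : M.Conf} {R : Finset M.HalfEdge} :
    ζ ∈ M.repairings ξ R ↔ ∀ x, x ∉ R → ζ.1 x = ξ.1 x := by simp [repairings]

theorem mem_edges {ξ : M.Conf} {e : Sym2 M.HalfEdge} :
    e ∈ M.edges ξ ↔ ∃ x, s(x, ξ.1 x) = e := by simp [edges]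

theorem mem_cut_of_subset {ξ : M.Conf} {E : Finset (Sym2 M.HalfEdge)} (hE : E ⊆ M.edges ξ)
    {x : M.HalfEdge} : x ∈ M.cut E ↔ s(x, ξ.1 x) ∈ E := by
  simp only [cut, Finset.mem_filter, Finset.mem_univ, true_and]
  constructor
  · rintro ⟨e, he, hx⟩
    obtain ⟨y, rfl⟩ := mem_edges.1 (hE he)
    rcases Sym2.mem_iff.1 hx with rfl | rfl
    · exact he
    · rwa [conf_conf, Sym2.eq_swap]
  · intro h
    exact ⟨_, h, Sym2.mem_mk_left _ _⟩

theorem cut_injOn (ξ : M.Conf) : Set.InjOn M.cut {E | E ⊆ M.edges ξ} := by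
  intro E hE E' hE' h
  ext e
  constructor
  · intro he
    obtain ⟨x, rfl⟩ := mem_edges.1 (hE he)
    rwa [← mem_cut_of_subset hE', ← h, mem_cut_of_subset hE]
  · intro he
    obtain ⟨x, rfl⟩ := mem_edges.1 (hE' he)
    rwa [← mem_cut_of_subset hE, h, mem_cut_of_subset hE']

theorem card_cut {ξ : M.Conf} {E : Finset (Sym2 M.HalfEdge)} (hE : E ⊆ M.edges ξ) :
    (M.cut E).card = 2 * E.card := by
  rw [Finset.card_eq_sum_card_fiberwise (f := fun x => s(x, ξ.1 x)) (t := E)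
    (fun x hx => (mem_cut_of_subset hE).1 hx), mul_comm]
  refine Finset.sum_const_nat fun e he => ?_
  obtain ⟨x, rfl⟩ := mem_edges.1 (hE he)
  have : (M.cut E).filter (fun y => s(y, ξ.1 y) = s(x, ξ.1 x)) = {x, ξ.1 x} := by
    ext y
    simp only [Finset.mem_filter, Finset.mem_insert, Finset.mem_singleton, mem_cut_of_subset hE]
    constructor
    · rintro ⟨-, h⟩
      have : y ∈ s(x, ξ.1 x) := h ▸ Sym2.mem_mk_left _ _
      simpa using this
    · rintro (rfl | rfl)
      · exact ⟨he, rfl⟩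
      · rw [conf_conf, Sym2.eq_swap]
        exact ⟨he, rfl⟩
  rw [this, Finset.card_pair (conf_ne ξ x).symm]

theorem exists_cut_eq {ξ : M.Conf} {R : Finset M.HalfEdge} (hR : ∀ x ∈ R, ξ.1 x ∈ R) :
    ∃ E ⊆ M.edges ξ, M.cut E = R := by
  refine ⟨R.image fun x => s(x, ξ.1 x), ?_, ?_⟩
  · intro e he
    obtain ⟨x, -, rfl⟩ := Finset.mem_image.1 he
    exact mem_edges.2 ⟨x, rfl⟩
  · ext x
    simp only [cut, Finset.mem_filter, Finset.mem_univ, true_and, Finset.mem_image]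
    constructor
    · rintro ⟨e, ⟨y, hy, rfl⟩, hx⟩
      rcases Sym2.mem_iff.1 hx with rfl | rfl
      · exact hy
      · exact hR _ hy
    · intro hx
      exact ⟨_, ⟨x, hx, rfl⟩, Sym2.mem_mk_left _ _⟩

theorem image_cut (ξ : M.Conf) :
    ((M.edges ξ).powersetCard M.k).image M.cut = M.rewirings ξ := by
  ext R
  simp only [Finset.mem_image, Finset.mem_powersetCard, mem_rewirings]
  constructor
  · rintro ⟨E, ⟨hE, hk⟩, rfl⟩
    refine ⟨by rw [card_cut hE, hk], fun x hx => ?_⟩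
    rw [mem_cut_of_subset hE] at hx ⊢
    rwa [conf_conf, Sym2.eq_swap]
  · rintro ⟨hk, hR⟩
    obtain ⟨E, hE, rfl⟩ := exists_cut_eq hR
    rw [card_cut hE] at hk
    exact ⟨E, ⟨hE, by omega⟩, rfl⟩

theorem card_rewirings_disjoint {ξ : M.Conf} {B : Finset M.HalfEdge}
    (hB : ∀ x ∈ B, ξ.1 x ∉ B) :
    ((M.rewirings ξ).filter fun R => Disjoint R B).card = (M.m - B.card).choose M.k := by
  have hs : B.image (fun x => s(x, ξ.1 x)) ⊆ M.edges ξ := by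
    intro e he
    obtain ⟨x, -, rfl⟩ := Finset.mem_image.1 he
    exact mem_edges.2 ⟨x, rfl⟩
  have hc : (B.image (fun x => s(x, ξ.1 x))).card = B.card := by
    refine Finset.card_image_of_injOn fun x hx y hy h => ?_
    rcases Sym2.eq_iff.1 h with h | h
    · exact h.1
    · exfalso
      apply hB _ hy
      rw [← h.1]
      exact hx
  have h : (M.rewirings ξ).filter (fun R => Disjoint R B)
      = ((M.edges ξ \ B.image fun x => s(x, ξ.1 x)).powersetCard M.k).image M.cut := by
    ext R
    rw [← image_cut]
    simp only [Finset.mem_filter, Finset.mem_image, Finset.mem_powersetCard]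
    constructor
    · rintro ⟨⟨E, ⟨hE, hk⟩, rfl⟩, hd⟩
      refine ⟨E, ⟨fun e he => Finset.mem_sdiff.2 ⟨hE he, fun hb => ?_⟩, hk⟩, rfl⟩
      obtain ⟨x, hx, rfl⟩ := Finset.mem_image.1 hb
      exact Finset.disjoint_left.1 hd ((mem_cut_of_subset hE).2 he) hx
    · rintro ⟨E, ⟨hE, hk⟩, rfl⟩
      have hE' : E ⊆ M.edges ξ := hE.trans Finset.sdiff_subset
      refine ⟨⟨E, ⟨hE', hk⟩, rfl⟩, Finset.disjoint_left.2 fun x hx hxB => ?_⟩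
      exact (Finset.mem_sdiff.1 (hE ((mem_cut_of_subset hE').1 hx))).2
        (Finset.mem_image_of_mem _ hxB)
  rw [h, Finset.card_image_of_injOn, Finset.card_powersetCard, Finset.card_sdiff_of_subset hs,
    card_edges, hc]
  exact (cut_injOn ξ).mono fun _ hE =>
    (Finset.mem_powersetCard.1 hE).1.trans Finset.sdiff_subset

theorem card_rewirings (ξ : M.Conf) : (M.rewirings ξ).card = M.m.choose M.k := by
  simpa using card_rewirings_disjoint (ξ := ξ) (B := ∅) (by simp)

theorem rewirings_nonempty (ξ : M.Conf) : (M.rewirings ξ).Nonempty := by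
  rw [← image_cut]
  exact (M.edgeChoices_nonempty ξ).image _

theorem map_mem_rewirings {π : Equiv.Perm M.HalfEdge} {ξ : M.Conf} {R : Finset M.HalfEdge} :
    R.map π.toEmbedding ∈ M.rewirings (conj π ξ) ↔ R ∈ M.rewirings ξ := by
  simp only [mem_rewirings, Finset.card_map, Finset.mem_map, Equiv.coe_toEmbedding,
    forall_exists_index, and_imp, forall_apply_eq_imp_iff₂, conj_apply_perm,
    EmbeddingLike.apply_eq_iff_eq, exists_eq_right]

theorem conj_mem_repairings {π : Equiv.Perm M.HalfEdge} {ξ ζ : M.Conf} {R : Finset M.HalfEdge} :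
    conj π ζ ∈ M.repairings (conj π ξ) (R.map π.toEmbedding) ↔ ζ ∈ M.repairings ξ R := by
  simp only [mem_repairings]
  constructor
  · intro h x hx
    have := h (π x) (by simpa using hx)
    rwa [conj_apply_perm, conj_apply_perm, EmbeddingLike.apply_eq_iff_eq] at this
  · intro h x hx
    rw [conj_apply, conj_apply, h]
    intro hx'
    exact hx (Finset.mem_map.2 ⟨_, hx', by simp⟩)

theorem repairings_congr {ξ ζ : M.Conf} {R : Finset M.HalfEdge} (h : ζ ∈ M.repairings ξ R) :
    M.repairings ζ R = M.repairings ξ R := by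
  ext θ
  rw [mem_repairings] at h
  simp only [mem_repairings]
  exact forall₂_congr fun x hx => by rw [h x hx]

theorem repairings_symm {ξ ζ : M.Conf} {R : Finset M.HalfEdge} :
    ζ ∈ M.repairings ξ R ↔ ξ ∈ M.repairings ζ R := by
  simp only [mem_repairings, eq_comm]

theorem apply_mem_of_mem_repairings {ξ ζ : M.Conf} {R : Finset M.HalfEdge}
    (hR : ∀ x ∈ R, ξ.1 x ∈ R) (h : ζ ∈ M.repairings ξ R) {x : M.HalfEdge} (hx : x ∈ R) :
    ζ.1 x ∈ R := by
  by_contra hn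
  have h1 := mem_repairings.1 h _ hn
  rw [conf_conf, eq_comm, conf_eq_iff] at h1
  exact hn (h1 ▸ hR x hx)

theorem mem_rewirings_of_mem_repairings {ξ ζ : M.Conf} {R : Finset M.HalfEdge}
    (hR : R ∈ M.rewirings ξ) (h : ζ ∈ M.repairings ξ R) : R ∈ M.rewirings ζ := by
  rw [mem_rewirings] at hR ⊢
  exact ⟨hR.1, fun x hx => apply_mem_of_mem_repairings hR.2 h hx⟩

theorem conj_mem_repairings_of_fixed {π : Equiv.Perm M.HalfEdge} {ξ ζ : M.Conf}
    {R : Finset M.HalfEdge} (hR : ∀ x ∈ R, ξ.1 x ∈ R) (hπ : ∀ x, x ∉ R → π x = x) :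
    conj π ζ ∈ M.repairings ξ R ↔ ζ ∈ M.repairings ξ R := by
  simp only [mem_repairings]
  refine forall₂_congr fun x hx => ?_
  have hξx : ξ.1 x ∉ R := fun h => hx (by simpa using hR _ h)
  rw [conj_apply_of_fixed _ (hπ x hx)]
  conv_lhs => rw [← hπ _ hξx, EmbeddingLike.apply_eq_iff_eq]

theorem expect_repairings_partner_eq {ξ : M.Conf} {R : Finset M.HalfEdge}
    (hR : ∀ x ∈ R, ξ.1 x ∈ R) {u a b : M.HalfEdge} (ha : a ∈ R.erase u) (hb : b ∈ R.erase u) :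
    (𝔼 ζ ∈ M.repairings ξ R, if ζ.1 u = b then (1 : ℝ) else 0)
      = 𝔼 ζ ∈ M.repairings ξ R, if ζ.1 u = a then (1 : ℝ) else 0 := by
  rw [Finset.mem_erase] at ha hb
  refine Finset.expect_equiv (conj (Equiv.swap a b)) (fun ζ => ?_) fun ζ _ => ?_
  · exact (conj_mem_repairings_of_fixed hR fun x hx =>
      Equiv.swap_apply_of_ne_of_ne (fun h => hx (h ▸ ha.2)) fun h => hx (h ▸ hb.2)).symm
  · rw [conj_apply_of_fixed _ (Equiv.swap_apply_of_ne_of_ne ha.1.symm hb.1.symm)]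
    congr 1
    rw [eq_iff_iff, Equiv.swap_apply_eq_iff, Equiv.swap_apply_left]

theorem expect_repairings_partner_le {ξ : M.Conf} {R : Finset M.HalfEdge}
    (hR : ∀ x ∈ R, ξ.1 x ∈ R) {u : M.HalfEdge} (hu : u ∈ R) (a : M.HalfEdge) :
    (𝔼 ζ ∈ M.repairings ξ R, if ζ.1 u = a then (1 : ℝ) else 0) ≤ 1 / (R.card - 1) := by
  have hcard : ((R.erase u).card : ℝ) = R.card - 1 := by
    rw [Finset.card_erase_of_mem hu, Nat.cast_pred (Finset.card_pos.2 ⟨u, hu⟩)]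
  rw [← hcard]
  by_cases ha : a ∈ R.erase u
  · have hsum : ∑ b ∈ R.erase u, (𝔼 ζ ∈ M.repairings ξ R, if ζ.1 u = b then (1 : ℝ) else 0)
        ≤ 1 := by
      rw [← Finset.expect_sum_comm]
      refine Finset.expect_le (M.repairings_nonempty ξ R) fun ζ _ => ?_
      rw [Finset.sum_ite_eq]
      split_ifs <;> norm_num
    rw [Finset.sum_congr rfl fun b hb => expect_repairings_partner_eq hR ha hb, Finset.sum_const,
      nsmul_eq_mul] at hsum
    rwa [le_div_iff₀' (by exact_mod_cast Finset.card_pos.2 ⟨a, ha⟩)]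
  · rw [Finset.expect_eq_zero fun ζ hζ => if_neg ?_]
    · positivity
    · rintro rfl
      exact ha (Finset.mem_erase.2 ⟨conf_ne ζ u, apply_mem_of_mem_repairings hR hζ hu⟩)

/-! ### The configuration dynamics -/

/-- Transition operator of one step of the configuration dynamics, restricted to the event that the
set of rewired half-edges satisfies `c`. -/
noncomputable def rewireOp (c : Finset M.HalfEdge → Prop) [DecidablePred c] : FunOp M.Conf where
  toFun φ ξ := 𝔼 R ∈ M.rewirings ξ, if c R then 𝔼 ζ ∈ M.repairings ξ R, φ ζ else 0
  map_add' φ ψ := by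
    ext ξ
    simp only [Pi.add_apply, ← Finset.expect_add_distrib]
    refine Finset.expect_congr rfl fun R _ => ?_
    split_ifs <;> simp [Finset.expect_add_distrib]
  map_smul' r φ := by
    ext ξ
    simp only [Pi.smul_apply, smul_eq_mul, RingHom.id_apply, Finset.mul_expect, mul_ite, mul_zero]

theorem rewireOp_apply (c : Finset M.HalfEdge → Prop) [DecidablePred c] (φ : M.Conf → ℝ)
    (ξ : M.Conf) : rewireOp c φ ξ
      = 𝔼 R ∈ M.rewirings ξ, if c R then 𝔼 ζ ∈ M.repairings ξ R, φ ζ else 0 := rfl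

theorem rewireOp_mono {c c' : Finset M.HalfEdge → Prop} [DecidablePred c] [DecidablePred c']
    (hc : ∀ R, c R → c' R) {φ ψ : M.Conf → ℝ} (h : ∀ ζ, φ ζ ≤ ψ ζ) (h0 : ∀ ζ, 0 ≤ ψ ζ)
    (ξ : M.Conf) : rewireOp c φ ξ ≤ rewireOp c' ψ ξ := by
  rw [rewireOp_apply, rewireOp_apply]
  refine Finset.expect_le_expect fun R _ => ?_
  by_cases h1 : c R
  · rw [if_pos h1, if_pos (hc R h1)]
    exact Finset.expect_le_expect fun ζ _ => h ζ
  · rw [if_neg h1]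
    split_ifs
    · exact Finset.expect_nonneg fun ζ _ => h0 ζ
    · exact le_rfl

theorem rewireOp_isPositive (c : Finset M.HalfEdge → Prop) [DecidablePred c] :
    (rewireOp c).IsPositive := by
  intro φ h ξ
  rw [rewireOp_apply]
  refine Finset.expect_nonneg fun R _ => ?_
  split_ifs
  · exact Finset.expect_nonneg fun ζ _ => h ζ
  · exact le_rfl

theorem rewireOp_congr {c : Finset M.HalfEdge → Prop} [DecidablePred c] {φ ψ : M.Conf → ℝ}
    {ξ : M.Conf} (h : ∀ R, c R → ∀ ζ, (∀ x, x ∉ R → ζ.1 x = ξ.1 x) → φ ζ = ψ ζ) :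
    rewireOp c φ ξ = rewireOp c ψ ξ := by
  rw [rewireOp_apply, rewireOp_apply]
  refine Finset.expect_congr rfl fun R _ => ?_
  split_ifs with hc
  · exact Finset.expect_congr rfl fun ζ hζ => h R hc ζ (mem_repairings.1 hζ)
  · rfl

theorem rewireOp_conj {c : Finset M.HalfEdge → Prop} [DecidablePred c] {π : Equiv.Perm M.HalfEdge}
    (hc : ∀ R, c (R.map π.toEmbedding) ↔ c R) (φ : M.Conf → ℝ) (ξ : M.Conf) :
    rewireOp c (fun ζ => φ (conj π ζ)) ξ = rewireOp c φ (conj π ξ) := by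
  rw [rewireOp_apply, rewireOp_apply]
  refine Finset.expect_equiv (Equiv.finsetCongr π) (fun R => ?_) fun R _ => ?_
  · simp only [Equiv.finsetCongr_apply]
    exact map_mem_rewirings.symm
  · simp only [Equiv.finsetCongr_apply, hc]
    split_ifs
    · exact Finset.expect_equiv (conj π) (fun ζ => conj_mem_repairings.symm) fun _ _ => rfl
    · rfl

variable (M) in
/-- The transition operator of the configuration dynamics. -/
noncomputable def dyn : FunOp M.Conf := rewireOp fun _ => True

theorem dyn_apply (φ : M.Conf → ℝ) (ξ : M.Conf) :
    M.dyn φ ξ = 𝔼 R ∈ M.rewirings ξ, 𝔼 ζ ∈ M.repairings ξ R, φ ζ := by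
  simp only [dyn, rewireOp_apply, if_true]

theorem dyn_one (ξ : M.Conf) : M.dyn (fun _ => 1) ξ = 1 := by
  simp only [dyn_apply, Finset.expect_const (M.repairings_nonempty ξ _),
    Finset.expect_const (rewirings_nonempty ξ)]

theorem sum_expect_repairings (R : Finset M.HalfEdge) (φ : M.Conf → ℝ) :
    ∑ ξ with R ∈ M.rewirings ξ, 𝔼 ζ ∈ M.repairings ξ R, φ ζ
      = ∑ ζ with R ∈ M.rewirings ζ, φ ζ := by
  refine sum_expect_of_symm (fun ξ _ => M.repairings_nonempty ξ R) (fun ξ hξ ζ hζ => ?_)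
    (fun _ _ _ => repairings_symm.1) (fun _ _ _ hζ => by rw [repairings_congr hζ]) φ
  rw [Finset.mem_filter_univ] at hξ ⊢
  exact mem_rewirings_of_mem_repairings hξ hζ

theorem sum_dyn (φ : M.Conf → ℝ) : ∑ ξ, M.dyn φ ξ = ∑ ξ, φ ξ := by
  have hchoose : (M.m.choose M.k : ℝ) ≠ 0 := by exact_mod_cast (Nat.choose_pos M.k_le_m).ne'
  have hswap (f : Finset M.HalfEdge → M.Conf → ℝ) :
      ∑ ξ, ∑ R ∈ M.rewirings ξ, f R ξ = ∑ R, ∑ ξ with R ∈ M.rewirings ξ, f R ξ :=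
    Finset.sum_comm' fun ξ R => by simp
  calc ∑ ξ, M.dyn φ ξ
      = (∑ R, ∑ ξ with R ∈ M.rewirings ξ, 𝔼 ζ ∈ M.repairings ξ R, φ ζ) / M.m.choose M.k := by
        simp only [dyn_apply, Finset.expect_eq_sum_div_card (M.rewirings _), card_rewirings]
        rw [← Finset.sum_div, hswap fun R ξ => 𝔼 ζ ∈ M.repairings ξ R, φ ζ]
    _ = (∑ ξ, ∑ _R ∈ M.rewirings ξ, φ ξ) / M.m.choose M.k := by
        rw [hswap]
        simp only [sum_expect_repairings]
    _ = ∑ ξ, φ ξ := by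
        simp only [Finset.sum_const, card_rewirings, nsmul_eq_mul, ← Finset.mul_sum]
        exact mul_div_cancel_left₀ _ hchoose

/-- Markov operators on configurations that commute with all relabellings of the half-edges and
preserve the uniform distribution. -/
structure IsExchangeable (P : FunOp M.Conf) : Prop extends P.IsMarkov where
  eqv : ∀ (π : Equiv.Perm M.HalfEdge) (φ : M.Conf → ℝ) (ξ : M.Conf),
    P (fun ζ => φ (conj π ζ)) ξ = P φ (conj π ξ)
  sum : ∀ φ : M.Conf → ℝ, ∑ ξ, P φ ξ = ∑ ξ, φ ξ

namespace IsExchangeable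

variable {P Q : FunOp M.Conf}

theorem one_isExchangeable : IsExchangeable (1 : FunOp M.Conf) where
  toIsMarkov := .one_isMarkov
  eqv _ _ _ := rfl
  sum _ := rfl

theorem mul (hP : IsExchangeable P) (hQ : IsExchangeable Q) : IsExchangeable (P * Q) where
  toIsMarkov := hP.toIsMarkov.mul hQ.toIsMarkov
  eqv π φ ξ := by
    rw [Module.End.mul_apply, Module.End.mul_apply, ← hP.eqv]
    exact P.apply_congr (hQ.eqv π φ) ξ
  sum φ := by simp only [Module.End.mul_apply, hP.sum, hQ.sum]

theorem pow (hP : IsExchangeable P) (j : ℕ) : IsExchangeable (P ^ j) := by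
  induction j with
  | zero => exact one_isExchangeable
  | succ j ih => rw [pow_succ]; exact ih.mul hP

end IsExchangeable

theorem isExchangeable_dyn : IsExchangeable M.dyn where
  nonneg := rewireOp_isPositive _
  one := dyn_one
  eqv _ φ ξ := rewireOp_conj (fun _ => Iff.rfl) φ ξ
  sum := sum_dyn

/-! ### Meeting a given half-edge -/

/-- Probability that the walk driven by the operators `Ps` uses one of the half-edges in `D`, either
as a position or as the partner of a position. -/
noncomputable def hit : List (FunOp M.Conf) → Finset M.HalfEdge → M.Conf →
    M.HalfEdge → ℝ
  | [], _, _, _ => 0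
  | P :: Ps, D, ξ, y => if y ∈ D then 1 else
      P (fun ζ => if ζ.1 y ∈ D then 1 else 𝔼 w ∈ M.siblings (ζ.1 y), hit Ps D ζ w) ξ

/-- Probability that the walk driven by the operators `Ps` meets `c` as the partner of a position,
and uses no half-edge in `D` before. -/
noncomputable def firstHit : List (FunOp M.Conf) → Finset M.HalfEdge → M.HalfEdge →
    M.Conf → M.HalfEdge → ℝ
  | [], _, _, _, _ => 0
  | P :: Ps, D, c, ξ, y => if y ∈ D then 0 else
      P (fun ζ => if ζ.1 y = c then 1 else if ζ.1 y ∈ D then 0 else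
        𝔼 w ∈ M.siblings (ζ.1 y), firstHit Ps D c ζ w) ξ

variable {Ps : List (FunOp M.Conf)}

theorem isMarkov_of_isExchangeable (hPs : ∀ P ∈ Ps, IsExchangeable P) : ∀ P ∈ Ps, P.IsMarkov :=
  fun P hP => (hPs P hP).toIsMarkov

theorem hit_mem_Icc (hPs : ∀ P ∈ Ps, P.IsMarkov) (D : Finset M.HalfEdge) (ξ : M.Conf)
    (y : M.HalfEdge) : hit Ps D ξ y ∈ Set.Icc (0 : ℝ) 1 := by
  induction Ps generalizing ξ y with
  | nil => simp [hit]
  | cons P Ps ih =>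
    obtain ⟨hP, hPs'⟩ := List.forall_mem_cons.1 hPs
    rw [hit]
    split_ifs
    · simp
    · refine hP.mem_Icc (fun ζ => ?_) ξ
      split_ifs
      · simp
      · exact expect_mem_Icc (M.siblings_nonempty _) fun w _ => ih hPs' ζ w

theorem firstHit_mem_Icc (hPs : ∀ P ∈ Ps, P.IsMarkov) (D : Finset M.HalfEdge) (c : M.HalfEdge)
    (ξ : M.Conf) (y : M.HalfEdge) : firstHit Ps D c ξ y ∈ Set.Icc (0 : ℝ) 1 := by
  induction Ps generalizing ξ y with
  | nil => simp [firstHit]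
  | cons P Ps ih =>
    obtain ⟨hP, hPs'⟩ := List.forall_mem_cons.1 hPs
    rw [firstHit]
    split_ifs
    · simp
    · refine hP.mem_Icc (fun ζ => ?_) ξ
      split_ifs
      · simp
      · simp
      · exact expect_mem_Icc (M.siblings_nonempty _) fun w _ => ih hPs' ζ w

theorem hit_union_le (hPs : ∀ P ∈ Ps, P.IsMarkov) (D D' : Finset M.HalfEdge) (ξ : M.Conf)
    (y : M.HalfEdge) : hit Ps (D ∪ D') ξ y ≤ hit Ps D ξ y + hit Ps D' ξ y := by
  induction Ps generalizing ξ y with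
  | nil => simp [hit]
  | cons P Ps ih =>
    obtain ⟨hP, hPs'⟩ := List.forall_mem_cons.1 hPs
    have h1 := (hit_mem_Icc hPs D ξ y).1
    have h2 := (hit_mem_Icc hPs D' ξ y).1
    by_cases hy : y ∈ D
    · have : hit (P :: Ps) D ξ y = 1 := by rw [hit, if_pos hy]
      have := (hit_mem_Icc hPs (D ∪ D') ξ y).2
      linarith
    by_cases hy' : y ∈ D'
    · have : hit (P :: Ps) D' ξ y = 1 := by rw [hit, if_pos hy']
      have := (hit_mem_Icc hPs (D ∪ D') ξ y).2
      linarith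
    rw [hit, hit, hit, if_neg hy, if_neg hy', if_neg (by simp [hy, hy']),
      ← FunOp.apply_add]
    refine hP.mono (fun ζ => ?_) ξ
    have e1 : 0 ≤ 𝔼 w ∈ M.siblings (ζ.1 y), hit Ps D ζ w :=
      Finset.expect_nonneg fun w _ => (hit_mem_Icc hPs' D ζ w).1
    have e2 : 0 ≤ 𝔼 w ∈ M.siblings (ζ.1 y), hit Ps D' ζ w :=
      Finset.expect_nonneg fun w _ => (hit_mem_Icc hPs' D' ζ w).1
    by_cases h3 : ζ.1 y ∈ D
    · rw [if_pos (by simp [h3]), if_pos h3]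
      split_ifs <;> linarith
    by_cases h4 : ζ.1 y ∈ D'
    · rw [if_pos (by simp [h4]), if_pos h4, if_neg h3]
      linarith
    rw [if_neg h3, if_neg h4, if_neg (by simp [h3, h4]), ← Finset.expect_add_distrib]
    exact Finset.expect_le_expect fun w _ => ih hPs' ζ w

theorem hit_cons_le {P : FunOp M.Conf} (hP : P.IsMarkov)
    (hPs : ∀ P ∈ Ps, P.IsMarkov) (b : M.HalfEdge) (ξ : M.Conf) (y : M.HalfEdge) :
    hit (P :: Ps) {b} ξ y ≤ (if y = b then 1 else 0) +
      P (fun ζ => (if ζ.1 y = b then 1 else 0) +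
      𝔼 w ∈ M.siblings (ζ.1 y), hit Ps {b} ζ w) ξ := by
  have e : ∀ ζ : M.Conf, 0 ≤ 𝔼 w ∈ M.siblings (ζ.1 y), hit Ps {b} ζ w := fun ζ =>
    Finset.expect_nonneg fun w _ => (hit_mem_Icc hPs _ ζ w).1
  have e2 : 0 ≤ P (fun ζ => (if ζ.1 y = b then 1 else 0) +
      𝔼 w ∈ M.siblings (ζ.1 y), hit Ps {b} ζ w) ξ := by
    refine hP.nonneg _ (fun ζ => ?_) ξ
    have := e ζ
    split_ifs <;> linarith
  rw [hit]
  simp only [Finset.mem_singleton]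
  split_ifs with h
  · linarith
  · rw [zero_add]
    refine hP.mono (fun ζ => ?_) ξ
    have := e ζ
    split_ifs <;> linarith

theorem sum_hit_target_le (hPs : ∀ P ∈ Ps, P.IsMarkov) (ξ : M.Conf) (y : M.HalfEdge) :
    ∑ b, hit Ps {b} ξ y ≤ 2 * Ps.length := by
  induction Ps generalizing ξ y with
  | nil => simp [hit]
  | cons P Ps ih =>
    obtain ⟨hP, hPs'⟩ := List.forall_mem_cons.1 hPs
    refine (Finset.sum_le_sum fun b _ => hit_cons_le hP hPs' b ξ y).trans ?_
    rw [Finset.sum_add_distrib, ← FunOp.apply_sum, Finset.sum_ite_eq, if_pos (Finset.mem_univ _)]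
    have : P (fun ζ => ∑ b, ((if ζ.1 y = b then 1 else 0) +
      𝔼 w ∈ M.siblings (ζ.1 y), hit Ps {b} ζ w)) ξ
        ≤ 1 + 2 * Ps.length := by
      refine hP.le_const (fun ζ => ?_) ξ
      rw [Finset.sum_add_distrib, Finset.sum_ite_eq, if_pos (Finset.mem_univ _),
        ← Finset.expect_sum_comm]
      have := Finset.expect_le (M.siblings_nonempty (ζ.1 y)) fun w _ => ih hPs' ζ w
      linarith
    push_cast [List.length_cons]
    linarith

theorem sum_hit_start_le (hPs : ∀ P ∈ Ps, P.IsMarkov) (ξ : M.Conf) (b : M.HalfEdge) :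
    ∑ y, hit Ps {b} ξ y ≤ 2 * Ps.length := by
  induction Ps generalizing ξ with
  | nil => simp [hit]
  | cons P Ps ih =>
    obtain ⟨hP, hPs'⟩ := List.forall_mem_cons.1 hPs
    refine (Finset.sum_le_sum fun y _ => hit_cons_le hP hPs' b ξ y).trans ?_
    rw [Finset.sum_add_distrib, ← FunOp.apply_sum, Finset.sum_ite_eq', if_pos (Finset.mem_univ _)]
    have : P (fun ζ => ∑ y, ((if ζ.1 y = b then 1 else 0) +
      𝔼 w ∈ M.siblings (ζ.1 y), hit Ps {b} ζ w)) ξ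
        ≤ 1 + 2 * Ps.length := by
      refine hP.le_const (fun ζ => ?_) ξ
      rw [sum_conf ζ fun z => (if z = b then 1 else 0) + (𝔼 w ∈ M.siblings z, hit Ps {b} ζ w),
        Finset.sum_add_distrib, Finset.sum_ite_eq', if_pos (Finset.mem_univ _), sum_expect_siblings]
      have := ih hPs' ζ
      linarith
    push_cast [List.length_cons]
    linarith

theorem firstHit_le_hit (hPs : ∀ P ∈ Ps, P.IsMarkov) (D : Finset M.HalfEdge) (c : M.HalfEdge)
    (ξ : M.Conf) (y : M.HalfEdge) : firstHit Ps D c ξ y ≤ hit Ps {c} ξ y := by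
  induction Ps generalizing ξ y with
  | nil => simp [hit, firstHit]
  | cons P Ps ih =>
    obtain ⟨hP, hPs'⟩ := List.forall_mem_cons.1 hPs
    by_cases hy : y ∈ D
    · rw [firstHit, if_pos hy]
      exact (hit_mem_Icc hPs _ _ _).1
    by_cases hy' : y = c
    · have : hit (P :: Ps) {c} ξ y = 1 := by rw [hit, if_pos (by simp [hy'])]
      rw [this]
      exact (firstHit_mem_Icc hPs _ _ _ _).2
    rw [firstHit, hit, if_neg hy, if_neg (by simpa using hy')]
    refine hP.mono (fun ζ => ?_) ξ
    simp only [Finset.mem_singleton]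
    split_ifs
    · exact le_rfl
    · exact Finset.expect_nonneg fun w _ => (hit_mem_Icc hPs' _ ζ w).1
    · exact Finset.expect_le_expect fun w _ => ih hPs' ζ w

theorem firstHit_le_add (hPs : ∀ P ∈ Ps, P.IsMarkov) (D D' : Finset M.HalfEdge) (c : M.HalfEdge)
    (ξ : M.Conf) (y : M.HalfEdge) :
    firstHit Ps D c ξ y ≤ firstHit Ps (D ∪ D') c ξ y + hit Ps D' ξ y := by
  induction Ps generalizing ξ y with
  | nil => simp [hit, firstHit]
  | cons P Ps ih =>
    obtain ⟨hP, hPs'⟩ := List.forall_mem_cons.1 hPs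
    have h1 := (firstHit_mem_Icc hPs (D ∪ D') c ξ y).1
    have h2 := (hit_mem_Icc hPs D' ξ y).1
    by_cases hy : y ∈ D
    · have : firstHit (P :: Ps) D c ξ y = 0 := by rw [firstHit, if_pos hy]
      linarith
    by_cases hy' : y ∈ D'
    · have : hit (P :: Ps) D' ξ y = 1 := by rw [hit, if_pos hy']
      have := (firstHit_mem_Icc hPs D c ξ y).2
      linarith
    rw [firstHit, firstHit, hit, if_neg hy, if_neg hy', if_neg (by simp [hy, hy']),
      ← FunOp.apply_add]
    refine hP.mono (fun ζ => ?_) ξ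
    have e1 : 0 ≤ 𝔼 w ∈ M.siblings (ζ.1 y), hit Ps D' ζ w :=
      Finset.expect_nonneg fun w _ => (hit_mem_Icc hPs' D' ζ w).1
    have e2 : (𝔼 w ∈ M.siblings (ζ.1 y), firstHit Ps D c ζ w) ≤ 1 :=
      Finset.expect_le (M.siblings_nonempty _) fun w _ => (firstHit_mem_Icc hPs' D c ζ w).2
    by_cases h3 : ζ.1 y = c
    · rw [if_pos h3, if_pos h3]
      split_ifs <;> linarith
    rw [if_neg h3, if_neg h3]
    by_cases h4 : ζ.1 y ∈ D
    · rw [if_pos h4, if_pos (by simp [h4])]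
      split_ifs <;> linarith
    rw [if_neg h4]
    by_cases h5 : ζ.1 y ∈ D'
    · rw [if_pos h5, if_pos (by simp [h5])]
      linarith
    rw [if_neg h5, if_neg (by simp [h4, h5]), ← Finset.expect_add_distrib]
    exact Finset.expect_le_expect fun w _ => ih hPs' ζ w

theorem perm_mem_iff {D : Finset M.HalfEdge} {π : Equiv.Perm M.HalfEdge}
    (hπ : ∀ x, x ∉ D → π x = x) (x : M.HalfEdge) : π x ∈ D ↔ x ∈ D := by
  constructor
  · intro h
    by_contra hx
    rw [hπ x hx] at h
    exact hx h
  · intro h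
    by_contra hx
    have := hπ _ hx
    rw [EmbeddingLike.apply_eq_iff_eq] at this
    exact hx (this.symm ▸ h)

theorem firstHit_conj (hPs : ∀ P ∈ Ps, IsExchangeable P) {D : Finset M.HalfEdge}
    {π : Equiv.Perm M.HalfEdge} (hπ : ∀ x, x ∉ D → π x = x) (c : M.HalfEdge)
    (ξ : M.Conf) (y : M.HalfEdge) :
    firstHit Ps D c ξ y = firstHit Ps D (π c) (conj π ξ) y := by
  induction Ps generalizing ξ y with
  | nil => simp [firstHit]
  | cons P Ps ih =>
    obtain ⟨hP, hPs'⟩ := List.forall_mem_cons.1 hPs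
    rw [firstHit, firstHit]
    split_ifs with hy
    · rfl
    rw [← hP.eqv]
    refine FunOp.apply_congr P (fun ζ => ?_) ξ
    rw [conj_apply_of_fixed _ (hπ y hy)]
    simp only [EmbeddingLike.apply_eq_iff_eq, perm_mem_iff hπ]
    split_ifs with h1 h2
    · rfl
    · rfl
    · rw [hπ _ h2]
      exact Finset.expect_congr rfl fun w _ => ih hPs' ζ w

/-- The law of the dynamics is invariant under exchanging `c` with any other half-edge `b`, so `c`
is as likely to be met as a typical half-edge, of which the walk meets at most `2 * Ps.length`. -/
theorem sum_firstHit_le (hPs : ∀ P ∈ Ps, IsExchangeable P) (c y : M.HalfEdge) :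
    M.ell * ∑ ξ, firstHit Ps {c} c ξ y ≤ Fintype.card M.Conf * (4 * Ps.length) := by
  have hMk := isMarkov_of_isExchangeable hPs
  have h1 : ∀ b, ∑ ξ, firstHit Ps {c} c ξ y ≤ ∑ ξ, 2 * hit Ps {b} ξ y := by
    intro b
    have hπ : ∀ x, x ∉ ({c} ∪ {b} : Finset M.HalfEdge) → Equiv.swap c b x = x := by
      intro x hx
      simp only [Finset.mem_union, Finset.mem_singleton, not_or] at hx
      exact Equiv.swap_apply_of_ne_of_ne hx.1 hx.2
    calc ∑ ξ, firstHit Ps {c} c ξ y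
        ≤ ∑ ξ, (firstHit Ps ({c} ∪ {b}) c ξ y + hit Ps {b} ξ y) :=
          Finset.sum_le_sum fun ξ _ => firstHit_le_add hMk _ _ _ _ _
      _ = ∑ ξ, firstHit Ps ({c} ∪ {b}) b (conj (Equiv.swap c b) ξ) y + ∑ ξ, hit Ps {b} ξ y := by
          rw [Finset.sum_add_distrib]
          congr 1
          refine Finset.sum_congr rfl fun ξ _ => ?_
          rw [firstHit_conj hPs hπ, Equiv.swap_apply_left]
      _ = ∑ ξ, firstHit Ps ({c} ∪ {b}) b ξ y + ∑ ξ, hit Ps {b} ξ y := by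
          rw [Equiv.sum_comp (conj (Equiv.swap c b)) fun ξ => firstHit Ps ({c} ∪ {b}) b ξ y]
      _ ≤ ∑ ξ, hit Ps {b} ξ y + ∑ ξ, hit Ps {b} ξ y :=
          add_le_add_left (Finset.sum_le_sum fun ξ _ => firstHit_le_hit hMk _ _ _ _) _
      _ = _ := by rw [← Finset.mul_sum]; ring
  have h2 := Finset.sum_le_sum fun b (_ : b ∈ (Finset.univ : Finset M.HalfEdge)) => h1 b
  rw [Finset.sum_const, nsmul_eq_mul, Finset.card_univ, card_halfEdge, Finset.sum_comm] at h2
  refine h2.trans ?_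
  refine (Finset.sum_le_sum fun ξ _ => (show _ ≤ (4 * Ps.length : ℝ) from ?_)).trans ?_
  · rw [← Finset.mul_sum]
    linarith [sum_hit_target_le hMk ξ y]
  · rw [Finset.sum_const, nsmul_eq_mul, Finset.card_univ]

/-- The permutation exchanging the edges of `a` and `b`, when these half-edges lie on different
edges of `ξ`. -/
def edgeSwap (ξ : M.Conf) (a b : M.HalfEdge) : Equiv.Perm M.HalfEdge :=
  if ξ.1 a = b then Equiv.swap a b else Equiv.swap a b * Equiv.swap (ξ.1 a) (ξ.1 b)

theorem edgeSwap_left (ξ : M.Conf) (a b : M.HalfEdge) : edgeSwap ξ a b a = b := by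
  unfold edgeSwap
  split_ifs with h
  · exact Equiv.swap_apply_left _ _
  · rw [Equiv.Perm.mul_apply, Equiv.swap_apply_of_ne_of_ne (conf_ne ξ a).symm,
      Equiv.swap_apply_left]
    intro h'
    rw [eq_comm, conf_eq_iff] at h'
    exact h h'

theorem edgeSwap_right (ξ : M.Conf) (a b : M.HalfEdge) : edgeSwap ξ a b b = a := by
  unfold edgeSwap
  split_ifs with h
  · exact Equiv.swap_apply_right _ _
  · rw [Equiv.Perm.mul_apply, Equiv.swap_apply_of_ne_of_ne (Ne.symm h) (conf_ne ξ b).symm,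
      Equiv.swap_apply_right]

theorem edgeSwap_fixed (ξ : M.Conf) {a b x : M.HalfEdge} (h1 : x ≠ a) (h2 : x ≠ b)
    (h3 : x ≠ ξ.1 a) (h4 : x ≠ ξ.1 b) : edgeSwap ξ a b x = x := by
  unfold edgeSwap
  split_ifs
  · exact Equiv.swap_apply_of_ne_of_ne h1 h2
  · rw [Equiv.Perm.mul_apply, Equiv.swap_apply_of_ne_of_ne h3 h4,
      Equiv.swap_apply_of_ne_of_ne h1 h2]

theorem edgeSwap_comm (ξ : M.Conf) (a b : M.HalfEdge) : edgeSwap ξ a b = edgeSwap ξ b a := by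
  unfold edgeSwap
  by_cases h : ξ.1 a = b
  · rw [if_pos h, if_pos ((conf_eq_iff ξ).1 h), Equiv.swap_comm]
  · rw [if_neg h, if_neg fun h' => h ((conf_eq_iff ξ).1 h')]
    rw [Equiv.swap_comm a b, Equiv.swap_comm (ξ.1 a)]

theorem edgeSwap_conf_left (ξ : M.Conf) (a b : M.HalfEdge) :
    edgeSwap ξ a b (ξ.1 a) = ξ.1 b := by
  by_cases hab : a = b
  · subst hab
    rw [edgeSwap, if_neg (conf_ne ξ a), Equiv.swap_self, Equiv.swap_self]
    rfl
  unfold edgeSwap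
  split_ifs with h
  · rw [h, Equiv.swap_apply_right, ← h, conf_conf]
  · rw [Equiv.Perm.mul_apply, Equiv.swap_apply_left, Equiv.swap_apply_of_ne_of_ne]
    · intro h'
      rw [conf_eq_iff] at h'
      exact h h'
    · exact conf_ne ξ b

theorem edgeSwap_conf_right (ξ : M.Conf) (a b : M.HalfEdge) :
    edgeSwap ξ a b (ξ.1 b) = ξ.1 a := by
  rw [edgeSwap_comm, edgeSwap_conf_left]

theorem conj_edgeSwap (ξ : M.Conf) (a b : M.HalfEdge) : conj (edgeSwap ξ a b) ξ = ξ := by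
  refine conj_eq_self fun x => ?_
  by_cases h1 : x = a
  · rw [h1, edgeSwap_left, edgeSwap_conf_left]
  by_cases h2 : x = b
  · rw [h2, edgeSwap_right, edgeSwap_conf_right]
  by_cases h3 : x = ξ.1 a
  · rw [h3, conf_conf, edgeSwap_left, edgeSwap_conf_left, conf_conf]
  by_cases h4 : x = ξ.1 b
  · rw [h4, conf_conf, edgeSwap_right, edgeSwap_conf_right, conf_conf]
  rw [edgeSwap_fixed ξ h1 h2 h3 h4, edgeSwap_fixed ξ]
  · exact fun h => h3 ((conf_eq_iff ξ).1 h).symm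
  · exact fun h => h4 ((conf_eq_iff ξ).1 h).symm
  · exact fun h => h1 (ξ.1.injective h)
  · exact fun h => h2 (ξ.1.injective h)

/-- As in `sum_firstHit_le`, but now the exchange has to preserve the initial configuration, which
`edgeSwap` does. -/
theorem firstHit_edge_le (hPs : ∀ P ∈ Ps, IsExchangeable P) (ξ : M.Conf) (y w : M.HalfEdge) :
    M.ell * firstHit Ps {y, ξ.1 y} y ξ w ≤ 6 * Ps.length := by
  have hMk := isMarkov_of_isExchangeable hPs
  have h1 : ∀ b, firstHit Ps {y, ξ.1 y} y ξ w
      ≤ 2 * hit Ps {b} ξ w + hit Ps {ξ.1 b} ξ w := by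
    intro b
    have hπ : ∀ x, x ∉ (({y, ξ.1 y} : Finset M.HalfEdge) ∪ ({b} ∪ {ξ.1 b})) →
        edgeSwap ξ y b x = x := by
      intro x hx
      simp only [Finset.mem_union, Finset.mem_insert, Finset.mem_singleton, not_or] at hx
      exact edgeSwap_fixed ξ hx.1.1 hx.2.1 hx.1.2 hx.2.2
    have e1 := firstHit_le_add hMk {y, ξ.1 y} ({b} ∪ {ξ.1 b}) y ξ w
    have e2 := firstHit_conj hPs hπ y ξ w
    rw [conj_edgeSwap, edgeSwap_left] at e2
    have e3 := firstHit_le_hit hMk ({y, ξ.1 y} ∪ ({b} ∪ {ξ.1 b})) b ξ w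
    have e4 := hit_union_le hMk {b} {ξ.1 b} ξ w
    linarith
  have h2 := Finset.sum_le_sum fun b (_ : b ∈ (Finset.univ : Finset M.HalfEdge)) => h1 b
  rw [Finset.sum_const, nsmul_eq_mul, Finset.card_univ, card_halfEdge, Finset.sum_add_distrib,
    ← Finset.mul_sum, sum_conf ξ fun b => hit Ps {b} ξ w] at h2
  linarith [sum_hit_target_le hMk ξ w]

/-! ### Repetition of vertices -/

/-- Probability that the walk driven by the operators `Ps` visits a vertex in `V`, or a vertex for
the second time. -/
noncomputable def revisit : List (FunOp M.Conf) → Finset (Fin n) → M.Conf → M.HalfEdge → ℝ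
  | [], _, _, _ => 0
  | P :: Ps, V, ξ, y => P (fun ζ => if (ζ.1 y).1 ∈ V then 1 else
      𝔼 w ∈ M.siblings (ζ.1 y), revisit Ps (insert (ζ.1 y).1 V) ζ w) ξ

/-- Probability that the walk driven by the operators `Ps` visits `v`, before visiting a vertex in
`V` or any vertex for the second time. -/
noncomputable def visit (v : Fin n) :
    List (FunOp M.Conf) → Finset (Fin n) → M.Conf → M.HalfEdge → ℝ
  | [], _, _, _ => 0
  | P :: Ps, V, ξ, y => P (fun ζ => if (ζ.1 y).1 = v then 1 else if (ζ.1 y).1 ∈ V then 0 else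
      𝔼 w ∈ M.siblings (ζ.1 y), visit v Ps (insert (ζ.1 y).1 V) ζ w) ξ

/-- Expected number of siblings of `y` that the walk driven by the operators `Ps` meets, each of
them for the first time, as the partner of a position. -/
noncomputable def siblingHit (Ps : List (FunOp M.Conf)) (y : M.HalfEdge) (ξ : M.Conf)
    (w : M.HalfEdge) : ℝ :=
  ∑ c ∈ M.siblings y, firstHit Ps {c} c ξ w

theorem revisit_mem_Icc (hPs : ∀ P ∈ Ps, P.IsMarkov) (V : Finset (Fin n)) (ξ : M.Conf)
    (y : M.HalfEdge) : revisit Ps V ξ y ∈ Set.Icc (0 : ℝ) 1 := by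
  induction Ps generalizing V ξ y with
  | nil => simp [revisit]
  | cons P Ps ih =>
    obtain ⟨hP, hPs'⟩ := List.forall_mem_cons.1 hPs
    rw [revisit]
    refine hP.mem_Icc (fun ζ => ?_) ξ
    split_ifs
    · simp
    · exact expect_mem_Icc (M.siblings_nonempty _) fun w _ => ih hPs' _ ζ w

theorem revisit_insert_le (hPs : ∀ P ∈ Ps, P.IsMarkov) (v : Fin n) (V : Finset (Fin n))
    (ξ : M.Conf) (y : M.HalfEdge) :
    revisit Ps (insert v V) ξ y ≤ revisit Ps V ξ y + visit v Ps V ξ y := by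
  induction Ps generalizing V ξ y with
  | nil => simp [revisit, visit]
  | cons P Ps ih =>
    obtain ⟨hP, hPs'⟩ := List.forall_mem_cons.1 hPs
    rw [revisit, revisit, visit, ← FunOp.apply_add]
    refine hP.mono (fun ζ => ?_) ξ
    have h0 : 0 ≤ 𝔼 w ∈ M.siblings (ζ.1 y), revisit Ps (insert (ζ.1 y).1 V) ζ w :=
      Finset.expect_nonneg fun w _ => (revisit_mem_Icc hPs' _ ζ w).1
    by_cases h1 : (ζ.1 y).1 = v
    · rw [if_pos (by simp [h1]), if_pos h1]
      split_ifs <;> linarith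
    by_cases h2 : (ζ.1 y).1 ∈ V
    · rw [if_pos (by simp [h2]), if_pos h2, if_neg h1, if_pos h2]
      linarith
    rw [if_neg h1, if_neg h2, if_neg (by simp [h1, h2]), if_neg h2, ← Finset.expect_add_distrib,
      Finset.insert_comm]
    exact Finset.expect_le_expect fun w _ => ih hPs' _ ζ w

theorem siblingHit_nonneg (hPs : ∀ P ∈ Ps, P.IsMarkov) (y : M.HalfEdge) (ξ : M.Conf)
    (w : M.HalfEdge) : 0 ≤ siblingHit Ps y ξ w :=
  Finset.sum_nonneg fun _ _ => (firstHit_mem_Icc hPs _ _ ξ w).1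

theorem apply_siblingHit_le {P : FunOp M.Conf} (hP : P.IsMarkov) (hPs : ∀ P ∈ Ps, P.IsMarkov)
    (ξ : M.Conf) {y w : M.HalfEdge} (hw : w ∉ M.siblings y) :
    P (fun ζ => if ζ.1 w ∈ M.siblings y then 1 else
        𝔼 w' ∈ M.siblings (ζ.1 w), siblingHit Ps y ζ w') ξ
      ≤ siblingHit (P :: Ps) y ξ w := by
  have hcons : ∀ c ∈ M.siblings y, firstHit (P :: Ps) {c} c ξ w
      = P (fun ζ => if ζ.1 w = c then 1 else
          𝔼 w' ∈ M.siblings (ζ.1 w), firstHit Ps {c} c ζ w') ξ := by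
    intro c hc
    rw [firstHit, if_neg fun h => hw (by rwa [Finset.mem_singleton.1 h])]
    refine FunOp.apply_congr P (fun ζ => ?_) ξ
    simp only [Finset.mem_singleton]
    split_ifs <;> rfl
  rw [siblingHit, Finset.sum_congr rfl hcons, ← FunOp.apply_sum]
  refine hP.mono (fun ζ => ?_) ξ
  split_ifs with hζ
  · have h0 : ∀ c ∈ M.siblings y, (0 : ℝ) ≤ if ζ.1 w = c then 1 else
        𝔼 w' ∈ M.siblings (ζ.1 w), firstHit Ps {c} c ζ w' := by
      intro c _
      split_ifs
      · exact zero_le_one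
      · exact Finset.expect_nonneg fun w' _ => (firstHit_mem_Icc hPs _ _ ζ w').1
    simpa using Finset.single_le_sum h0 hζ
  · have hne : ∀ c ∈ M.siblings y, ζ.1 w ≠ c := fun c hc h => hζ (by rwa [h])
    rw [Finset.sum_congr rfl fun c hc => if_neg (hne c hc)]
    refine le_of_eq ?_
    exact Finset.expect_sum_comm _ _ _

theorem visit_le (hPs : ∀ P ∈ Ps, P.IsMarkov) {y z : M.HalfEdge} {V : Finset (Fin n)}
    (hz : z.1 ∈ V) (ξ : M.Conf) {w : M.HalfEdge} (hwz : w ≠ z) (hw : w.1 ≠ y.1) :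
    visit y.1 Ps V ξ w ≤ siblingHit Ps y ξ w + firstHit Ps {y, z} y ξ w := by
  induction Ps generalizing V ξ w with
  | nil => simp [visit, firstHit, siblingHit]
  | cons P Ps ih =>
    obtain ⟨hP, hPs'⟩ := List.forall_mem_cons.1 hPs
    have hwy : w ≠ y := fun h => hw (by rw [h])
    refine le_trans ?_ (add_le_add_left
      (apply_siblingHit_le hP hPs' ξ fun h => hw (M.mem_siblings.1 h).1) _)
    rw [firstHit, if_neg (by simp [hwy, hwz]), ← FunOp.apply_add, visit]
    refine hP.mono (fun ζ => ?_) ξ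
    have hS : 0 ≤ 𝔼 w' ∈ M.siblings (ζ.1 w), siblingHit Ps y ζ w' :=
      Finset.expect_nonneg fun w' _ => siblingHit_nonneg hPs' y ζ w'
    have hF : 0 ≤ 𝔼 w' ∈ M.siblings (ζ.1 w), firstHit Ps {y, z} y ζ w' :=
      Finset.expect_nonneg fun w' _ => (firstHit_mem_Icc hPs' _ _ ζ w').1
    by_cases h1 : (ζ.1 w).1 = y.1
    · rw [if_pos h1]
      by_cases h2 : ζ.1 w = y
      · rw [if_pos h2]
        split_ifs <;> linarith
      · rw [if_pos (M.mem_siblings.2 ⟨h1, h2⟩), if_neg h2]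
        split_ifs <;> linarith
    have h2 : ζ.1 w ≠ y := fun h => h1 (by rw [h])
    rw [if_neg h1, if_neg fun h => h1 (M.mem_siblings.1 h).1, if_neg h2]
    by_cases h3 : (ζ.1 w).1 ∈ V
    · rw [if_pos h3]
      split_ifs <;> linarith
    have h4 : ζ.1 w ≠ z := fun h => h3 (by rwa [h])
    rw [if_neg h3, if_neg (by simp [h2, h4]), ← Finset.expect_add_distrib]
    refine Finset.expect_le_expect fun w' hw' => ?_
    have hw'1 := (M.mem_siblings.1 hw').1
    exact ih hPs' (by simp [hz]) ζ (fun h => h3 (by rwa [← hw'1, h])) (by rwa [hw'1])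

theorem revisit_start_le {P : FunOp M.Conf} (hP : P.IsMarkov) (hPs : ∀ P ∈ Ps, IsExchangeable P)
    (ξ : M.Conf) (y : M.HalfEdge) :
    revisit (P :: Ps) {y.1} ξ y
      ≤ P (fun ζ => 𝔼 w ∈ M.siblings (ζ.1 y), revisit Ps {w.1} ζ w) ξ
        + (siblingHit (P :: Ps) y ξ y + 6 * Ps.length / M.ell) := by
  have hell : (0 : ℝ) < M.ell := by exact_mod_cast M.ell_pos
  have hMk := isMarkov_of_isExchangeable hPs
  refine le_trans ?_ (add_le_add_right (add_le_add_left
    (apply_siblingHit_le hP hMk ξ fun h => (M.mem_siblings.1 h).2 rfl) _) _)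
  rw [← hP.const (6 * Ps.length / M.ell : ℝ) ξ, ← FunOp.apply_add, ← FunOp.apply_add, revisit]
  refine hP.mono (fun ζ => ?_) ξ
  have hR : 0 ≤ 𝔼 w ∈ M.siblings (ζ.1 y), revisit Ps {w.1} ζ w :=
    Finset.expect_nonneg fun w _ => (revisit_mem_Icc hMk _ ζ w).1
  have hL : (0 : ℝ) ≤ 6 * Ps.length / M.ell := by positivity
  by_cases h1 : (ζ.1 y).1 = y.1
  · rw [if_pos (by simp [h1]), if_pos (M.mem_siblings.2 ⟨h1, conf_ne ζ y⟩)]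
    linarith
  rw [if_neg (by simpa using h1), if_neg fun h => h1 (M.mem_siblings.1 h).1,
    ← Finset.expect_const (M.siblings_nonempty (ζ.1 y)) (6 * Ps.length / M.ell : ℝ),
    ← Finset.expect_add_distrib, ← Finset.expect_add_distrib]
  refine Finset.expect_le_expect fun w hw => ?_
  obtain ⟨hw1, hw2⟩ := M.mem_siblings.1 hw
  have hinsert := revisit_insert_le hMk y.1 {(ζ.1 y).1} ζ w
  have hvisit := visit_le hMk (y := y) (z := ζ.1 y) (V := {(ζ.1 y).1}) (by simp) ζ hw2
    (by rwa [hw1])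
  have hfirst : firstHit Ps {y, ζ.1 y} y ζ w ≤ 6 * Ps.length / M.ell := by
    rw [le_div_iff₀ hell, mul_comm]
    exact firstHit_edge_le hPs ζ y w
  rw [Finset.pair_comm, hw1]
  linarith

theorem sum_card_siblings : ∑ x : M.HalfEdge, ((M.siblings x).card : ℝ) = M.ell * M.nu := by
  have hell : (M.ell : ℝ) ≠ 0 := by exact_mod_cast M.ell_pos.ne'
  rw [nu, mul_div_cancel₀ _ hell]
  refine Finset.sum_congr rfl fun x _ => ?_
  rw [card_siblings, Nat.cast_sub (by have := M.two_le_d x.1; omega), Nat.cast_one]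

theorem nu_nonneg : 0 ≤ M.nu := by
  have hell : (0 : ℝ) < M.ell := by exact_mod_cast M.ell_pos
  refine nonneg_of_mul_nonneg_right ?_ hell
  rw [← sum_card_siblings]
  positivity

theorem sum_siblingHit_le (hPs : ∀ P ∈ Ps, IsExchangeable P) :
    ∑ ξ, ∑ y : M.HalfEdge, siblingHit Ps y ξ y
      ≤ Fintype.card M.Conf * (4 * Ps.length * M.nu) := by
  have hell : (0 : ℝ) < M.ell := by exact_mod_cast M.ell_pos
  have hfirst : ∀ c y : M.HalfEdge,
      ∑ ξ, firstHit Ps {c} c ξ y ≤ Fintype.card M.Conf * (4 * Ps.length) / M.ell := by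
    intro c y
    rw [le_div_iff₀ hell, mul_comm]
    exact sum_firstHit_le hPs c y
  calc ∑ ξ, ∑ y : M.HalfEdge, siblingHit Ps y ξ y
      = ∑ y : M.HalfEdge, ∑ c ∈ M.siblings y, ∑ ξ, firstHit Ps {c} c ξ y := by
        rw [Finset.sum_comm]
        exact Finset.sum_congr rfl fun y _ => Finset.sum_comm
    _ ≤ ∑ y : M.HalfEdge, ∑ _c ∈ M.siblings y,
          (Fintype.card M.Conf * (4 * Ps.length) / M.ell : ℝ) :=
        Finset.sum_le_sum fun y _ => Finset.sum_le_sum fun c _ => hfirst c y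
    _ = Fintype.card M.Conf * (4 * Ps.length * M.nu) := by
        simp only [Finset.sum_const, nsmul_eq_mul]
        rw [← Finset.sum_mul, sum_card_siblings]
        field_simp

theorem sum_revisit_le (hPs : ∀ P ∈ Ps, IsExchangeable P) {L : ℕ} (hL : Ps.length ≤ L) :
    ∑ ξ, ∑ y, revisit Ps {y.1} ξ y
      ≤ Ps.length * (Fintype.card M.Conf * (4 * L * M.nu + 6 * L)) := by
  induction Ps with
  | nil => simp [revisit]
  | cons P Ps ih =>
    obtain ⟨hP, hPs'⟩ := List.forall_mem_cons.1 hPs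
    have hell : (0 : ℝ) < M.ell := by exact_mod_cast M.ell_pos
    have hν := M.nu_nonneg
    have hLr : ((P :: Ps).length : ℝ) ≤ L := by exact_mod_cast hL
    rw [List.length_cons] at hL
    have hlater : ∑ ξ, ∑ y, P (fun ζ => 𝔼 w ∈ M.siblings (ζ.1 y), revisit Ps {w.1} ζ w) ξ
        = ∑ ξ, ∑ y, revisit Ps {y.1} ξ y := by
      simp_rw [← FunOp.apply_sum]
      rw [hP.sum]
      refine Finset.sum_congr rfl fun ζ _ => ?_
      rw [sum_conf ζ fun z => 𝔼 w ∈ M.siblings z, revisit Ps {w.1} ζ w, sum_expect_siblings]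
    have hsib : ∑ ξ, ∑ y : M.HalfEdge, siblingHit (P :: Ps) y ξ y
        ≤ Fintype.card M.Conf * (4 * L * M.nu) :=
      (sum_siblingHit_le hPs).trans (by gcongr)
    have hconst : ∑ _ξ : M.Conf, ∑ _y : M.HalfEdge, (6 * Ps.length / M.ell : ℝ)
        ≤ Fintype.card M.Conf * (6 * L) := by
      simp only [Finset.sum_const, nsmul_eq_mul, Finset.card_univ, card_halfEdge]
      rw [mul_div_cancel₀ _ hell.ne']
      gcongr
      omega
    refine (Finset.sum_le_sum fun ξ _ => Finset.sum_le_sum fun y _ =>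
      revisit_start_le hP.toIsMarkov hPs' ξ y).trans ?_
    simp only [Finset.sum_add_distrib]
    rw [hlater, List.length_cons]
    push_cast
    linarith [ih hPs' (by omega)]

/-! ### Expectations along the dynamic walk -/

/-- The expectation of `f (X_j)` for the walk started from the configuration `ξ` and the half-edge
`y`. -/
noncomputable def walkExp (f : M.HalfEdge → ℝ) : ℕ → M.Conf → M.HalfEdge → ℝ
  | 0, _, y => f y
  | j + 1, ξ, y => M.dyn (fun ζ => 𝔼 w ∈ M.siblings (ζ.1 y), walkExp f j ζ w) ξ

/-- The expectation of `f (X_{j+1})` for the walk that leaves `u` when the configuration has become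
`ζ`: it moves to a sibling of the partner of `u` and takes `j` more steps. -/
noncomputable def crossExp (f : M.HalfEdge → ℝ) (j : ℕ) (u : M.HalfEdge) (ζ : M.Conf) : ℝ :=
  𝔼 w ∈ M.siblings (ζ.1 u), walkExp f j ζ w

theorem sum_walkExp (f : M.HalfEdge → ℝ) (j : ℕ) (ξ : M.Conf) :
    ∑ y, walkExp f j ξ y = ∑ y, f y := by
  induction j generalizing ξ with
  | zero => rfl
  | succ j ih =>
    simp only [walkExp]
    rw [← FunOp.apply_sum, ← isExchangeable_dyn.const (∑ y, f y) ξ]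
    refine FunOp.apply_congr _ (fun ζ => ?_) ξ
    rw [sum_conf ζ fun z => 𝔼 w ∈ M.siblings z, walkExp f j ζ w, sum_expect_siblings, ih]

theorem abs_walkExp_le {f : M.HalfEdge → ℝ} {K : ℝ} (hf : ∀ y, |f y| ≤ K) (j : ℕ) (ξ : M.Conf)
    (y : M.HalfEdge) : |walkExp f j ξ y| ≤ K := by
  induction j generalizing ξ y with
  | zero => exact hf y
  | succ j ih =>
    rw [walkExp]
    refine (isExchangeable_dyn.abs_le _ ξ).trans (isExchangeable_dyn.le_const (fun ζ => ?_) ξ)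
    exact abs_expect_le_of_forall_abs_le (M.siblings_nonempty _) fun w _ => ih ζ w

theorem isMarkov_replicate_dyn {j : ℕ} : ∀ P ∈ List.replicate j M.dyn, P.IsMarkov := by
  intro P hP
  rw [List.eq_of_mem_replicate hP]
  exact isExchangeable_dyn.toIsMarkov

theorem abs_walkExp_conj_sub_le {f : M.HalfEdge → ℝ} {K : ℝ} (hf : ∀ y, |f y| ≤ K)
    {D : Finset M.HalfEdge} {π : Equiv.Perm M.HalfEdge} (hπ : ∀ x, x ∉ D → π x = x) (j : ℕ)
    (ξ : M.Conf) (y : M.HalfEdge) :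
    |walkExp f j (conj π ξ) y - walkExp f j ξ y|
      ≤ 2 * K * hit (List.replicate j M.dyn) D ξ y := by
  induction j generalizing ξ y with
  | zero => simp [walkExp, hit]
  | succ j ih =>
    have hsub : ∀ {a b : ℝ}, |a| ≤ K → |b| ≤ K → |a - b| ≤ 2 * K := fun ha hb =>
      (abs_sub _ _).trans (by linarith)
    rw [List.replicate_succ, hit]
    split_ifs with hy
    · rw [mul_one]
      exact hsub (abs_walkExp_le hf _ _ _) (abs_walkExp_le hf _ _ _)
    simp only [walkExp]
    rw [← isExchangeable_dyn.eqv, ← FunOp.apply_sub, ← FunOp.apply_const_mul]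
    refine isExchangeable_dyn.nonneg.abs_le (fun ζ => ?_) ξ
    rw [conj_apply_of_fixed _ (hπ y hy)]
    split_ifs with h1
    · rw [mul_one]
      exact hsub
        (abs_expect_le_of_forall_abs_le (M.siblings_nonempty _) fun w _ => abs_walkExp_le hf _ _ _)
        (abs_expect_le_of_forall_abs_le (M.siblings_nonempty _) fun w _ => abs_walkExp_le hf _ _ _)
    · rw [hπ _ h1, ← Finset.expect_sub_distrib, Finset.mul_expect]
      exact (Finset.abs_expect_le _ _).trans (Finset.expect_le_expect fun w _ => ih ζ w)

/-! ### Returns to the initial edge -/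

/-- For the walk that starts from a sibling of `a` with the configuration `ζ`, the probability of
using `a` or its partner `ξ a` within `j` steps, summed over `a`. -/
noncomputable def returns (j : ℕ) (ξ ζ : M.Conf) : ℝ :=
  ∑ a, 𝔼 w ∈ M.siblings a, hit (List.replicate j M.dyn) {a, ξ.1 a} ζ w

theorem returns_nonneg (j : ℕ) (ξ ζ : M.Conf) : 0 ≤ returns j ξ ζ :=
  Finset.sum_nonneg fun _ _ => Finset.expect_nonneg fun _ _ =>
    (hit_mem_Icc isMarkov_replicate_dyn _ _ _).1

/-- Expected number of returns within `j` steps, for walks started after `i` steps of the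
configuration dynamics. -/
noncomputable def returnExp (i j : ℕ) (ξ : M.Conf) : ℝ := (M.dyn ^ i) (returns j ξ) ξ

theorem returnExp_nonneg (i j : ℕ) (ξ : M.Conf) : 0 ≤ returnExp i j ξ :=
  (isExchangeable_dyn.pow _).nonneg _ (returns_nonneg j ξ) ξ

theorem hit_le_revisit {Ps : List (FunOp M.Conf)} (hPs : ∀ P ∈ Ps, P.IsMarkov)
    {D : Finset M.HalfEdge} {V : Finset (Fin n)} (hD : ∀ x ∈ D, x.1 ∈ V) (ξ : M.Conf)
    {y : M.HalfEdge} (hy : y ∉ D) : hit Ps D ξ y ≤ revisit Ps V ξ y := by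
  induction Ps generalizing V ξ y with
  | nil => simp [hit, revisit]
  | cons P Ps ih =>
    obtain ⟨hP, hPs'⟩ := List.forall_mem_cons.1 hPs
    rw [hit, if_neg hy, revisit]
    refine hP.mono (fun ζ => ?_) ξ
    by_cases h1 : (ζ.1 y).1 ∈ V
    · rw [if_pos h1]
      split_ifs
      · exact le_rfl
      · exact Finset.expect_le (M.siblings_nonempty _) fun w _ => (hit_mem_Icc hPs' _ _ _).2
    · rw [if_neg h1, if_neg fun h => h1 (hD _ h)]
      refine Finset.expect_le_expect fun w hw => ?_
      refine ih hPs' (fun x hx => by simp [hD x hx]) ζ fun h => h1 ?_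
      rw [← (M.mem_siblings.1 hw).1]
      exact hD _ h

/-- The identity at the head of the list makes the walk cross the edge of `y` in `ξ` itself, so that
a later use of this edge is the second visit to a vertex. -/
theorem returnExp_succ_le_revisit (i j : ℕ) (ξ : M.Conf) :
    returnExp i (j + 1) ξ
      ≤ ∑ y, revisit (1 :: M.dyn ^ (i + 1) :: List.replicate j M.dyn) {y.1} ξ y := by
  have hMk : ∀ P ∈ M.dyn ^ (i + 1) :: List.replicate j M.dyn, P.IsMarkov :=
    List.forall_mem_cons.2 ⟨(isExchangeable_dyn.pow _).toIsMarkov, isMarkov_replicate_dyn⟩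
  unfold returnExp returns
  rw [FunOp.apply_sum, ← sum_conf ξ]
  refine Finset.sum_le_sum fun y _ => ?_
  rw [conf_conf, FunOp.apply_expect, revisit, Module.End.one_apply]
  split_ifs with hloop
  · refine Finset.expect_le (M.siblings_nonempty _) fun w _ => ?_
    exact (isExchangeable_dyn.pow i).le_const
      (fun ζ => (hit_mem_Icc isMarkov_replicate_dyn _ _ _).2) ξ
  refine Finset.expect_le_expect fun w hw => ?_
  obtain ⟨hw1, hw2⟩ := M.mem_siblings.1 hw
  have hwD : w ∉ ({ξ.1 y, y} : Finset M.HalfEdge) := by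
    simp only [Finset.mem_insert, Finset.mem_singleton, not_or]
    refine ⟨hw2, fun h => hloop ?_⟩
    rw [← hw1, h]
    simp
  have hmerge : (M.dyn ^ i) (fun ζ => hit (List.replicate (j + 1) M.dyn) {ξ.1 y, y} ζ w) ξ
      = hit (M.dyn ^ (i + 1) :: List.replicate j M.dyn) {ξ.1 y, y} ξ w := by
    rw [hit, if_neg hwD, pow_succ, Module.End.mul_apply]
    refine FunOp.apply_congr _ (fun ζ => ?_) ξ
    rw [List.replicate_succ, hit, if_neg hwD]
  rw [hmerge]
  refine hit_le_revisit hMk (fun x hx => ?_) ξ hwD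
  simp only [Finset.mem_insert, Finset.mem_singleton] at hx ⊢
  rcases hx with rfl | rfl <;> simp

theorem sum_returnExp_le (i j : ℕ) :
    ∑ ξ : M.Conf, returnExp i j ξ ≤ Fintype.card M.Conf * ((j + 1) ^ 2 * (4 * M.nu + 6)) := by
  have hν := M.nu_nonneg
  rcases j with _ | j
  · have hzero : ∀ ξ : M.Conf, returns 0 ξ = 0 := fun ξ => by
      ext ζ
      simp [returns, hit]
    simp only [returnExp, hzero, map_zero, Pi.zero_apply, Finset.sum_const_zero]
    positivity
  have hPs : ∀ P ∈ (1 : FunOp M.Conf) :: M.dyn ^ (i + 1) :: List.replicate j M.dyn,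
      IsExchangeable P := by
    simp only [List.forall_mem_cons]
    refine ⟨.one_isExchangeable, isExchangeable_dyn.pow _, fun P hP => ?_⟩
    rw [List.eq_of_mem_replicate hP]
    exact isExchangeable_dyn
  refine (Finset.sum_le_sum fun ξ _ => returnExp_succ_le_revisit i j ξ).trans
    ((sum_revisit_le hPs le_rfl).trans (le_of_eq ?_))
  simp only [List.length_cons, List.length_replicate]
  push_cast
  ring

/-! ### The partner of a rewired half-edge is almost uniform -/

/-- The half-edges on the edges of `ξ` that meet `S`. -/
def edgeHull (ξ : M.Conf) (S : Finset M.HalfEdge) : Finset M.HalfEdge :=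
  S ∪ S.image ξ.1

theorem card_edgeHull_le (ξ : M.Conf) (S : Finset M.HalfEdge) :
    (edgeHull ξ S).card ≤ 2 * S.card := by
  have hunion := Finset.card_union_le S (S.image ξ.1)
  have himage := Finset.card_image_le (s := S) (f := ξ.1)
  unfold edgeHull
  omega

theorem edgeSwap_fixed_of_notMem_edgeHull {ξ : M.Conf} {S : Finset M.HalfEdge} {a b : M.HalfEdge}
    (ha : a ∉ edgeHull ξ S) (hb : b ∉ edgeHull ξ S) : ∀ x ∈ S, edgeSwap ξ a b x = x := by
  intro x hx
  simp only [edgeHull, Finset.mem_union, Finset.mem_image, not_or, not_exists, not_and] at ha hb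
  exact edgeSwap_fixed ξ (fun h => ha.1 (h ▸ hx)) (fun h => hb.1 (h ▸ hx))
    (fun h => ha.2 x hx (by rw [h, conf_conf])) (fun h => hb.2 x hx (by rw [h, conf_conf]))

/-- Operators that commute with the relabellings of the half-edges outside `S`. -/
def IsEquivariantOff (S : Finset M.HalfEdge) (T : FunOp M.Conf) : Prop :=
  ∀ π : Equiv.Perm M.HalfEdge, (∀ x ∈ S, π x = x) → ∀ (φ : M.Conf → ℝ) (ξ : M.Conf),
    T (fun ζ => φ (conj π ζ)) ξ = T φ (conj π ξ)

section Symmetrization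

variable {S : Finset M.HalfEdge} {T T' : FunOp M.Conf} {u : M.HalfEdge} {ξ : M.Conf}

theorem IsEquivariantOff.mul (hT : IsEquivariantOff S T) (hT' : IsEquivariantOff S T') :
    IsEquivariantOff S (T * T') := fun π hπ φ ξ => by
  rw [Module.End.mul_apply, Module.End.mul_apply, ← hT π hπ]
  exact FunOp.apply_congr _ (hT' π hπ φ) ξ

theorem IsEquivariantOff.apply_partner_eq (hT : IsEquivariantOff S T) (hu : u ∈ S)
    (g : M.Conf → M.HalfEdge → ℝ) {a b : M.HalfEdge} (ha : a ∉ edgeHull ξ S)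
    (hb : b ∉ edgeHull ξ S) :
    T (fun ζ => if ζ.1 u = b then g ζ b else 0) ξ
      = T (fun ζ => if ζ.1 u = a then g (conj (edgeSwap ξ a b) ζ) b else 0) ξ := by
  have hfix := edgeSwap_fixed_of_notMem_edgeHull ha hb
  conv_lhs => rw [← conj_edgeSwap ξ a b, ← hT _ hfix]
  refine FunOp.apply_congr _ (fun ζ => ?_) ξ
  rw [conj_apply_of_fixed _ (hfix u hu)]
  congr 1
  rw [eq_iff_iff]
  refine ⟨fun h => (edgeSwap ξ a b).injective (h.trans (edgeSwap_left ξ a b).symm), ?_⟩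
  rintro rfl
  exact edgeSwap_left ξ _ b

theorem apply_partner_eq_sum (T : FunOp M.Conf) (g : M.Conf → M.HalfEdge → ℝ)
    (U : Finset M.HalfEdge) :
    T (fun ζ => if ζ.1 u ∈ U then g ζ (ζ.1 u) else 0) ξ
      = ∑ b ∈ U, T (fun ζ => if ζ.1 u = b then g ζ b else 0) ξ := by
  rw [← FunOp.apply_sum]
  refine FunOp.apply_congr _ (fun ζ => ?_) ξ
  rw [Finset.sum_ite_eq]

theorem IsEquivariantOff.card_mul_apply_partner_eq (hT : IsEquivariantOff S T) (hu : u ∈ S)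
    (g : M.Conf → M.HalfEdge → ℝ) {V : Finset M.HalfEdge} (hV : V = (edgeHull ξ S)ᶜ) :
    (V.card : ℝ) * T (fun ζ => if ζ.1 u ∈ V then g ζ (ζ.1 u) else 0) ξ
      = T (fun ζ => if ζ.1 u ∈ V then
          ∑ b ∈ V, g (conj (edgeSwap ξ (ζ.1 u) b) ζ) b else 0) ξ := by
  have hmem : ∀ a ∈ V, a ∉ edgeHull ξ S := fun a ha => by simpa [hV] using ha
  rw [apply_partner_eq_sum T g,
    apply_partner_eq_sum T fun ζ a => ∑ b ∈ V, g (conj (edgeSwap ξ a b) ζ) b, ← nsmul_eq_mul,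
    ← Finset.sum_const]
  refine Finset.sum_congr rfl fun a ha => ?_
  rw [Finset.sum_congr rfl fun b hb => hT.apply_partner_eq hu g (hmem a ha) (hmem b hb),
    ← FunOp.apply_sum]
  refine FunOp.apply_congr _ (fun ζ => ?_) ξ
  split_ifs <;> simp

/-- Exchanging the edge of the partner of `u` with a uniform edge replaces `g ζ (ζ u)` by the mean
of `g ζ`, which vanishes. -/
theorem abs_apply_partner_le (hpos : T.IsPositive) (hT : IsEquivariantOff S T) (hu : u ∈ S)
    {g : M.Conf → M.HalfEdge → ℝ} {K : ℝ} (hK : ∀ ζ a, |g ζ a| ≤ K) (hg : ∀ ζ, ∑ a, g ζ a = 0) :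
    ((M.ell : ℝ) - (edgeHull ξ S).card) * |T (fun ζ => g ζ (ζ.1 u)) ξ|
      ≤ M.ell * (K * T (fun ζ => if ζ.1 u ∈ edgeHull ξ S then 1 else 0) ξ)
        + T (fun ζ => K * (edgeHull ξ S).card
            + ∑ b, |g (conj (edgeSwap ξ (ζ.1 u) b) ζ) b - g ζ b|) ξ := by
  obtain ⟨U, hU⟩ : ∃ U, U = edgeHull ξ S := ⟨_, rfl⟩
  rw [← hU]
  have hK0 : 0 ≤ K := (abs_nonneg _).trans (hK ξ u)
  have hcard : ((M.ell : ℝ) - U.card) = (Uᶜ : Finset M.HalfEdge).card := by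
    rw [Finset.card_compl, card_halfEdge, Nat.cast_sub]
    rw [← M.card_halfEdge]
    exact Finset.card_le_univ U
  have hsplit : T (fun ζ => g ζ (ζ.1 u)) ξ
      = T (fun ζ => if ζ.1 u ∈ U then g ζ (ζ.1 u) else 0) ξ
        + T (fun ζ => if ζ.1 u ∈ Uᶜ then g ζ (ζ.1 u) else 0) ξ := by
    rw [← FunOp.apply_add]
    refine FunOp.apply_congr _ (fun ζ => ?_) ξ
    by_cases h : ζ.1 u ∈ U <;> simp [h]
  have hinside : |T (fun ζ => if ζ.1 u ∈ U then g ζ (ζ.1 u) else 0) ξ|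
      ≤ K * T (fun ζ => if ζ.1 u ∈ U then 1 else 0) ξ := by
    rw [← FunOp.apply_const_mul]
    refine hpos.abs_le (fun ζ => ?_) ξ
    split_ifs
    · simpa using hK ζ (ζ.1 u)
    · simp
  have houtside : (Uᶜ : Finset M.HalfEdge).card
        * |T (fun ζ => if ζ.1 u ∈ Uᶜ then g ζ (ζ.1 u) else 0) ξ|
      ≤ T (fun ζ => K * U.card + ∑ b, |g (conj (edgeSwap ξ (ζ.1 u) b) ζ) b - g ζ b|) ξ := by
    rw [← Nat.abs_cast (Uᶜ : Finset M.HalfEdge).card, ← abs_mul,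
      hT.card_mul_apply_partner_eq hu g (by rw [hU])]
    refine hpos.abs_le (fun ζ => ?_) ξ
    split_ifs
    · exact abs_sum_compl_le (hK ζ) (hg ζ) U
    · rw [abs_zero]
      positivity
  rw [hsplit]
  refine (mul_le_mul_of_nonneg_left (abs_add_le _ _) (hcard ▸ Nat.cast_nonneg _)).trans ?_
  rw [mul_add]
  refine add_le_add (mul_le_mul ?_ hinside (abs_nonneg _) (Nat.cast_nonneg _)) ?_
  · linarith [(Nat.cast_nonneg U.card : (0 : ℝ) ≤ U.card)]
  · rwa [hcard]

end Symmetrization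

/-! ### Crossing a rewired edge -/

/-- One step of the configuration dynamics without rewiring half-edges in `B`. -/
noncomputable def avoid (B : Finset M.HalfEdge) : FunOp M.Conf :=
  rewireOp fun R => Disjoint R B

/-- One step of the configuration dynamics without rewiring half-edges in `B`, but rewiring `u`. -/
noncomputable def avoidRewire (B : Finset M.HalfEdge) (u : M.HalfEdge) : FunOp M.Conf :=
  rewireOp fun R => Disjoint R B ∧ u ∈ R

theorem avoid_eq_add (B : Finset M.HalfEdge) (u : M.HalfEdge) (φ : M.Conf → ℝ) (ξ : M.Conf) :
    avoid B φ ξ = avoid (insert u B) φ ξ + avoidRewire B u φ ξ := by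
  simp only [avoid, avoidRewire, rewireOp_apply]
  rw [← Finset.expect_add_distrib]
  refine Finset.expect_congr rfl fun R _ => ?_
  by_cases h1 : Disjoint R B <;> by_cases h2 : u ∈ R <;> simp [h1, h2]

theorem mem_map_iff_of_fixed {π : Equiv.Perm M.HalfEdge} {x : M.HalfEdge} (h : π x = x)
    (R : Finset M.HalfEdge) : x ∈ R.map π.toEmbedding ↔ x ∈ R := by
  conv_lhs => rw [← h]
  simp

theorem disjoint_map_iff {π : Equiv.Perm M.HalfEdge} {B : Finset M.HalfEdge}
    (h : ∀ x ∈ B, π x = x) (R : Finset M.HalfEdge) :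
    Disjoint (R.map π.toEmbedding) B ↔ Disjoint R B := by
  rw [Finset.disjoint_right, Finset.disjoint_right]
  exact forall₂_congr fun x hx => by rw [mem_map_iff_of_fixed (h x hx)]

variable {S B : Finset M.HalfEdge} {u : M.HalfEdge} {T : FunOp M.Conf} {i j : ℕ}

theorem isEquivariantOff_avoid (hB : B ⊆ S) : IsEquivariantOff S (avoid B) :=
  fun _ hπ => rewireOp_conj (disjoint_map_iff fun x hx => hπ x (hB hx))

theorem isEquivariantOff_avoidRewire (hB : B ⊆ S) (hu : u ∈ S) :
    IsEquivariantOff S (avoidRewire B u) :=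
  fun _ hπ => rewireOp_conj fun R => by
    rw [disjoint_map_iff fun x hx => hπ x (hB hx), mem_map_iff_of_fixed (hπ u hu)]

theorem rewireOp_le_dyn (c : Finset M.HalfEdge → Prop) [DecidablePred c] {φ ψ : M.Conf → ℝ}
    (h : ∀ ζ, φ ζ ≤ ψ ζ) (h0 : ∀ ζ, 0 ≤ ψ ζ) (ξ : M.Conf) : rewireOp c φ ξ ≤ M.dyn ψ ξ := by
  rw [dyn]
  exact rewireOp_mono (fun _ _ => trivial) h h0 ξ

/-- Operators describing `j` steps of the dynamics restricted to an event that depends only on which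
half-edges in `S` are rewired, and excludes that `u` is rewired. -/
structure IsRestriction (S : Finset M.HalfEdge) (u : M.HalfEdge) (j : ℕ)
    (T : FunOp M.Conf) : Prop where
  nonneg : T.IsPositive
  le : ∀ φ : M.Conf → ℝ, (∀ ζ, 0 ≤ φ ζ) → ∀ ξ, T φ ξ ≤ (M.dyn ^ j) φ ξ
  eqv : IsEquivariantOff S T
  keep : ∀ (a : M.HalfEdge) (ξ : M.Conf),
    T (fun ζ => if ζ.1 u = a then 1 else 0) ξ ≤ if ξ.1 u = a then 1 else 0

theorem isRestriction_one (S : Finset M.HalfEdge) (u : M.HalfEdge) : IsRestriction S u 0 1 where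
  nonneg _ h ξ := h ξ
  le _ _ _ := le_rfl
  eqv _ _ _ _ := rfl
  keep _ _ := le_rfl

theorem IsRestriction.rewireOp_mul_le (hT : IsRestriction S u j T) (c : Finset M.HalfEdge → Prop)
    [DecidablePred c] (φ : M.Conf → ℝ) (hφ : ∀ ζ, 0 ≤ φ ζ) (ξ : M.Conf) :
    (rewireOp c * T) φ ξ ≤ (M.dyn ^ (j + 1)) φ ξ := by
  rw [Module.End.mul_apply, pow_succ', Module.End.mul_apply]
  exact rewireOp_le_dyn c (hT.le φ hφ) (fun ζ => (hT.nonneg φ hφ ζ).trans (hT.le φ hφ ζ)) ξ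

theorem IsRestriction.avoid_mul (hT : IsRestriction S u j T) (hB : B ⊆ S) (hu : u ∈ B) :
    IsRestriction S u (j + 1) (avoid B * T) where
  nonneg := (rewireOp_isPositive _).mul hT.nonneg
  le := hT.rewireOp_mul_le _
  eqv := (isEquivariantOff_avoid hB).mul hT.eqv
  keep a ξ := by
    rw [Module.End.mul_apply, avoid]
    have h0 : ∀ ζ : M.Conf, (0 : ℝ) ≤ if ζ.1 u = a then 1 else 0 := fun ζ => by
      split_ifs <;> norm_num
    calc rewireOp (fun R => Disjoint R B) (T fun ζ => if ζ.1 u = a then 1 else 0) ξ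
        ≤ rewireOp (fun R => Disjoint R B) (fun ζ => if ζ.1 u = a then 1 else 0) ξ :=
          rewireOp_mono (fun _ h => h) (fun ζ => hT.keep a ζ) h0 ξ
      _ = rewireOp (fun R => Disjoint R B) (fun _ => if ξ.1 u = a then 1 else 0) ξ :=
          rewireOp_congr fun R hR ζ hζ => by
            simp only [hζ u (Finset.disjoint_right.1 hR hu)]
      _ ≤ M.dyn (fun _ => if ξ.1 u = a then 1 else 0) ξ :=
          rewireOp_le_dyn _ (fun _ => le_rfl) (fun _ => h0 ξ) ξ
      _ = _ := isExchangeable_dyn.const _ ξ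

theorem two_mul_k_sub_one_pos : (0 : ℝ) < 2 * M.k - 1 := by
  have : (2 : ℝ) ≤ M.k := by exact_mod_cast M.two_le_k
  linarith

theorem avoidRewire_partner_le (B : Finset M.HalfEdge) (u a : M.HalfEdge) (ξ : M.Conf) :
    avoidRewire B u (fun ζ => if ζ.1 u = a then 1 else 0) ξ ≤ 1 / (2 * M.k - 1) := by
  rw [avoidRewire, rewireOp_apply]
  refine Finset.expect_le (rewirings_nonempty ξ) fun R hR => ?_
  obtain ⟨hcard, hinv⟩ := mem_rewirings.1 hR
  split_ifs with h
  · refine (expect_repairings_partner_le hinv h.2 a).trans_eq ?_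
    rw [hcard]
    push_cast
    rfl
  · exact one_div_nonneg.2 two_mul_k_sub_one_pos.le

theorem IsRestriction.avoidRewire_mul_mem_le (hT : IsRestriction S u j T) (B U : Finset M.HalfEdge)
    (ξ : M.Conf) :
    (avoidRewire B u * T) (fun ζ => if ζ.1 u ∈ U then 1 else 0) ξ ≤ U.card / (2 * M.k - 1) := by
  have hpoint : ∀ a ∈ U, (avoidRewire B u * T) (fun ζ => if ζ.1 u = a then 1 else 0) ξ
      ≤ 1 / (2 * M.k - 1) := by
    intro a _
    rw [Module.End.mul_apply]
    refine le_trans ?_ (avoidRewire_partner_le B u a ξ)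
    rw [avoidRewire]
    exact rewireOp_mono (fun _ h => h) (hT.keep a) (fun ζ => by split_ifs <;> norm_num) ξ
  rw [apply_partner_eq_sum _ fun _ _ => 1]
  refine (Finset.sum_le_card_nsmul _ _ _ hpoint).trans_eq ?_
  rw [nsmul_eq_mul, mul_one_div]

theorem sum_abs_walkExp_edgeSwap_le {f : M.HalfEdge → ℝ} {K : ℝ} (hf : ∀ y, |f y| ≤ K) (j : ℕ)
    (ξ ζ : M.Conf) (a : M.HalfEdge) :
    ∑ b, |(𝔼 w ∈ M.siblings b, walkExp f j (conj (edgeSwap ξ a b) ζ) w)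
        - 𝔼 w ∈ M.siblings b, walkExp f j ζ w| ≤ 2 * K * (returns j ξ ζ + 4 * j) := by
  have hK0 : 0 ≤ K := (abs_nonneg _).trans (hf a)
  have hMk := isMarkov_replicate_dyn (M := M) (j := j)
  have hpoint : ∀ b, |(𝔼 w ∈ M.siblings b, walkExp f j (conj (edgeSwap ξ a b) ζ) w)
        - 𝔼 w ∈ M.siblings b, walkExp f j ζ w|
      ≤ 2 * K * ((𝔼 w ∈ M.siblings b, hit (List.replicate j M.dyn) {b, ξ.1 b} ζ w)
        + (𝔼 w ∈ M.siblings b, hit (List.replicate j M.dyn) {a} ζ w)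
        + 𝔼 w ∈ M.siblings b, hit (List.replicate j M.dyn) {ξ.1 a} ζ w) := by
    intro b
    rw [← Finset.expect_sub_distrib, ← Finset.expect_add_distrib, ← Finset.expect_add_distrib,
      Finset.mul_expect]
    refine (Finset.abs_expect_le _ _).trans (Finset.expect_le_expect fun w _ => ?_)
    have hfix : ∀ x, x ∉ (({b, ξ.1 b} : Finset M.HalfEdge) ∪ {a}) ∪ {ξ.1 a} →
        edgeSwap ξ a b x = x := by
      intro x hx
      simp only [Finset.mem_union, Finset.mem_insert, Finset.mem_singleton, not_or] at hx
      exact edgeSwap_fixed ξ hx.1.2 hx.1.1.1 hx.2 hx.1.1.2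
    refine (abs_walkExp_conj_sub_le hf hfix j ζ w).trans ?_
    refine mul_le_mul_of_nonneg_left ?_ (by positivity)
    refine (hit_union_le hMk _ _ ζ w).trans ?_
    gcongr
    exact hit_union_le hMk _ _ ζ w
  refine (Finset.sum_le_sum fun b _ => hpoint b).trans ?_
  rw [← Finset.mul_sum, Finset.sum_add_distrib, Finset.sum_add_distrib, sum_expect_siblings,
    sum_expect_siblings]
  have ha := sum_hit_start_le hMk ζ a
  have hpartner := sum_hit_start_le hMk ζ (ξ.1 a)
  rw [List.length_replicate] at ha hpartner
  refine mul_le_mul_of_nonneg_left ?_ (by positivity)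
  rw [returns]
  linarith

theorem IsRestriction.avoidRewire_mul_swap_le (hT : IsRestriction S u i T) (B : Finset M.HalfEdge)
    {f : M.HalfEdge → ℝ} {K : ℝ} (hf : ∀ y, |f y| ≤ K) (j : ℕ) {a : ℝ} (ha : 0 ≤ a) (ξ : M.Conf) :
    (avoidRewire B u * T) (fun ζ => a
      + ∑ b, |(𝔼 w ∈ M.siblings b, walkExp f j (conj (edgeSwap ξ (ζ.1 u) b) ζ) w)
        - 𝔼 w ∈ M.siblings b, walkExp f j ζ w|) ξ
      ≤ a + 2 * K * (returnExp (i + 1) j ξ + 4 * j) := by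
  have hMk := isExchangeable_dyn (M := M).pow (i + 1)
  refine (hT.rewireOp_mul_le _ _ (fun ζ => ?_) ξ).trans ?_
  · exact add_nonneg ha (Finset.sum_nonneg fun _ _ => abs_nonneg _)
  refine (hMk.mono (fun ζ => ?_) ξ).trans_eq
    (b := (M.dyn ^ (i + 1)) (fun ζ => (a + 8 * K * j) + 2 * K * returns j ξ ζ) ξ) ?_
  · linarith [sum_abs_walkExp_edgeSwap_le hf j ξ ζ (ζ.1 u)]
  · rw [FunOp.apply_add, hMk.const, FunOp.apply_const_mul, returnExp]
    ring

/-- Bound for the distance to uniformity of the walk `j` steps after it crosses an edge rewired at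
time `i`, if the rewiring of at most `s` half-edges is prescribed before. -/
noncomputable def crossErr (s i j : ℕ) (ξ : M.Conf) : ℝ :=
  2 * s / (2 * M.k - 1) + (2 * s + 8 * j + 2 * returnExp i j ξ) / M.ell

theorem crossErr_nonneg (s i j : ℕ) (ξ : M.Conf) : 0 ≤ crossErr s i j ξ := by
  have hk := M.two_mul_k_sub_one_pos
  have hr := returnExp_nonneg i j ξ
  rw [crossErr]
  positivity

theorem IsRestriction.abs_avoidRewire_le (hT : IsRestriction S u i T) (hB : B ⊆ S) (hu : u ∈ S)
    {s : ℕ} (hs : S.card ≤ s) (hsl : 4 * s ≤ M.ell) {f : M.HalfEdge → ℝ} {K : ℝ}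
    (hf : ∀ y, |f y| ≤ K) (hf0 : ∑ y, f y = 0) (j : ℕ) (ξ : M.Conf) :
    |avoidRewire B u (T (crossExp f j u)) ξ|
      ≤ 2 * K * crossErr s (i + 1) j ξ := by
  have hell : (0 : ℝ) < M.ell := by exact_mod_cast M.ell_pos
  have hk := M.two_mul_k_sub_one_pos
  have hK0 : 0 ≤ K := (abs_nonneg _).trans (hf u)
  have hU : ((edgeHull ξ S).card : ℝ) ≤ 2 * s := by
    exact_mod_cast (card_edgeHull_le ξ S).trans (by omega)
  have hslr : (4 * s : ℝ) ≤ M.ell := by exact_mod_cast hsl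
  have hpartner := abs_apply_partner_le (ξ := ξ)
    (T := avoidRewire B u * T) ((rewireOp_isPositive _).mul hT.nonneg)
    ((isEquivariantOff_avoidRewire hB hu).mul hT.eqv) hu
    (g := fun ζ a => 𝔼 w ∈ M.siblings a, walkExp f j ζ w) (K := K)
    (fun ζ a => abs_expect_le_of_forall_abs_le (M.siblings_nonempty _)
      fun w _ => abs_walkExp_le hf j ζ w)
    (fun ζ => by rw [sum_expect_siblings, sum_walkExp, hf0])
  have hmem := (hT.avoidRewire_mul_mem_le B (edgeHull ξ S) ξ).trans
    (div_le_div_of_nonneg_right hU hk.le)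
  have hswap := hT.avoidRewire_mul_swap_le B hf j
    (mul_nonneg hK0 (Nat.cast_nonneg (edgeHull ξ S).card)) ξ
  obtain ⟨A, hA⟩ :
    ∃ A, A = avoidRewire B u (T (crossExp f j u)) ξ := ⟨_, rfl⟩
  rw [Module.End.mul_apply, show (fun ζ : M.Conf => 𝔼 w ∈ M.siblings (ζ.1 u), walkExp f j ζ w)
    = crossExp f j u from rfl, ← hA] at hpartner
  rw [← hA]
  have hhalf : (M.ell : ℝ) / 2 * |A| ≤ M.ell * (K * (2 * s / (2 * M.k - 1)))
      + K * (2 * s + 8 * j + 2 * returnExp (i + 1) j ξ) := by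
    have h1 := mul_le_mul_of_nonneg_right
      (show (M.ell : ℝ) / 2 ≤ M.ell - (edgeHull ξ S).card by linarith) (abs_nonneg A)
    have h2 := mul_le_mul_of_nonneg_left (mul_le_mul_of_nonneg_left hmem hK0) hell.le
    have h3 := mul_le_mul_of_nonneg_left hU hK0
    linarith
  rw [mul_comm, ← le_div_iff₀ (by positivity)] at hhalf
  refine hhalf.trans_eq ?_
  rw [crossErr]
  field_simp

/-! ### The law of the trajectory -/

theorem pmfExp_step (ξ : M.Conf) (y : M.HalfEdge) (F : M.State → ℝ) :
    pmfExp (M.step ξ y) F = 𝔼 R ∈ M.rewirings ξ, 𝔼 ζ ∈ M.repairings ξ R,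
      𝔼 z ∈ M.siblings (ζ.1 y), F (ζ, R, z) := by
  rw [step, pmfExp_bind, pmfExp_uniformOfFinset, ← image_cut,
    Finset.expect_image ((cut_injOn ξ).mono fun _ hE => (Finset.mem_powersetCard.1 hE).1)]
  refine Finset.expect_congr rfl fun E _ => ?_
  rw [pmfExp_bind, pmfExp_uniformOfFinset]
  refine Finset.expect_congr rfl fun ζ _ => ?_
  rw [pmfExp_map, pmfExp_uniformOfFinset]

theorem mem_support_step {ξ : M.Conf} {y : M.HalfEdge} {s : M.State}
    (h : s ∈ (M.step ξ y).support) : s.1 ∈ M.repairings ξ s.2.1 := by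
  simp only [step, PMF.mem_support_bind_iff, PMF.support_map, Set.mem_image,
    PMF.mem_support_uniformOfFinset_iff] at h
  obtain ⟨E, -, ζ, hζ, z, -, rfl⟩ := h
  exact hζ

namespace Path

variable {t : ℕ}

/-- The walk has not moved along a previously rewired edge. -/
def Alive (w : M.Path t) : Prop :=
  ∀ s : Fin t, Path.pos w s.castSucc ∉ Path.rewiredUpTo w s.succ

/-- The positions before the last one, most recent first. -/
def past (w : M.Path t) : List M.HalfEdge :=
  (List.ofFn fun i : Fin t => Path.pos w i.castSucc).reverse

/-- The last position. -/
def cur (w : M.Path t) : M.HalfEdge := Path.pos w (Fin.last t)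

/-- The last configuration. -/
def conf (w : M.Path t) : M.Conf := (w (Fin.last t)).1

/-- All half-edges rewired so far. -/
def rewiredSet (w : M.Path t) : Set M.HalfEdge := Path.rewiredUpTo w (Fin.last t)

/-- Extension of a trajectory by one state. -/
def extend (w : M.Path t) (s : M.State) : M.Path (t + 1) := (Fin.snoc w s : Fin (t + 2) → M.State)

/-- The walk has not moved along a previously rewired edge, and no half-edge of `B` was rewired. -/
def AliveOff (w : M.Path t) (B : Finset M.HalfEdge) : Prop :=
  Alive w ∧ ∀ h ∈ B, h ∉ rewiredSet w

theorem extend_castSucc (w : M.Path t) (s : M.State) (i : Fin (t + 1)) :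
    extend w s i.castSucc = w i := Fin.snoc_castSucc (α := fun _ => M.State) s w i

theorem extend_last (w : M.Path t) (s : M.State) : extend w s (Fin.last (t + 1)) = s :=
  Fin.snoc_last (α := fun _ => M.State) s w

theorem rewiredUpTo_extend_castSucc (w : M.Path t) (s : M.State) (i : Fin (t + 1)) :
    Path.rewiredUpTo (extend w s) i.castSucc = Path.rewiredUpTo w i := by
  ext h
  simp only [rewiredUpTo, Set.mem_ofPred_eq, rewired]
  constructor
  · rintro ⟨r, hr0, hri, hh⟩
    induction r using Fin.lastCases with
    | last => exact absurd (lt_of_le_of_lt hri (Fin.castSucc_lt_last i)) (lt_irrefl _)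
    | cast r =>
      rw [extend_castSucc] at hh
      exact ⟨r, Fin.castSucc_lt_castSucc_iff.1 hr0, Fin.castSucc_le_castSucc_iff.1 hri, hh⟩
  · rintro ⟨r, hr0, hri, hh⟩
    refine ⟨r.castSucc, Fin.castSucc_lt_castSucc_iff.2 hr0,
      Fin.castSucc_le_castSucc_iff.2 hri, ?_⟩
    rwa [extend_castSucc]

theorem rewiredSet_extend (w : M.Path t) (s : M.State) :
    rewiredSet (extend w s) = rewiredSet w ∪ (s.2.1 : Set M.HalfEdge) := by
  ext h
  simp only [rewiredSet, rewiredUpTo, Set.mem_ofPred_eq, rewired, Set.mem_union, Finset.mem_coe]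
  constructor
  · rintro ⟨r, hr0, -, hh⟩
    induction r using Fin.lastCases with
    | last =>
      rw [extend_last] at hh
      exact Or.inr hh
    | cast r =>
      rw [extend_castSucc] at hh
      exact Or.inl ⟨r, Fin.castSucc_lt_castSucc_iff.1 hr0, Fin.le_last r, hh⟩
  · rintro (⟨r, hr0, -, hh⟩ | hh)
    · refine ⟨r.castSucc, Fin.castSucc_lt_castSucc_iff.2 hr0, Fin.le_last _, ?_⟩
      rwa [extend_castSucc]
    · exact ⟨Fin.last _, Fin.last_pos, le_rfl, by rwa [extend_last]⟩

theorem cur_extend (w : M.Path t) (s : M.State) : cur (extend w s) = s.2.2 := by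
  rw [cur, pos, extend_last]

theorem conf_extend (w : M.Path t) (s : M.State) : conf (extend w s) = s.1 := by
  rw [conf, extend_last]

theorem pos_extend_castSucc (w : M.Path t) (s : M.State) (i : Fin (t + 1)) :
    Path.pos (extend w s) i.castSucc = Path.pos w i := by
  rw [pos, extend_castSucc, pos]

theorem past_extend (w : M.Path t) (s : M.State) : past (extend w s) = cur w :: past w := by
  rw [past, List.ofFn_succ', List.concat_eq_append, List.reverse_concat']
  simp only [pos_extend_castSucc]
  rfl

theorem alive_extend (w : M.Path t) (s : M.State) :
    Alive (extend w s) ↔ Alive w ∧ cur w ∉ rewiredSet w ∧ cur w ∉ s.2.1 := by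
  have h : cur w ∉ rewiredSet (extend w s) ↔ cur w ∉ rewiredSet w ∧ cur w ∉ s.2.1 := by
    rw [rewiredSet_extend]
    simp
  rw [← h, Alive, Fin.forall_fin_succ']
  simp only [pos_extend_castSucc, Fin.succ_castSucc, rewiredUpTo_extend_castSucc, Fin.succ_last]
  rfl

theorem aliveOff_empty (w : M.Path t) : AliveOff w ∅ ↔ Alive w := by
  simp [AliveOff]

theorem aliveOff_extend (w : M.Path t) (s : M.State) (B : Finset M.HalfEdge) :
    AliveOff (extend w s) B
      ↔ AliveOff w (insert (cur w) B) ∧ Disjoint s.2.1 (insert (cur w) B) := by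
  simp only [AliveOff, alive_extend, rewiredSet_extend, Finset.disjoint_right,
    Finset.forall_mem_insert, Set.mem_union, Finset.mem_coe, not_or, forall₂_and]
  tauto

theorem lt_tau_iff (w : M.Path t) : (t : ℕ∞) < Path.tau w ↔ Alive w := by
  constructor
  · intro h s hs
    refine absurd (lt_of_lt_of_le h (sInf_le ⟨s, hs, rfl⟩)) (not_lt.2 ?_)
    exact_mod_cast s.2
  · intro h
    have : {r : ℕ∞ | ∃ s : Fin t,
        Path.pos w s.castSucc ∈ Path.rewiredUpTo w s.succ ∧ r = ((s : ℕ) + 1 : ℕ)} = ∅ := by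
      ext r
      simp only [Set.mem_ofPred_eq, Set.mem_empty_iff_false, iff_false, not_exists, not_and]
      exact fun s hs => absurd hs (h s)
    rw [tau, this, sInf_empty]
    exact ENat.natCast_lt_top t

end Path

open DynConfModel.Path

/-- Expectation for the chain started from `(η, x)`, for functions of the trajectory up to `t`. -/
noncomputable def pathExp (η : M.Conf) (x : M.HalfEdge) (t : ℕ) (F : M.Path t → ℝ) : ℝ :=
  pmfExp (M.pathLaw η x t) F

theorem pathExp_zero (η : M.Conf) (x : M.HalfEdge) (F : M.Path 0 → ℝ) :
    pathExp η x 0 F = F fun _ => (η, ∅, x) := by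
  rw [pathExp, pathLaw, pmfExp_pure]

theorem pathExp_succ (η : M.Conf) (x : M.HalfEdge) (t : ℕ) (F : M.Path (t + 1) → ℝ) :
    pathExp η x (t + 1) F = pathExp η x t fun w => 𝔼 R ∈ M.rewirings (conf w),
      𝔼 ζ ∈ M.repairings (conf w) R, 𝔼 z ∈ M.siblings (ζ.1 (cur w)), F (extend w (ζ, R, z)) := by
  rw [pathExp, pathLaw, pmfExp_bind, pathExp]
  refine pmfExp_congr fun w _ => ?_
  rw [pmfExp_map, pmfExp_step]
  rfl

theorem conf_eq_of_notMem_rewiredSet {η : M.Conf} {x : M.HalfEdge} {t : ℕ} {w : M.Path t}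
    (hw : w ∈ (M.pathLaw η x t).support) {h : M.HalfEdge} (hh : h ∉ rewiredSet w) :
    (conf w).1 h = η.1 h := by
  induction t generalizing h with
  | zero =>
    rw [pathLaw, PMF.mem_support_pure_iff] at hw
    rw [hw]
    rfl
  | succ t ih =>
    rw [pathLaw, PMF.mem_support_bind_iff] at hw
    obtain ⟨w', hw', hw⟩ := hw
    rw [PMF.support_map, Set.mem_image] at hw
    obtain ⟨s, hs, rfl⟩ := hw
    change h ∉ rewiredSet (extend w' s) at hh
    change (conf (extend w' s)).1 h = _
    rw [rewiredSet_extend] at hh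
    simp only [Set.mem_union, Finset.mem_coe, not_or] at hh
    rw [conf_extend, mem_repairings.1 (mem_support_step hs) h hh.2]
    exact ih hw' hh.1

/-! ### The walk on the initial configuration -/

/-- Expectation for the walk on the fixed configuration `η`, for functions of the past positions
(most recent first) and the current position. -/
noncomputable def staticExp (η : M.Conf) : ℕ → List M.HalfEdge → M.HalfEdge →
    (List M.HalfEdge → M.HalfEdge → ℝ) → ℝ
  | 0, l, y, F => F l y
  | s + 1, l, y, F => 𝔼 w ∈ M.siblings (η.1 y), staticExp η s (y :: l) w F

theorem staticExp_succ (η : M.Conf) (s : ℕ) (l : List M.HalfEdge) (y : M.HalfEdge)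
    (F : List M.HalfEdge → M.HalfEdge → ℝ) :
    staticExp η (s + 1) l y F
      = staticExp η s l y fun l' y' => 𝔼 w ∈ M.siblings (η.1 y'), F (y' :: l') w := by
  induction s generalizing l y with
  | zero => rfl
  | succ s ih =>
    rw [staticExp]
    conv_rhs => rw [staticExp]
    exact Finset.expect_congr rfl fun w _ => ih (y :: l) w

theorem staticExp_sub (η : M.Conf) (s : ℕ) (l : List M.HalfEdge) (y : M.HalfEdge)
    (F G : List M.HalfEdge → M.HalfEdge → ℝ) :
    staticExp η s l y (fun l y => F l y - G l y) = staticExp η s l y F - staticExp η s l y G := by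
  induction s generalizing l y with
  | zero => rfl
  | succ s ih =>
    simp only [staticExp]
    rw [← Finset.expect_sub_distrib]
    exact Finset.expect_congr rfl fun w _ => ih (y :: l) w

theorem staticExp_sum {ι : Type*} (I : Finset ι) (η : M.Conf) (s : ℕ) (l : List M.HalfEdge)
    (y : M.HalfEdge) (F : ι → List M.HalfEdge → M.HalfEdge → ℝ) :
    staticExp η s l y (fun l y => ∑ i ∈ I, F i l y) = ∑ i ∈ I, staticExp η s l y (F i) := by
  induction s generalizing l y with
  | zero => rfl
  | succ s ih =>
    simp only [staticExp]
    rw [← Finset.expect_sum_comm]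
    exact Finset.expect_congr rfl fun w _ => ih (y :: l) w

theorem staticExp_mono (η : M.Conf) (s : ℕ) (l : List M.HalfEdge) (y : M.HalfEdge)
    {F G : List M.HalfEdge → M.HalfEdge → ℝ}
    (h : ∀ l' y', l'.length = l.length + s → F l' y' ≤ G l' y') :
    staticExp η s l y F ≤ staticExp η s l y G := by
  induction s generalizing l y with
  | zero => exact h l y rfl
  | succ s ih =>
    simp only [staticExp]
    refine Finset.expect_le_expect fun w _ => ih (y :: l) w fun l' y' hl => h l' y' ?_
    rw [hl, List.length_cons]
    omega

theorem staticExp_const (η : M.Conf) (s : ℕ) (l : List M.HalfEdge) (y : M.HalfEdge) (c : ℝ) :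
    staticExp η s l y (fun _ _ => c) = c := by
  induction s generalizing l y with
  | zero => rfl
  | succ s ih =>
    rw [staticExp, Finset.expect_congr rfl fun w _ => ih (y :: l) w,
      Finset.expect_const (M.siblings_nonempty _)]

theorem abs_staticExp_le (η : M.Conf) (s : ℕ) (l : List M.HalfEdge) (y : M.HalfEdge)
    {F G : List M.HalfEdge → M.HalfEdge → ℝ}
    (h : ∀ l' y', l'.length = l.length + s → |F l' y'| ≤ G l' y') :
    |staticExp η s l y F| ≤ staticExp η s l y G := by
  induction s generalizing l y with
  | zero => exact h l y rfl
  | succ s ih =>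
    simp only [staticExp]
    refine (Finset.abs_expect_le _ _).trans
      (Finset.expect_le_expect fun w _ => ih (y :: l) w fun l' y' hl => h l' y' ?_)
    rw [hl, List.length_cons]
    omega

/-- For `l = [x_{s-1}, …, x_0]`, the dynamics of the configuration during `s` steps, restricted to
the event that `x_j` is not rewired up to time `j + 1` and that `B` is not rewired at all. -/
noncomputable def chainOp : List M.HalfEdge → Finset M.HalfEdge → FunOp M.Conf
  | [], _ => 1
  | y :: l, B => chainOp l (insert y B) * avoid (insert y B)

theorem expect_siblings_eq_sum (y : M.HalfEdge) (g : M.HalfEdge → ℝ) :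
    𝔼 z ∈ M.siblings y, g z
      = ∑ z, (if z ∈ M.siblings y then ((M.siblings y).card : ℝ)⁻¹ else 0) * g z := by
  simp only [ite_mul, zero_mul, Finset.sum_ite_mem, Finset.univ_inter]
  rw [Finset.expect_eq_sum_div_card, div_eq_inv_mul, Finset.mul_sum]

open Classical in
theorem expect_extend_aliveOff {η : M.Conf} {x : M.HalfEdge} {s : ℕ} {w : M.Path s}
    (hw : w ∈ (M.pathLaw η x s).support) (B : M.HalfEdge → Finset M.HalfEdge)
    (G : M.HalfEdge → M.Conf → ℝ) :
    (𝔼 R ∈ M.rewirings (conf w), 𝔼 ζ ∈ M.repairings (conf w) R, 𝔼 z ∈ M.siblings (ζ.1 (cur w)),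
        if AliveOff (extend w (ζ, R, z)) (B z) then G z ζ else 0)
      = 𝔼 z ∈ M.siblings (η.1 (cur w)), if AliveOff w (insert (cur w) (B z)) then
          avoid (insert (cur w) (B z)) (G z) (conf w) else 0 := by
  have hsiblings : ∀ R, ∀ ζ ∈ M.repairings (conf w) R,
      (𝔼 z ∈ M.siblings (ζ.1 (cur w)),
        if AliveOff (extend w (ζ, R, z)) (B z) then G z ζ else 0)
      = 𝔼 z ∈ M.siblings (η.1 (cur w)), if AliveOff w (insert (cur w) (B z)) then
          if Disjoint R (insert (cur w) (B z)) then G z ζ else 0 else 0 := by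
    intro R ζ hζ
    simp only [aliveOff_extend, ite_and]
    by_cases hcur : cur w ∉ rewiredSet w ∧ cur w ∉ R
    · rw [mem_repairings.1 hζ _ hcur.2, conf_eq_of_notMem_rewiredSet hw hcur.1]
    · have hzero : ∀ z, (if AliveOff w (insert (cur w) (B z)) then
          if Disjoint R (insert (cur w) (B z)) then G z ζ else 0 else 0) = 0 := by
        intro z
        rw [← ite_and, if_neg]
        rintro ⟨⟨-, hoff⟩, hdisj⟩
        exact hcur ⟨hoff _ (Finset.mem_insert_self _ _),
          Finset.disjoint_right.1 hdisj (Finset.mem_insert_self _ _)⟩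
      simp only [hzero, Finset.expect_const_zero]
  rw [Finset.expect_congr rfl fun R _ => (Finset.expect_congr rfl (hsiblings R)).trans
    (Finset.expect_comm _ _ _), Finset.expect_comm]
  refine Finset.expect_congr rfl fun z _ => ?_
  split_ifs
  · rw [avoid, rewireOp_apply]
    refine Finset.expect_congr rfl fun R _ => ?_
    split_ifs
    · rfl
    · exact Finset.expect_const_zero _
  · simp only [Finset.expect_const_zero]

open Classical in
/-- As long as no rewired edge is used, the walk is the walk on the initial configuration. -/
theorem pathExp_aliveOff (η : M.Conf) (x : M.HalfEdge) (s : ℕ)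
    (B : List M.HalfEdge → M.HalfEdge → Finset M.HalfEdge)
    (F : List M.HalfEdge → M.HalfEdge → M.Conf → ℝ) :
    pathExp η x s (fun w =>
        if AliveOff w (B (past w) (cur w)) then F (past w) (cur w) (conf w) else 0)
      = staticExp η s [] x fun l y => chainOp l (B l y) (F l y) η := by
  induction s generalizing B F with
  | zero =>
    rw [pathExp_zero, if_pos]
    · rfl
    · refine ⟨fun i => i.elim0, fun h _ => ?_⟩
      rintro ⟨r, hr0, hr, -⟩
      exact absurd (lt_of_lt_of_le hr0 hr) (by simp)
  | succ s ih =>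
    have hstep : pathExp η x (s + 1) (fun w =>
          if AliveOff w (B (past w) (cur w)) then F (past w) (cur w) (conf w) else 0)
        = pathExp η x s fun w => ∑ z,
            if AliveOff w (insert (cur w) (B (cur w :: past w) z)) then
              (if z ∈ M.siblings (η.1 (cur w)) then ((M.siblings (η.1 (cur w))).card : ℝ)⁻¹
                else 0) * avoid (insert (cur w) (B (cur w :: past w) z))
                  (F (cur w :: past w) z) (conf w) else 0 := by
      rw [pathExp_succ]
      refine pmfExp_congr fun w hw => ?_
      simp only [past_extend, cur_extend, conf_extend]
      rw [expect_extend_aliveOff hw (B (cur w :: past w)) (F (cur w :: past w)),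
        expect_siblings_eq_sum]
      simp only [mul_ite, mul_zero]
    rw [hstep, pathExp, pmfExp_sum, staticExp_succ]
    refine (Finset.sum_congr rfl fun z _ => ih (fun l y => insert y (B (y :: l) z)) fun l y ζ =>
      (if z ∈ M.siblings (η.1 y) then ((M.siblings (η.1 y)).card : ℝ)⁻¹ else 0) *
        avoid (insert y (B (y :: l) z)) (F (y :: l) z) ζ).trans ?_
    rw [← staticExp_sum]
    congr 1
    ext l y
    rw [expect_siblings_eq_sum]
    exact Finset.sum_congr rfl fun z _ => FunOp.apply_const_mul _ _ _ _

theorem avoid_le_dyn (B : Finset M.HalfEdge) {φ : M.Conf → ℝ} (h : ∀ ζ, 0 ≤ φ ζ) (ξ : M.Conf) :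
    avoid B φ ξ ≤ M.dyn φ ξ := by
  rw [avoid]
  exact rewireOp_le_dyn _ (fun _ => le_rfl) h ξ

theorem chainOp_isPositive (l : List M.HalfEdge) (B : Finset M.HalfEdge) :
    (chainOp l B).IsPositive := by
  induction l generalizing B with
  | nil => exact fun _ h ξ => h ξ
  | cons y l ih => exact (ih _).mul (rewireOp_isPositive _)

theorem chainOp_le (l : List M.HalfEdge) (B : Finset M.HalfEdge) {φ : M.Conf → ℝ}
    (h : ∀ ζ, 0 ≤ φ ζ) (ξ : M.Conf) : chainOp l B φ ξ ≤ (M.dyn ^ l.length) φ ξ := by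
  induction l generalizing B φ with
  | nil => exact le_rfl
  | cons y l ih =>
    rw [chainOp, Module.End.mul_apply, List.length_cons, pow_succ, Module.End.mul_apply]
    refine (ih _ (rewireOp_isPositive _ _ h)).trans ?_
    exact (isExchangeable_dyn.pow _).mono (avoid_le_dyn _ h) ξ

theorem abs_chainOp_le (l : List M.HalfEdge) (B : Finset M.HalfEdge) {φ ψ : M.Conf → ℝ}
    (h : ∀ ζ, |φ ζ| ≤ ψ ζ) (ξ : M.Conf) : |chainOp l B φ ξ| ≤ (M.dyn ^ l.length) ψ ξ :=
  ((chainOp_isPositive l B).abs_le h ξ).trans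
    (chainOp_le l B (fun ζ => (abs_nonneg _).trans (h ζ)) ξ)

/-! ### The walk after the first use of a rewired edge -/

theorem abs_chainOp_sub_le {S : Finset M.HalfEdge} {u : M.HalfEdge} (hu : u ∈ S) {s : ℕ}
    (hs : S.card ≤ s) (hsl : 4 * s ≤ M.ell) {f : M.HalfEdge → ℝ} {K : ℝ} (hf : ∀ y, |f y| ≤ K)
    (hf0 : ∑ y, f y = 0) (j : ℕ) (η : M.Conf) {l : List M.HalfEdge} (hl : ∀ x ∈ l, x ∈ S)
    {B : Finset M.HalfEdge} (hB : B ⊆ S) {i : ℕ} {T : FunOp M.Conf} (hT : IsRestriction S u i T) :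
    |chainOp l B (avoid B (T (crossExp f j u))) η
      - chainOp l (insert u B) (avoid (insert u B) (T (crossExp f j u))) η|
      ≤ 2 * K * ∑ p ∈ Finset.range (l.length + 1),
        (M.dyn ^ p) (crossErr s (i + l.length - p + 1) j) η := by
  induction l generalizing B i T with
  | nil =>
    simp only [List.length_nil, zero_add, Finset.sum_range_one, chainOp, Module.End.one_apply,
      pow_zero, add_zero, Nat.sub_zero]
    rw [avoid_eq_add B u, add_sub_cancel_left]
    exact hT.abs_avoidRewire_le hB hu hs hsl hf hf0 j η
  | cons y l ih =>
    have hyS : y ∈ S := hl y (by simp)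
    have hT' := hT.avoid_mul (Finset.insert_subset hu hB) (Finset.mem_insert_self u B)
    have hsplit : chainOp (y :: l) B (avoid B (T (crossExp f j u))) η
        = chainOp (y :: l) B (avoid (insert u B) (T (crossExp f j u))) η
          + chainOp (y :: l) B (avoidRewire B u (T (crossExp f j u))) η := by
      rw [← FunOp.apply_add]
      exact FunOp.apply_congr _ (avoid_eq_add B u _) η
    have hlater := ih (fun x hx => hl x (by simp [hx])) (Finset.insert_subset hyS hB) hT'
    have hnow := abs_chainOp_le (y :: l) B
      (fun ξ => hT.abs_avoidRewire_le hB hu hs hsl hf hf0 j ξ) η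
    rw [FunOp.apply_const_mul] at hnow
    rw [hsplit, add_sub_right_comm, List.length_cons, Finset.sum_range_succ, mul_add]
    refine (abs_add_le _ _).trans (add_le_add ?_ ?_)
    · rw [Finset.insert_comm u y B] at hlater
      refine LE.le.trans_eq hlater ?_
      rw [show i + 1 + l.length = i + (l.length + 1) by omega]
    · rwa [Nat.add_sub_cancel]

open Classical in
theorem pathExp_not_alive_succ (f : M.HalfEdge → ℝ) (η : M.Conf) (x : M.HalfEdge) (t j : ℕ) :
    pathExp η x (t + 1) (fun w => if Alive w then 0 else walkExp f j (conf w) (cur w))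
      = pathExp η x t (fun w => if Alive w then 0 else walkExp f (j + 1) (conf w) (cur w))
        + staticExp η t [] x fun l y => chainOp l ∅ (avoid ∅ (crossExp f j y)) η
          - chainOp l {y} (avoid {y} (crossExp f j y)) η := by
  rw [staticExp_sub, ← pathExp_aliveOff η x t (fun _ _ => ∅) fun _ y => avoid ∅ (crossExp f j y),
    ← pathExp_aliveOff η x t (fun _ y => {y}) fun _ y => avoid {y} (crossExp f j y), pathExp_succ,
    pathExp, pathExp, pathExp, pathExp, ← pmfExp_sub, ← pmfExp_add]
  refine pmfExp_congr fun w _ => ?_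
  simp only [alive_extend, cur_extend, conf_extend, AliveOff, Finset.mem_singleton, forall_eq,
    Finset.notMem_empty, false_imp_iff, implies_true, and_true]
  by_cases hA : Alive w
  · by_cases hy : cur w ∈ rewiredSet w
    · simp [hA, hy, avoid, rewireOp_apply, crossExp]
    · simp only [hA, hy, not_false_eq_true, true_and, if_true, zero_add, avoid, rewireOp_apply]
      rw [← Finset.expect_sub_distrib]
      refine Finset.expect_congr rfl fun R _ => ?_
      by_cases hR : cur w ∈ R
      · simp [hR, crossExp]
      · simp [hR, Finset.expect_const (M.siblings_nonempty _)]
  · simp [hA, walkExp, dyn, rewireOp_apply]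

open Classical in
theorem abs_pathExp_not_alive_le {f : M.HalfEdge → ℝ} {K : ℝ} (hf : ∀ y, |f y| ≤ K)
    (hf0 : ∑ y, f y = 0) {L : ℕ} (hL : 4 * L ≤ M.ell) (η : M.Conf) (x : M.HalfEdge) (t j : ℕ)
    (htj : t + j ≤ L) :
    |pathExp η x t fun w => if Alive w then 0 else walkExp f j (conf w) (cur w)|
      ≤ 2 * K * ∑ s ∈ Finset.range t, ∑ p ∈ Finset.range (s + 1),
        (M.dyn ^ p) (crossErr L (s - p + 1) (t + j - s - 1)) η := by
  induction t generalizing j with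
  | zero =>
    have h : Alive (fun _ => (η, ∅, x) : M.Path 0) := fun i => Fin.elim0 i
    rw [pathExp_zero, if_pos h]
    simp
  | succ t ih =>
    rw [pathExp_not_alive_succ, Finset.sum_range_succ, mul_add]
    refine (abs_add_le _ _).trans (add_le_add ?_ ?_)
    · refine (ih (j + 1) (by omega)).trans_eq ?_
      rw [← Nat.add_assoc t j 1, Nat.add_right_comm t j 1]
    · rw [show t + 1 + j - t - 1 = j by omega]
      refine (abs_staticExp_le η t [] x (G := fun _ _ => _) fun l y hl => ?_).trans
        (staticExp_const η t [] x _).le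
      rw [List.length_nil, zero_add] at hl
      have hcard : (insert y l.toFinset).card ≤ L := by
        have := Finset.card_insert_le y l.toFinset
        have := List.toFinset_card_le l
        omega
      simpa only [Module.End.one_apply, zero_add, hl, insert_empty_eq] using
        abs_chainOp_sub_le (Finset.mem_insert_self y l.toFinset) hcard hL hf hf0 j η (l := l)
          (fun z hz => by simp [hz]) (Finset.empty_subset _) (isRestriction_one _ _)

/-! ### The tail of the first use of a rewired edge -/

/-- Probability that none of `j` given edges is rewired in one step. -/
noncomputable def keepProb (M : DynConfModel n) (j : ℕ) : ℝ :=
  ((M.m - j).choose M.k : ℝ) / (M.m.choose M.k : ℝ)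

theorem keepProb_mem_Icc (j : ℕ) : M.keepProb j ∈ Set.Icc (0 : ℝ) 1 := by
  refine ⟨by rw [keepProb]; positivity, div_le_one_of_le₀ ?_ (by positivity)⟩
  exact_mod_cast Nat.choose_le_choose _ (Nat.sub_le _ _)

theorem keepProb_zero : M.keepProb 0 = 1 := by
  rw [keepProb, Nat.sub_zero, div_self]
  exact_mod_cast (Nat.choose_pos M.k_le_m).ne'

theorem keepProb_succ {j : ℕ} (hj : j < M.m) :
    M.keepProb (j + 1) = M.keepProb j * (((M.m - j - M.k : ℕ) : ℝ) / (M.m - j : ℕ)) := by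
  obtain ⟨r, hr⟩ : ∃ r, M.m - j = r + 1 := ⟨M.m - j - 1, by omega⟩
  have hchoose : ((r.choose M.k * (r + 1 : ℕ) : ℕ) : ℝ)
      = (((r + 1).choose M.k * (r + 1 - M.k) : ℕ) : ℝ) := by rw [Nat.choose_mul_succ_eq]
  have hr1 : ((r + 1 : ℕ) : ℝ) ≠ 0 := by exact_mod_cast r.succ_ne_zero
  rw [keepProb, keepProb, Nat.sub_add_eq, hr, Nat.add_sub_cancel, div_mul_div_comm,
    ← Nat.cast_mul, ← hchoose, Nat.cast_mul, mul_div_mul_right _ _ hr1]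

theorem keepProb_one : M.keepProb 1 = 1 - M.alpha := by
  have hm : (M.m : ℝ) ≠ 0 := by exact_mod_cast M.m_pos.ne'
  rw [keepProb_succ M.m_pos, keepProb_zero, one_mul, Nat.sub_zero, Nat.cast_sub M.k_le_m, alpha,
    sub_div, div_self hm]

theorem alpha_pos : 0 < M.alpha := by
  have hk : 0 < M.k := two_pos.trans_le M.two_le_k
  have hm := M.m_pos
  rw [alpha]
  positivity

theorem alpha_le_one : M.alpha ≤ 1 :=
  div_le_one_of_le₀ (by exact_mod_cast M.k_le_m) (Nat.cast_nonneg _)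

theorem avoid_one {ξ : M.Conf} {B : Finset M.HalfEdge} (hB : ∀ x ∈ B, ξ.1 x ∉ B) :
    avoid B (fun _ => 1) ξ = M.keepProb B.card := by
  rw [avoid, rewireOp_apply]
  simp only [Finset.expect_const (M.repairings_nonempty ξ _)]
  rw [Finset.expect_eq_sum_div_card, card_rewirings, ← Finset.sum_filter, Finset.sum_const,
    nsmul_eq_mul, mul_one, card_rewirings_disjoint hB, keepProb]

theorem avoid_one_le (y : M.HalfEdge) (B : Finset M.HalfEdge) (ξ : M.Conf) :
    avoid (insert y B) (fun _ => 1) ξ ≤ 1 - M.alpha := by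
  calc avoid (insert y B) (fun _ => 1) ξ ≤ avoid {y} (fun _ => 1) ξ :=
        rewireOp_mono (fun R hR => hR.mono_right (by simp)) (fun _ => le_rfl)
          (fun _ => zero_le_one) ξ
    _ = 1 - M.alpha := by
        rw [avoid_one (by simp [conf_ne]), Finset.card_singleton, keepProb_one]

theorem chainOp_one_mem_Icc (l : List M.HalfEdge) (B : Finset M.HalfEdge) (η : M.Conf) :
    chainOp l B (fun _ => 1) η ∈ Set.Icc (0 : ℝ) 1 :=
  ⟨chainOp_isPositive l B _ (fun _ => zero_le_one) η,
    (chainOp_le l B (fun _ => zero_le_one) η).trans_eq ((isExchangeable_dyn.pow _).const 1 η)⟩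

theorem chainOp_one_le (y : M.HalfEdge) (l : List M.HalfEdge) (B : Finset M.HalfEdge)
    (η : M.Conf) : chainOp (y :: l) B (fun _ => 1) η ≤ 1 - M.alpha := by
  calc chainOp l (insert y B) (avoid (insert y B) fun _ => 1) η
      ≤ chainOp l (insert y B) (fun _ => (1 - M.alpha) * 1) η :=
        (chainOp_isPositive l _).mono (fun ζ => by simpa using avoid_one_le y B ζ) η
    _ = (1 - M.alpha) * chainOp l (insert y B) (fun _ => 1) η := FunOp.apply_const_mul _ _ _ _
    _ ≤ 1 - M.alpha :=
        mul_le_of_le_one_right (sub_nonneg.2 M.alpha_le_one) (chainOp_one_mem_Icc l _ η).2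

theorem chainOp_congr (l : List M.HalfEdge) (B : Finset M.HalfEdge) {φ ψ : M.Conf → ℝ} {η : M.Conf}
    (h : ∀ ζ : M.Conf, (∀ x ∈ B, ζ.1 x = η.1 x) → φ ζ = ψ ζ) :
    chainOp l B φ η = chainOp l B ψ η := by
  induction l generalizing B φ ψ with
  | nil => exact h η fun _ _ => rfl
  | cons y l ih =>
    rw [chainOp, Module.End.mul_apply, Module.End.mul_apply]
    refine ih _ fun ζ hζ => ?_
    rw [avoid]
    refine rewireOp_congr fun R hR θ hθ => h θ fun x hx => ?_
    have hx' : x ∈ insert y B := Finset.mem_insert_of_mem hx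
    rw [hθ x (Finset.disjoint_right.1 hR hx'), hζ x hx']

theorem chainOp_one_eq {η : M.Conf} (l : List M.HalfEdge) (B : Finset M.HalfEdge)
    (hl : l.Nodup) (hlB : ∀ x ∈ l, x ∉ B)
    (h : ∀ x ∈ l.toFinset ∪ B, η.1 x ∉ l.toFinset ∪ B) :
    chainOp l B (fun _ => 1) η
      = ∏ j ∈ Finset.range l.length, M.keepProb (B.card + j + 1) := by
  induction l generalizing B with
  | nil => rfl
  | cons y l ih =>
    rw [List.nodup_cons] at hl
    rw [List.forall_mem_cons] at hlB
    rw [List.toFinset_cons, Finset.insert_union, ← Finset.union_insert] at h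
    have hcard : (insert y B).card = B.card + 1 := Finset.card_insert_of_notMem hlB.1
    have hfirst : chainOp (y :: l) B (fun _ => 1) η
        = chainOp l (insert y B) (fun _ => M.keepProb (B.card + 1) * 1) η := by
      refine chainOp_congr l _ fun ζ hζ => ?_
      rw [avoid_one, hcard, mul_one]
      exact fun x hx hx' => h x (Finset.mem_union_right _ hx)
        (Finset.mem_union_right _ (hζ x hx ▸ hx'))
    have hnotMem : ∀ x ∈ l, x ∉ insert y B := fun x hx => by
      rw [Finset.mem_insert, not_or]
      exact ⟨fun hxy => hl.1 (hxy ▸ hx), hlB.2 x hx⟩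
    rw [hfirst, FunOp.apply_const_mul, ih _ hl.2 hnotMem h, hcard, List.length_cons,
      Finset.prod_range_succ', mul_comm, add_zero]
    exact congrArg (· * _) (Finset.prod_congr rfl fun j _ => by
      rw [Nat.add_right_comm B.card 1 j, Nat.add_assoc B.card j 1])

/-- The half-edges in `l` lie on distinct edges of `η`. -/
def DistinctEdges (η : M.Conf) (l : List M.HalfEdge) : Prop :=
  l.Nodup ∧ ∀ x ∈ l, η.1 x ∉ l

theorem DistinctEdges.cons {η : M.Conf} {l : List M.HalfEdge} {y : M.HalfEdge}
    (h : DistinctEdges η l) (hy : y ∉ l) (hy' : ∀ x ∈ l, η.1 x ≠ y) :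
    DistinctEdges η (y :: l) := by
  refine ⟨List.nodup_cons.2 ⟨hy, h.1⟩, fun x hx hx' => ?_⟩
  rcases List.mem_cons.1 hx with rfl | hx <;> rcases List.mem_cons.1 hx' with hx' | hx'
  · exact conf_ne η _ hx'
  · exact hy' _ hx' (conf_conf η _)
  · exact hy' x hx hx'
  · exact h.2 x hx hx'

theorem DistinctEdges.tail {η : M.Conf} {l : List M.HalfEdge} {y : M.HalfEdge}
    (h : DistinctEdges η (y :: l)) : DistinctEdges η l :=
  ⟨(List.nodup_cons.1 h.1).2, fun x hx hx' =>
    h.2 x (List.mem_cons_of_mem _ hx) (List.mem_cons_of_mem _ hx')⟩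

open Classical in
/-- The walk on `η` uses an edge twice only if it visits a vertex twice. -/
theorem staticExp_not_distinctEdges_le (η : M.Conf) (s : ℕ) {l : List M.HalfEdge}
    {y : M.HalfEdge} {V : Finset (Fin n)} (hdistinct : DistinctEdges η (y :: l))
    (hV : ∀ x ∈ y :: l, x.1 ∈ V) (hV' : ∀ x ∈ l, (η.1 x).1 ∈ V) :
    staticExp η s l y (fun l' _ => if DistinctEdges η l' then 0 else 1)
      ≤ revisit (List.replicate s 1) V η y := by
  induction s generalizing l y V with
  | zero =>
    rw [staticExp, if_pos hdistinct.tail]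
    exact le_rfl
  | succ s ih =>
    rw [staticExp, List.replicate_succ, revisit, Module.End.one_apply]
    split_ifs with hvisited
    · refine Finset.expect_le (M.siblings_nonempty _) fun w _ =>
        (staticExp_mono η s _ w (G := fun _ _ => 1) fun l' _ _ => ?_).trans_eq
          (staticExp_const η s _ w 1)
      split_ifs <;> norm_num
    · refine Finset.expect_le_expect fun w hw => ?_
      obtain ⟨hw, hne⟩ := M.mem_siblings.1 hw
      have hwV : w.1 ∉ V := by rwa [hw]
      refine ih (hdistinct.cons (fun h => hwV (hV w h)) (List.forall_mem_cons.2
        ⟨hne.symm, fun x hx hxw => hwV (hxw ▸ hV' x hx)⟩)) (List.forall_mem_cons.2 ⟨?_, ?_⟩)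
        (List.forall_mem_cons.2 ⟨Finset.mem_insert_self _ _, ?_⟩)
      · exact hw ▸ Finset.mem_insert_self _ _
      · exact fun x hx => Finset.mem_insert_of_mem (hV x hx)
      · exact fun x hx => Finset.mem_insert_of_mem (hV' x hx)

theorem prob_eq_pathExp (η : M.Conf) (x : M.HalfEdge) (t : ℕ) (A : Set (M.Path t)) :
    M.prob η x t A = pathExp η x t (A.indicator fun _ => 1) := by
  rw [prob, PMF.toOuterMeasure_apply_fintype, ENNReal.toReal_sum]
  · refine Finset.sum_congr rfl fun w _ => ?_
    by_cases h : w ∈ A <;> simp [h]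
  · intro w _
    by_cases h : w ∈ A
    · simpa [h] using PMF.apply_ne_top _ _
    · simp [h]

theorem prob_lt_tau (η : M.Conf) (x : M.HalfEdge) (t : ℕ) :
    M.prob η x t {w | (t : ℕ∞) < Path.tau w}
      = staticExp η t [] x fun l _ => chainOp l ∅ (fun _ => 1) η := by
  classical
  rw [prob_eq_pathExp, ← pathExp_aliveOff η x t (fun _ _ => ∅) (fun _ _ _ => 1)]
  refine pmfExp_congr fun w _ => ?_
  simp only [Set.indicator_apply, Set.mem_ofPred_eq, lt_tau_iff, aliveOff_empty]

theorem abs_prob_lt_tau_sub_le (η : M.Conf) (x : M.HalfEdge) (t : ℕ) :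
    |M.prob η x t {w | (t : ℕ∞) < Path.tau w} - ∏ j ∈ Finset.range t, M.keepProb (j + 1)|
      ≤ revisit (List.replicate t 1) {x.1} η x := by
  classical
  have hprod : ∏ j ∈ Finset.range t, M.keepProb (j + 1) ∈ Set.Icc (0 : ℝ) 1 :=
    ⟨Finset.prod_nonneg fun j _ => (keepProb_mem_Icc _).1,
      Finset.prod_le_one (fun j _ => (keepProb_mem_Icc _).1) fun j _ => (keepProb_mem_Icc _).2⟩
  rw [prob_lt_tau, ← staticExp_const η t [] x (∏ j ∈ Finset.range t, M.keepProb (j + 1)),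
    ← staticExp_sub]
  refine (abs_staticExp_le η t [] x fun l _ hl => ?_).trans (staticExp_not_distinctEdges_le η t
    (l := []) (y := x) ⟨by simp, by simp [conf_ne]⟩ (by simp) (by simp))
  rw [List.length_nil, zero_add] at hl
  split_ifs with h
  · rw [chainOp_one_eq l ∅ h.1 (by simp) (by simpa using h.2), hl]
    simp
  · exact abs_sub_le_of_le_of_le (chainOp_one_mem_Icc l ∅ η).1 (chainOp_one_mem_Icc l ∅ η).2
      hprod.1 hprod.2 |>.trans_eq (sub_zero 1)

theorem prob_lt_tau_le (η : M.Conf) (x : M.HalfEdge) {t : ℕ} (ht : 1 ≤ t) :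
    M.prob η x t {w | (t : ℕ∞) < Path.tau w} ≤ 1 - M.alpha := by
  rw [prob_lt_tau]
  refine (staticExp_mono η t [] x (G := fun _ _ => 1 - M.alpha) fun l _ hl => ?_).trans_eq
    (staticExp_const η t [] x _)
  cases l with
  | nil => simp only [List.length_nil] at hl; omega
  | cons z l => exact chainOp_one_le z l ∅ η

/-! ### Closeness to uniformity after the first use of a rewired edge -/

/-- Bounds, up to a constant, the distance from uniformity at time `t` on the event that a rewired
edge has been used. The summand at `s` and `p` is the error made when the first such edge is used
at step `s + 1` and the positions up to time `s - p` force it not to be rewired before. -/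
noncomputable def mixErr (t : ℕ) (η : M.Conf) : ℝ :=
  ∑ s ∈ Finset.range t, ∑ p ∈ Finset.range (s + 1),
    (M.dyn ^ p) (crossErr t (s - p + 1) (t - s - 1)) η

theorem mixErr_nonneg (t : ℕ) (η : M.Conf) : 0 ≤ mixErr t η :=
  Finset.sum_nonneg fun _ _ => Finset.sum_nonneg fun p _ =>
    (isExchangeable_dyn.pow p).nonneg _ (fun _ => crossErr_nonneg _ _ _ _) η

theorem alpha_mul_ell : M.alpha * M.ell = 2 * M.k := by
  have hm : (M.m : ℝ) ≠ 0 := by exact_mod_cast M.m_pos.ne'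
  rw [alpha, ell_eq]
  push_cast
  field_simp

theorem sum_crossErr_le {t i j : ℕ} (hj : j + 1 ≤ t) :
    ∑ ξ : M.Conf, crossErr t i j ξ
      ≤ Fintype.card M.Conf * (t ^ 2 * (26 + 8 * M.nu) / (M.alpha * M.ell)) := by
  have hell : (0 : ℝ) < M.ell := by exact_mod_cast M.ell_pos
  have hα := M.alpha_pos
  have hν := M.nu_nonneg
  have hk : (2 : ℝ) ≤ M.k := by exact_mod_cast M.two_le_k
  have hjt : (j : ℝ) + 1 ≤ t := by exact_mod_cast hj
  have ht1 : (1 : ℝ) ≤ t := by exact_mod_cast (Nat.succ_pos j).trans_le hj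
  have hreturn : ∑ ξ : M.Conf, returnExp i j ξ
      ≤ Fintype.card M.Conf * (t ^ 2 * (4 * M.nu + 6)) :=
    (sum_returnExp_le i j).trans (by gcongr)
  have hrewire : 2 * (t : ℝ) / (2 * M.k - 1) ≤ 4 * t ^ 2 / (M.alpha * M.ell) := by
    rw [alpha_mul_ell, div_le_div_iff₀ (by linarith) (by linarith)]
    have htsq : (t : ℝ) ≤ t ^ 2 := le_self_pow₀ ht1 two_ne_zero
    nlinarith [mul_nonneg (sub_nonneg.2 htsq) (zero_le_two.trans hk),
      mul_nonneg (sq_nonneg (t : ℝ)) (sub_nonneg.2 (one_le_two.trans hk))]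
  have hdegenerate : (2 * t + 8 * j + 2 * (t ^ 2 * (4 * M.nu + 6))) / (M.ell : ℝ)
      ≤ (10 * t ^ 2 + 2 * (t ^ 2 * (4 * M.nu + 6))) / (M.alpha * M.ell) := by
    gcongr
    · nlinarith
    · exact mul_le_of_le_one_left hell.le M.alpha_le_one
  calc ∑ ξ : M.Conf, crossErr t i j ξ
      = Fintype.card M.Conf * (2 * t / (2 * M.k - 1) + (2 * t + 8 * j) / M.ell)
        + 2 / M.ell * ∑ ξ : M.Conf, returnExp i j ξ := by
        rw [Finset.mul_sum, ← nsmul_eq_mul, ← Finset.card_univ, ← Finset.sum_const,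
          ← Finset.sum_add_distrib]
        exact Finset.sum_congr rfl fun ξ _ => by rw [crossErr]; ring
    _ ≤ Fintype.card M.Conf * (2 * t / (2 * M.k - 1) + (2 * t + 8 * j) / M.ell)
        + 2 / M.ell * (Fintype.card M.Conf * (t ^ 2 * (4 * M.nu + 6))) := by gcongr
    _ = Fintype.card M.Conf * (2 * t / (2 * M.k - 1)
        + (2 * t + 8 * j + 2 * (t ^ 2 * (4 * M.nu + 6))) / M.ell) := by ring
    _ ≤ Fintype.card M.Conf * (4 * t ^ 2 / (M.alpha * M.ell)
        + (10 * t ^ 2 + 2 * (t ^ 2 * (4 * M.nu + 6))) / (M.alpha * M.ell)) := by gcongr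
    _ = Fintype.card M.Conf * (t ^ 2 * (26 + 8 * M.nu) / (M.alpha * M.ell)) := by ring

theorem sum_mixErr_le (t : ℕ) :
    ∑ η : M.Conf, mixErr t η
      ≤ Fintype.card M.Conf * (t ^ 4 * (26 + 8 * M.nu) / (M.alpha * M.ell)) := by
  set b : ℝ := Fintype.card M.Conf * (t ^ 2 * (26 + 8 * M.nu) / (M.alpha * M.ell)) with hb
  have hb0 : 0 ≤ b := by
    have := M.alpha_pos
    have := M.nu_nonneg
    positivity
  calc ∑ η : M.Conf, mixErr t η
      = ∑ s ∈ Finset.range t, ∑ p ∈ Finset.range (s + 1),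
          ∑ ξ : M.Conf, crossErr t (s - p + 1) (t - s - 1) ξ := by
        simp only [mixErr]
        rw [Finset.sum_comm]
        refine Finset.sum_congr rfl fun s _ => ?_
        rw [Finset.sum_comm]
        exact Finset.sum_congr rfl fun p _ => (isExchangeable_dyn.pow p).sum _
    _ ≤ ∑ _s ∈ Finset.range t, (t : ℝ) * b := by
        refine Finset.sum_le_sum fun s hs => ?_
        rw [Finset.mem_range] at hs
        calc ∑ p ∈ Finset.range (s + 1), ∑ ξ : M.Conf, crossErr t (s - p + 1) (t - s - 1) ξ
            ≤ ∑ _p ∈ Finset.range (s + 1), b :=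
              Finset.sum_le_sum fun p _ => sum_crossErr_le (by omega)
          _ = ((s + 1 : ℕ) : ℝ) * b := by rw [Finset.sum_const, Finset.card_range, nsmul_eq_mul]
          _ ≤ t * b := by
              have : ((s + 1 : ℕ) : ℝ) ≤ t := by exact_mod_cast hs
              gcongr
    _ = Fintype.card M.Conf * (t ^ 4 * (26 + 8 * M.nu) / (M.alpha * M.ell)) := by
        rw [Finset.sum_const, Finset.card_range, nsmul_eq_mul, hb]
        ring

theorem tau_le_iff {t : ℕ} (w : M.Path t) : Path.tau w ≤ (t : ℕ∞) ↔ ¬ Alive w := by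
  rw [← not_lt, lt_tau_iff]

theorem prob_tau_le (η : M.Conf) (x : M.HalfEdge) (t : ℕ) :
    M.prob η x t {w | Path.tau w ≤ (t : ℕ∞)}
      = 1 - M.prob η x t {w | (t : ℕ∞) < Path.tau w} := by
  classical
  rw [prob_eq_pathExp, prob_eq_pathExp, eq_sub_iff_add_eq, pathExp, pathExp, ← pmfExp_add]
  refine (pmfExp_congr fun w _ => ?_).trans (pmfExp_const (M.pathLaw η x t) 1)
  by_cases h : Alive w <;> simp [tau_le_iff, lt_tau_iff, h]

theorem sum_mul_prob_cur_inter (η : M.Conf) (x : M.HalfEdge) (t : ℕ) (A : Set (M.Path t))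
    (f : M.HalfEdge → ℝ) :
    ∑ y, f y * M.prob η x t ({w | Path.pos w (Fin.last t) = y} ∩ A)
      = pathExp η x t (A.indicator fun w => f (cur w)) := by
  classical
  simp only [prob_eq_pathExp, pathExp, ← pmfExp_const_mul]
  rw [← pmfExp_sum]
  refine pmfExp_congr fun w _ => ?_
  by_cases h : w ∈ A <;> simp [h, cur, Set.indicator_apply]

theorem sum_prob_cur_inter (η : M.Conf) (x : M.HalfEdge) (t : ℕ) (A : Set (M.Path t)) :
    ∑ y, M.prob η x t ({w | Path.pos w (Fin.last t) = y} ∩ A) = M.prob η x t A := by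
  simpa only [one_mul, prob_eq_pathExp η x t A] using sum_mul_prob_cur_inter η x t A fun _ => 1

theorem sum_abs_prob_cur_sub_le (η : M.Conf) (x : M.HalfEdge) {t : ℕ} (ht : 4 * t ≤ M.ell) :
    ∑ y, |M.prob η x t ({w | Path.pos w (Fin.last t) = y} ∩ {w | Path.tau w ≤ (t : ℕ∞)})
        - M.prob η x t {w | Path.tau w ≤ (t : ℕ∞)} / M.ell| ≤ 4 * mixErr t η := by
  classical
  set A : Set (M.Path t) := {w | Path.tau w ≤ (t : ℕ∞)} with hA
  have hell : (M.ell : ℝ) ≠ 0 := by exact_mod_cast M.ell_pos.ne'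
  obtain ⟨f, hf, hf0, hsum⟩ := exists_sum_abs_eq_sum_mul (g := fun y : M.HalfEdge =>
      M.prob η x t ({w | Path.pos w (Fin.last t) = y} ∩ A) - M.prob η x t A / M.ell) (by
    rw [Finset.sum_sub_distrib, sum_prob_cur_inter, Finset.sum_const, Finset.card_univ,
      card_halfEdge, nsmul_eq_mul, mul_div_cancel₀ _ hell, sub_self])
  have hpath : pathExp η x t (A.indicator fun w => f (cur w))
      = pathExp η x t fun w => if Alive w then 0 else walkExp f 0 (conf w) (cur w) :=
    pmfExp_congr fun w _ => by
      by_cases h : Alive w <;> simp [hA, tau_le_iff, h, walkExp]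
  rw [hsum]
  simp only [mul_sub, Finset.sum_sub_distrib]
  rw [← Finset.sum_mul, hf0, zero_mul, sub_zero, sum_mul_prob_cur_inter, hpath]
  refine (le_abs_self _).trans ((abs_pathExp_not_alive_le hf hf0 ht η x t 0 le_rfl).trans_eq ?_)
  rw [mixErr]
  norm_num

theorem tvDist_condLaw_le (η : M.Conf) (x : M.HalfEdge) {t : ℕ} (ht : 1 ≤ t)
    (hL : 4 * t ≤ M.ell) :
    tvDist (M.condLaw η x t {w | Path.tau w ≤ (t : ℕ∞)}) M.unif ≤ 2 * mixErr t η / M.alpha := by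
  have hell : (0 : ℝ) < M.ell := by exact_mod_cast M.ell_pos
  set A : Set (M.Path t) := {w | Path.tau w ≤ (t : ℕ∞)}
  have hα := M.alpha_pos
  have hαA : M.alpha ≤ M.prob η x t A := by
    rw [prob_tau_le]
    linarith [prob_lt_tau_le η x ht]
  have hA : 0 < M.prob η x t A := hα.trans_le hαA
  have hnonneg := mixErr_nonneg t η
  calc tvDist (M.condLaw η x t A) M.unif
      = 1 / 2 * ((∑ y, |M.prob η x t ({w | Path.pos w (Fin.last t) = y} ∩ A)
          - M.prob η x t A / M.ell|) / M.prob η x t A) := by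
        rw [tvDist, Finset.sum_div]
        congr 1
        refine Finset.sum_congr rfl fun y _ => ?_
        rw [← abs_of_pos hA, ← abs_div, abs_of_pos hA, condLaw, unif]
        congr 1
        field_simp
    _ ≤ 1 / 2 * (4 * mixErr t η / M.alpha) := by
        gcongr
        exact sum_abs_prob_cur_sub_le η x hL
    _ = 2 * mixErr t η / M.alpha := by ring

/-! ### Balls in the initial configuration -/

/-- The half-edges at vertices within distance `i` of the vertex of `x`. -/
def ball (η : M.Conf) (x : M.HalfEdge) : ℕ → Finset M.HalfEdge
  | 0 => Finset.univ.filter fun w => w.1 = x.1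
  | i + 1 => Finset.univ.filter fun w => w ∈ ball η x i ∨ ∃ y ∈ ball η x i, w.1 = (η.1 y).1

theorem mem_ball_succ {η : M.Conf} {x w : M.HalfEdge} {i : ℕ} :
    w ∈ ball η x (i + 1) ↔ w ∈ ball η x i ∨ ∃ y ∈ ball η x i, w.1 = (η.1 y).1 := by
  simp [ball]

theorem mem_ball_of_vertex_eq {η : M.Conf} {x w c : M.HalfEdge} {i : ℕ} (h : w.1 = c.1)
    (hc : c ∈ ball η x i) : w ∈ ball η x i := by
  induction i with
  | zero =>
    simp only [ball, Finset.mem_filter, Finset.mem_univ, true_and] at hc ⊢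
    rw [h, hc]
  | succ i ih =>
    rw [mem_ball_succ] at hc ⊢
    rcases hc with hc | ⟨y, hy, hc⟩
    · exact Or.inl (ih hc)
    · exact Or.inr ⟨y, hy, h.trans hc⟩

theorem ball_subset_succ (η : M.Conf) (x : M.HalfEdge) (i : ℕ) :
    ball η x i ⊆ ball η x (i + 1) := fun _ hw => mem_ball_succ.2 (Or.inl hw)

theorem conf_mem_ball_succ {η : M.Conf} {x y : M.HalfEdge} {i : ℕ} (h : y ∈ ball η x i) :
    η.1 y ∈ ball η x (i + 1) := mem_ball_succ.2 (Or.inr ⟨y, h, rfl⟩)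

theorem staticExp_eq_zero {η : M.Conf} {x : M.HalfEdge} {F : List M.HalfEdge → M.HalfEdge → ℝ}
    {s i : ℕ} {l : List M.HalfEdge} {y : M.HalfEdge} (hy : y ∈ ball η x i)
    (hF : ∀ l' y', y' ∈ ball η x (i + s) → F l' y' = 0) : staticExp η s l y F = 0 := by
  induction s generalizing l y i with
  | zero => exact hF l y hy
  | succ s ih =>
    rw [staticExp, ← Finset.expect_const (M.siblings_nonempty (η.1 y)) (0 : ℝ)]
    refine Finset.expect_congr rfl fun w hw => ih (i := i + 1) ?_ fun l' y' h => hF l' y' ?_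
    · exact mem_ball_of_vertex_eq (M.mem_siblings.1 hw).1 (conf_mem_ball_succ hy)
    · rwa [← add_assoc, add_right_comm]

theorem prob_cur_inter_lt_tau_eq_zero {η : M.Conf} {x y : M.HalfEdge} {t : ℕ}
    (hy : y ∉ ball η x t) :
    M.prob η x t ({w | Path.pos w (Fin.last t) = y} ∩ {w | (t : ℕ∞) < Path.tau w}) = 0 := by
  classical
  have h := pathExp_aliveOff η x t (fun _ _ => ∅) fun _ z _ => if z = y then 1 else 0
  rw [prob_eq_pathExp]
  refine Eq.trans (pmfExp_congr fun w _ => ?_) (h.trans (staticExp_eq_zero (x := x) (i := 0) ?_ ?_))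
  · simp only [lt_tau_iff, Set.indicator_apply, Set.mem_inter_iff, Set.mem_ofPred_eq, and_comm,
      ite_and, aliveOff_empty, cur]
    rfl
  · simp [ball]
  · intro l z hz
    rw [zero_add] at hz
    have hzy : z ≠ y := fun h => hy (h ▸ hz)
    simp only [hzy, if_false]
    exact congrFun (map_zero (chainOp l ∅)) η

theorem le_tvDist_condLaw (η : M.Conf) (x : M.HalfEdge) (t : ℕ)
    (hpos : 0 < M.prob η x t {w | (t : ℕ∞) < Path.tau w}) :
    1 - ((ball η x t).card : ℝ) / M.ell
      ≤ tvDist (M.condLaw η x t {w | (t : ℕ∞) < Path.tau w}) M.unif := by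
  have hell : (M.ell : ℝ) ≠ 0 := by exact_mod_cast M.ell_pos.ne'
  have hcond : ∑ y, M.condLaw η x t {w | (t : ℕ∞) < Path.tau w} y = 1 := by
    simp only [condLaw]
    rw [← Finset.sum_div, sum_prob_cur_inter, div_self hpos.ne']
  have hunif : ∑ y, M.unif y = 1 := by
    simp only [unif, Finset.sum_const, Finset.card_univ, card_halfEdge, nsmul_eq_mul]
    field_simp
  have hball : ∑ y ∈ ball η x t, M.unif y = (ball η x t).card / M.ell := by
    simp [unif, div_eq_mul_inv]
  rw [← hball]
  refine one_sub_sum_le_tvDist hcond hunif fun y hy => ?_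
  rw [condLaw, prob_cur_inter_lt_tau_eq_zero hy, zero_div]

theorem ball_conj_swap {η : M.Conf} {x b c : M.HalfEdge} {i : ℕ} (hb : b ∉ ball η x i)
    (hc : c ∉ ball η x i) : ball (conj (Equiv.swap c b) η) x i = ball η x i := by
  induction i with
  | zero => rfl
  | succ i ih =>
    have hb' : b ∉ ball η x i := fun h => hb (ball_subset_succ η x i h)
    have hc' : c ∉ ball η x i := fun h => hc (ball_subset_succ η x i h)
    have hconj : ∀ y ∈ ball η x i, (conj (Equiv.swap c b) η).1 y = η.1 y := by
      intro y hy
      have hy' := conf_mem_ball_succ hy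
      rw [conj_apply_of_fixed, Equiv.swap_apply_of_ne_of_ne]
      · exact fun h => hc (h ▸ hy')
      · exact fun h => hb (h ▸ hy')
      · exact Equiv.swap_apply_of_ne_of_ne (fun h => hc' (h ▸ hy)) fun h => hb' (h ▸ hy)
    ext w
    rw [mem_ball_succ, mem_ball_succ, ih hb' hc']
    refine or_congr Iff.rfl (exists_congr fun y => and_congr_right fun hy => ?_)
    rw [hconj y hy]

theorem conj_swap_conj_swap (η : M.Conf) (b c : M.HalfEdge) :
    conj (Equiv.swap c b) (conj (Equiv.swap c b) η) = η := by
  apply Subtype.ext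
  ext1 y
  simp [conj_apply]

/-- The half-edges outside of a ball that are paired with a half-edge in the ball. -/
def boundary (η : M.Conf) (x : M.HalfEdge) (i : ℕ) : Finset M.HalfEdge :=
  Finset.univ.filter fun c => c ∉ ball η x i ∧ η.1 c ∈ ball η x i

theorem mem_boundary {η : M.Conf} {x c : M.HalfEdge} {i : ℕ} :
    c ∈ boundary η x i ↔ c ∉ ball η x i ∧ η.1 c ∈ ball η x i := by
  simp [boundary]

theorem card_boundary_le (η : M.Conf) (x : M.HalfEdge) (i : ℕ) :
    (boundary η x i).card ≤ (ball η x i).card := by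
  refine Finset.card_le_card_of_injOn η.1 (fun c hc => ?_) η.1.injective.injOn
  exact (mem_boundary.1 (Finset.mem_coe.1 hc)).2

theorem mem_boundary_conj_swap {η : M.Conf} {x b c : M.HalfEdge} {i : ℕ}
    (hc : c ∈ boundary η x i) (hb : b ∉ ball η x i) :
    b ∈ boundary (conj (Equiv.swap c b) η) x i ∧ c ∉ ball (conj (Equiv.swap c b) η) x i := by
  obtain ⟨hcball, hηc⟩ := mem_boundary.1 hc
  rw [mem_boundary, ball_conj_swap hb hcball]
  refine ⟨⟨hb, ?_⟩, hcball⟩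
  rw [conj_apply, Equiv.swap_inv, Equiv.swap_apply_right, Equiv.swap_apply_of_ne_of_ne]
  · exact hηc
  · exact conf_ne η c
  · exact fun h => hb (h ▸ hηc)

theorem mem_boundary_conj_swap_iff {η : M.Conf} {x b c : M.HalfEdge} {i : ℕ} :
    (b ∈ boundary (conj (Equiv.swap c b) η) x i ∧ c ∉ ball (conj (Equiv.swap c b) η) x i)
      ↔ c ∈ boundary η x i ∧ b ∉ ball η x i := by
  refine ⟨fun ⟨hb, hc⟩ => ?_, fun ⟨hc, hb⟩ => mem_boundary_conj_swap hc hb⟩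
  simpa only [Equiv.swap_comm b c, conj_swap_conj_swap] using mem_boundary_conj_swap hb hc

-- Swapping `b` and `c` preserves the law of `η`, so a half-edge outside of the ball is as likely
-- to be paired with the ball as any other one.
theorem sum_boundary_mul_le (x c : M.HalfEdge) (i : ℕ) {F : Finset M.HalfEdge → ℝ}
    (hF : ∀ B, 0 ≤ F B) :
    ∑ η : M.Conf, (if c ∈ boundary η x i then F (ball η x i) * (M.ell - (ball η x i).card) else 0)
      ≤ ∑ η : M.Conf, F (ball η x i) * (ball η x i).card := by
  have hcompl (η : M.Conf) : (M.ell : ℝ) - (ball η x i).card = (ball η x i)ᶜ.card := by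
    rw [Finset.card_compl, card_halfEdge, Nat.cast_sub]
    exact card_halfEdge (M := M) ▸ Finset.card_le_univ _
  calc ∑ η : M.Conf, (if c ∈ boundary η x i then
          F (ball η x i) * (M.ell - (ball η x i).card) else 0)
      = ∑ η : M.Conf, ∑ b, if c ∈ boundary η x i ∧ b ∉ ball η x i then F (ball η x i) else 0 := by
        refine Finset.sum_congr rfl fun η _ => ?_
        simp only [hcompl, ite_and, Finset.sum_ite_irrel, Finset.sum_const_zero,
          ← Finset.mem_compl, Finset.sum_ite_mem, Finset.univ_inter, Finset.sum_const,
          nsmul_eq_mul, mul_comm]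
    _ = ∑ b, ∑ η : M.Conf, if b ∈ boundary η x i ∧ c ∉ ball η x i then F (ball η x i) else 0 := by
        rw [Finset.sum_comm]
        refine Finset.sum_congr rfl fun b _ => ?_
        rw [← Equiv.sum_comp (conj (Equiv.swap c b)) fun η : M.Conf =>
          if b ∈ boundary η x i ∧ c ∉ ball η x i then F (ball η x i) else 0]
        refine Finset.sum_congr rfl fun η _ => ?_
        rw [if_congr mem_boundary_conj_swap_iff rfl rfl]
        refine ite_congr rfl (fun h => ?_) fun _ => rfl
        rw [ball_conj_swap h.2 (mem_boundary.1 h.1).1]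
    _ ≤ ∑ b, ∑ η : M.Conf, if b ∈ boundary η x i then F (ball η x i) else 0 := by
        refine Finset.sum_le_sum fun b _ => Finset.sum_le_sum fun η _ => ?_
        by_cases hb : b ∈ boundary η x i <;> by_cases hc : c ∈ ball η x i <;> simp [hb, hc, hF]
    _ = ∑ η : M.Conf, F (ball η x i) * (boundary η x i).card := by
        rw [Finset.sum_comm]
        refine Finset.sum_congr rfl fun η _ => ?_
        rw [Finset.sum_ite_mem, Finset.univ_inter, Finset.sum_const, nsmul_eq_mul, mul_comm]
    _ ≤ ∑ η : M.Conf, F (ball η x i) * (ball η x i).card := by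
        refine Finset.sum_le_sum fun η _ => mul_le_mul_of_nonneg_left ?_ (hF _)
        exact_mod_cast card_boundary_le η x i

theorem card_ball_succ_le (η : M.Conf) (x : M.HalfEdge) (i : ℕ) :
    (ball η x (i + 1)).card
      ≤ (ball η x i).card + ∑ c ∈ boundary η x i, M.d c.1 := by
  have hsub : ball η x (i + 1) ⊆ ball η x i ∪ (boundary η x i).biUnion
      fun c => Finset.univ.filter fun w : M.HalfEdge => w.1 = c.1 := by
    intro w hw
    rw [Finset.mem_union, Finset.mem_biUnion, or_iff_not_imp_left]
    intro hwball
    obtain ⟨y, hy, hwy⟩ := (mem_ball_succ.1 hw).resolve_left hwball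
    refine ⟨η.1 y, mem_boundary.2 ⟨fun h => hwball (mem_ball_of_vertex_eq hwy h), ?_⟩, ?_⟩
    · rwa [conf_conf]
    · simpa using hwy
  simpa only [card_filter_vertex_eq] using (Finset.card_le_card hsub).trans
    ((Finset.card_union_le _ _).trans (Nat.add_le_add_left Finset.card_biUnion_le _))

theorem sum_d_vertex : ∑ x : M.HalfEdge, (M.d x.1 : ℝ) = M.ell * (M.nu + 1) := by
  have hell : (M.ell : ℝ) ≠ 0 := by exact_mod_cast M.ell_pos.ne'
  rw [nu, Finset.sum_sub_distrib, Finset.sum_const, Finset.card_univ, card_halfEdge, nsmul_one]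
  field_simp
  ring

/-- The size of a ball relative to half of all half-edges, truncated at `1`: up to this size the
growth of a ball is dominated by a branching process. -/
noncomputable def ballRatio (η : M.Conf) (x : M.HalfEdge) (i : ℕ) : ℝ :=
  min 1 (2 * (ball η x i).card / M.ell)

theorem ballRatio_nonneg (η : M.Conf) (x : M.HalfEdge) (i : ℕ) : 0 ≤ ballRatio η x i :=
  le_min zero_le_one (by positivity)

theorem ballRatio_of_le {η : M.Conf} {x : M.HalfEdge} {i : ℕ} (h : 2 * (ball η x i).card ≤ M.ell) :
    ballRatio η x i = 2 * (ball η x i).card / M.ell := by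
  rw [ballRatio, min_eq_right]
  exact div_le_one_of_le₀ (by exact_mod_cast h) (by positivity)

theorem ballRatio_of_lt {η : M.Conf} {x : M.HalfEdge} {i : ℕ} (h : M.ell < 2 * (ball η x i).card) :
    ballRatio η x i = 1 := by
  have hell : (0 : ℝ) < M.ell := by exact_mod_cast M.ell_pos
  rw [ballRatio, min_eq_left]
  rw [one_le_div hell]
  exact_mod_cast h.le

theorem sum_boundary_small_le (x c : M.HalfEdge) (i : ℕ) :
    ∑ η : M.Conf, (if c ∈ boundary η x i ∧ 2 * (ball η x i).card ≤ M.ell then (1 : ℝ) else 0)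
      ≤ ∑ η : M.Conf, ballRatio η x i := by
  have hell : (0 : ℝ) < M.ell := by exact_mod_cast M.ell_pos
  set F : Finset M.HalfEdge → ℝ := fun B => if 2 * B.card ≤ M.ell then 2 / M.ell else 0 with hF
  have hF0 (B) : 0 ≤ F B := by
    rw [hF]
    positivity
  refine (Finset.sum_le_sum fun η _ => ?_).trans
    ((sum_boundary_mul_le x c i hF0).trans (Finset.sum_le_sum fun η _ => ?_))
  · by_cases hc : c ∈ boundary η x i <;> by_cases h : 2 * (ball η x i).card ≤ M.ell
    · have hreal : 2 * ((ball η x i).card : ℝ) ≤ M.ell := by exact_mod_cast h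
      simp only [hF, hc, h, and_self, if_true]
      rw [div_mul_eq_mul_div, one_le_div hell]
      linarith
    all_goals simp [hF, hc, h]
  · rcases le_or_gt (2 * (ball η x i).card) M.ell with h | h
    · rw [ballRatio_of_le h, hF]
      simp only [if_pos h]
      exact (div_mul_eq_mul_div _ _ _).le
    · simp only [hF, if_neg h.not_ge, zero_mul]
      exact ballRatio_nonneg η x i

theorem ballRatio_succ_le (η : M.Conf) (x : M.HalfEdge) (i : ℕ) :
    ballRatio η x (i + 1) ≤ ballRatio η x i + 2 / M.ell * ∑ c,
      (if c ∈ boundary η x i ∧ 2 * (ball η x i).card ≤ M.ell then (1 : ℝ) else 0)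
        * M.d c.1 := by
  rcases le_or_gt (2 * (ball η x i).card) M.ell with h | h
  · have hcard : ((ball η x (i + 1)).card : ℝ)
        ≤ (ball η x i).card + ∑ c ∈ boundary η x i, (M.d c.1 : ℝ) := by
      exact_mod_cast card_ball_succ_le η x i
    simp only [h, and_true, ite_mul, one_mul, zero_mul]
    rw [Finset.sum_ite_mem, Finset.univ_inter, ballRatio_of_le h, div_mul_eq_mul_div, ← add_div,
      ← mul_add]
    refine (min_le_right (1 : ℝ) _).trans ?_
    gcongr
  · simpa [ballRatio_of_lt h, h.not_ge] using show ballRatio η x (i + 1) ≤ 1 from min_le_left _ _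

theorem sum_ballRatio_succ_le (x : M.HalfEdge) (i : ℕ) :
    ∑ η : M.Conf, ballRatio η x (i + 1) ≤ (2 * M.nu + 3) * ∑ η : M.Conf, ballRatio η x i := by
  have hell : (M.ell : ℝ) ≠ 0 := by exact_mod_cast M.ell_pos.ne'
  calc ∑ η : M.Conf, ballRatio η x (i + 1)
      ≤ ∑ η : M.Conf, (ballRatio η x i + 2 / M.ell * ∑ c,
          (if c ∈ boundary η x i ∧ 2 * (ball η x i).card ≤ M.ell then (1 : ℝ) else 0)
            * M.d c.1) :=
        Finset.sum_le_sum fun η _ => ballRatio_succ_le η x i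
    _ = ∑ η : M.Conf, ballRatio η x i + 2 / M.ell * ∑ c, (∑ η : M.Conf,
          if c ∈ boundary η x i ∧ 2 * (ball η x i).card ≤ M.ell then (1 : ℝ) else 0)
            * M.d c.1 := by
        rw [Finset.sum_add_distrib, ← Finset.mul_sum, Finset.sum_comm]
        simp only [Finset.sum_mul]
    _ ≤ ∑ η : M.Conf, ballRatio η x i + 2 / M.ell * ∑ c : M.HalfEdge,
          (∑ η : M.Conf, ballRatio η x i) * M.d c.1 := by
        refine add_le_add_right (mul_le_mul_of_nonneg_left (Finset.sum_le_sum fun c _ => ?_)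
          (by positivity)) _
        exact mul_le_mul_of_nonneg_right (sum_boundary_small_le x c i) (Nat.cast_nonneg _)
    _ = (2 * M.nu + 3) * ∑ η : M.Conf, ballRatio η x i := by
        rw [← Finset.mul_sum, sum_d_vertex]
        field_simp
        ring

theorem sum_sum_ballRatio_le (i : ℕ) :
    ∑ x : M.HalfEdge, ∑ η : M.Conf, ballRatio η x i
      ≤ Fintype.card M.Conf * ((2 * M.nu + 3) ^ i * (2 * (M.nu + 1))) := by
  have hell : (M.ell : ℝ) ≠ 0 := by exact_mod_cast M.ell_pos.ne'
  have hν := M.nu_nonneg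
  induction i with
  | zero =>
    calc ∑ x : M.HalfEdge, ∑ η : M.Conf, ballRatio η x 0
        ≤ ∑ x : M.HalfEdge, ∑ _η : M.Conf, 2 * (M.d x.1 : ℝ) / M.ell := by
          gcongr with x _ η _
          refine (min_le_right _ _).trans_eq ?_
          rw [ball, card_filter_vertex_eq]
      _ = Fintype.card M.Conf * ((2 * M.nu + 3) ^ 0 * (2 * (M.nu + 1))) := by
          simp only [Finset.sum_const, nsmul_eq_mul, ← Finset.mul_sum, ← Finset.sum_div,
            Finset.card_univ]
          rw [sum_d_vertex]
          field_simp
  | succ i ih =>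
    calc ∑ x : M.HalfEdge, ∑ η : M.Conf, ballRatio η x (i + 1)
        ≤ (2 * M.nu + 3) * ∑ x : M.HalfEdge, ∑ η : M.Conf, ballRatio η x i := by
          rw [Finset.mul_sum]
          exact Finset.sum_le_sum fun x _ => sum_ballRatio_succ_le x i
      _ ≤ (2 * M.nu + 3)
          * (Fintype.card M.Conf * ((2 * M.nu + 3) ^ i * (2 * (M.nu + 1)))) := by gcongr
      _ = Fintype.card M.Conf * ((2 * M.nu + 3) ^ (i + 1) * (2 * (M.nu + 1))) := by ring

theorem abs_keepRatio_sub_le {j : ℕ} (hj : j < M.m) :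
    |((M.m - j - M.k : ℕ) : ℝ) / (M.m - j : ℕ) - (1 - M.alpha)| ≤ j / (M.m - j : ℕ) := by
  have hm : (0 : ℝ) < M.m := by exact_mod_cast M.m_pos
  have hkm : (M.k : ℝ) ≤ M.m := by exact_mod_cast M.k_le_m
  have hpos : (0 : ℝ) < (M.m - j : ℕ) := by exact_mod_cast Nat.sub_pos_of_lt hj
  have hkept : ((M.m - j : ℕ) : ℝ) ≤ (M.m - j - M.k : ℕ) + M.k := by exact_mod_cast le_tsub_add
  have hsub : ((M.m - j : ℕ) : ℝ) = M.m - j := Nat.cast_sub hj.le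
  rw [alpha, one_sub_div hm.ne', abs_le]
  constructor
  · rw [neg_le_sub_iff_le_add, ← add_div, div_le_div_iff₀ hm hpos]
    nlinarith [mul_nonneg (j.cast_nonneg : (0 : ℝ) ≤ j) (sub_nonneg.2 hkm)]
  · refine (sub_nonpos.2 ?_).trans (by positivity)
    rw [div_le_div_iff₀ hpos hm]
    rcases le_total M.k (M.m - j) with hk | hk
    · rw [Nat.cast_sub hk, hsub]
      nlinarith [mul_nonneg (j.cast_nonneg : (0 : ℝ) ≤ j) (M.k.cast_nonneg : (0 : ℝ) ≤ M.k)]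
    · rw [Nat.sub_eq_zero_of_le hk, Nat.cast_zero, zero_mul]
      exact mul_nonneg (sub_nonneg.2 hkm) hpos.le

theorem abs_one_sub_alpha_le_one : |1 - M.alpha| ≤ 1 := by
  rw [abs_of_nonneg (sub_nonneg.2 M.alpha_le_one)]
  linarith [M.alpha_pos]

theorem abs_keepProb_le_one (j : ℕ) : |M.keepProb j| ≤ 1 := by
  rw [abs_of_nonneg (keepProb_mem_Icc j).1]
  exact (keepProb_mem_Icc j).2

theorem abs_keepProb_sub_le {t : ℕ} (htm : 2 * t ≤ M.m) {j : ℕ} (hj : j ≤ t) :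
    |M.keepProb j - (1 - M.alpha) ^ j| ≤ j * (2 * t / M.m) := by
  induction j with
  | zero => simp [keepProb_zero]
  | succ j ih =>
    have hjm : j < M.m := by omega
    have hratio : (j : ℝ) / (M.m - j : ℕ) ≤ 2 * t / M.m := by
      have hm : (0 : ℝ) < M.m := by exact_mod_cast M.m_pos
      have hpos : (0 : ℝ) < (M.m - j : ℕ) := by exact_mod_cast Nat.sub_pos_of_lt hjm
      rw [div_le_div_iff₀ hpos hm]
      exact_mod_cast show j * M.m ≤ 2 * t * (M.m - j) by
        nlinarith [show M.m ≤ 2 * (M.m - j) by omega, Nat.zero_le (M.m - j)]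
    rw [keepProb_succ hjm, pow_succ]
    refine (abs_mul_sub_mul_le (abs_keepProb_le_one j) abs_one_sub_alpha_le_one).trans
      ((add_le_add (ih (by omega)) ((abs_keepRatio_sub_le hjm).trans hratio)).trans_eq ?_)
    push_cast
    ring

theorem abs_prod_keepProb_sub_le {t : ℕ} (htm : 2 * t ≤ M.m) :
    |∏ j ∈ Finset.range t, M.keepProb (j + 1) - (1 - M.alpha) ^ (t * (t + 1) / 2)|
      ≤ 2 * t ^ 3 / M.m := by
  have hpartial (s : ℕ) (hs : s ≤ t) : |∏ j ∈ Finset.range s, M.keepProb (j + 1)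
      - ∏ j ∈ Finset.range s, (1 - M.alpha) ^ (j + 1)| ≤ s * (t * (2 * t / M.m)) := by
    induction s with
    | zero => simp
    | succ s ih =>
      have hprod : |∏ j ∈ Finset.range s, M.keepProb (j + 1)| ≤ 1 := by
        rw [Finset.abs_prod]
        exact Finset.prod_le_one (fun _ _ => abs_nonneg _) fun j _ => abs_keepProb_le_one _
      have hpow : |(1 - M.alpha) ^ (s + 1)| ≤ 1 := by
        rw [abs_pow]
        exact pow_le_one₀ (abs_nonneg _) abs_one_sub_alpha_le_one
      have hstep : |M.keepProb (s + 1) - (1 - M.alpha) ^ (s + 1)| ≤ t * (2 * t / M.m) :=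
        (abs_keepProb_sub_le htm hs).trans (by gcongr)
      rw [Finset.prod_range_succ, Finset.prod_range_succ]
      refine (abs_mul_sub_mul_le hprod hpow).trans
        ((add_le_add (ih (by omega)) hstep).trans_eq ?_)
      push_cast
      ring
  have hexponent : ∑ j ∈ Finset.range t, (j + 1) = t * (t + 1) / 2 := by
    simpa [mul_comm, Finset.sum_range_succ'] using Finset.sum_range_id (t + 1)
  rw [← hexponent, ← Finset.prod_pow_eq_pow_sum]
  exact (hpartial t le_rfl).trans_eq (by ring)

/-! ### Typical initial conditions -/

theorem conf_nonempty : Nonempty M.Conf := by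
  have hcard : Fintype.card M.HalfEdge = Fintype.card (Fin M.m ⊕ Fin M.m) := by
    rw [card_halfEdge, ell_eq, Fintype.card_sum, Fintype.card_fin, two_mul]
  obtain ⟨e⟩ := Fintype.card_eq.1 hcard
  refine ⟨⟨(e.trans (Equiv.sumComm _ _)).trans e.symm, fun x => by simp, fun x hx => ?_⟩⟩
  have hswap : (e x).swap = e x := by simpa using congrArg e hx
  cases hex : e x <;> simp [hex] at hswap

theorem initMeasure_le_one (S : Set (M.Conf × M.HalfEdge)) : M.initMeasure S ≤ 1 := by
  rw [initMeasure, ← Set.ncard_univ]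
  refine div_le_one_of_le₀ ?_ (Nat.cast_nonneg _)
  exact_mod_cast Set.ncard_le_ncard (Set.subset_univ S)

theorem card_conf_prod : (Nat.card (M.Conf × M.HalfEdge) : ℝ) = Fintype.card M.Conf * M.ell := by
  rw [Nat.card_eq_fintype_card, Fintype.card_prod, card_halfEdge, Nat.cast_mul]

theorem one_sub_le_initMeasure {f : M.Conf → M.HalfEdge → ℝ} (hf : ∀ η x, 0 ≤ f η x) {a : ℝ}
    (ha : 0 < a) (hsum : ∑ η, ∑ x, f η x ≤ Fintype.card M.Conf * M.ell * a ^ 2)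
    {S : Set (M.Conf × M.HalfEdge)} (hS : ∀ η x, f η x ≤ a → (η, x) ∈ S) :
    1 - a ≤ M.initMeasure S := by
  have hcard : (0 : ℝ) < Fintype.card M.Conf * M.ell := by
    have := conf_nonempty (M := M)
    exact mul_pos (Nat.cast_pos.2 Fintype.card_pos) (Nat.cast_pos.2 M.ell_pos)
  have hmarkov : (Sᶜ.ncard : ℝ) * a ≤ ∑ p : M.Conf × M.HalfEdge, f p.1 p.2 :=
    ncard_mul_le_sum (f := fun p => f p.1 p.2) (B := Sᶜ) (fun p => hf p.1 p.2)
      fun p hp => (not_le.1 fun hle => hp (hS p.1 p.2 hle)).le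
  rw [Fintype.sum_prod_type] at hmarkov
  have hcompl : (Sᶜ.ncard : ℝ) ≤ Fintype.card M.Conf * M.ell * a :=
    le_of_mul_le_mul_right (by linarith [hmarkov.trans hsum]) ha
  have hadd : (S.ncard : ℝ) + Sᶜ.ncard = Fintype.card M.Conf * M.ell := by
    rw [← card_conf_prod]
    exact_mod_cast Set.ncard_add_ncard_compl S
  rw [initMeasure, card_conf_prod, le_div_iff₀ hcard]
  linarith

/-- The sum of the errors at time `t` in the three estimates, as a function of the initial
configuration and half-edge. -/
noncomputable def initErr (t : ℕ) (η : M.Conf) (x : M.HalfEdge) : ℝ :=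
  2 * mixErr t η / M.alpha + ballRatio η x t + revisit (List.replicate t 1) {x.1} η x

variable (M) in
/-- Bound for the mean of `initErr` over a uniform initial configuration and half-edge. -/
noncomputable def meanErr (t : ℕ) : ℝ :=
  t ^ 4 * (52 + 16 * M.nu) / (M.alpha ^ 2 * M.ell)
    + (2 * M.nu + 3) ^ t * (2 * (M.nu + 1)) / M.ell + t ^ 2 * (4 * M.nu + 6) / M.ell

theorem meanErr_pos (t : ℕ) : 0 < M.meanErr t := by
  have hell := M.ell_pos
  have hν := M.nu_nonneg
  have hα := M.alpha_pos
  unfold meanErr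
  positivity

theorem isExchangeable_of_mem_replicate {t : ℕ} :
    ∀ P ∈ List.replicate t (1 : FunOp M.Conf), IsExchangeable P :=
  fun _ hP => List.eq_of_mem_replicate hP ▸ .one_isExchangeable

theorem mixErr_div_alpha_nonneg (t : ℕ) (η : M.Conf) : 0 ≤ 2 * mixErr t η / M.alpha :=
  div_nonneg (mul_nonneg zero_le_two (mixErr_nonneg t η)) M.alpha_pos.le

theorem revisit_replicate_nonneg (t : ℕ) (η : M.Conf) (x : M.HalfEdge) :
    0 ≤ revisit (List.replicate t 1) {x.1} η x :=
  (revisit_mem_Icc (fun P hP => (isExchangeable_of_mem_replicate P hP).toIsMarkov) _ η x).1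

theorem initErr_nonneg (t : ℕ) (η : M.Conf) (x : M.HalfEdge) : 0 ≤ initErr t η x :=
  add_nonneg (add_nonneg (mixErr_div_alpha_nonneg t η) (ballRatio_nonneg η x t))
    (revisit_replicate_nonneg t η x)

theorem sum_initErr_le (t : ℕ) :
    ∑ η : M.Conf, ∑ x, initErr t η x ≤ Fintype.card M.Conf * M.ell * M.meanErr t := by
  have hell : (0 : ℝ) < M.ell := by exact_mod_cast M.ell_pos
  have hα := M.alpha_pos
  have hmix : ∑ η : M.Conf, ∑ _x : M.HalfEdge, 2 * mixErr t η / M.alpha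
      ≤ M.ell * (2 * (Fintype.card M.Conf * (t ^ 4 * (26 + 8 * M.nu) / (M.alpha * M.ell)))
        / M.alpha) := by
    simp only [Finset.sum_const, Finset.card_univ, card_halfEdge, nsmul_eq_mul,
      ← Finset.mul_sum, ← Finset.sum_div]
    gcongr
    exact sum_mixErr_le t
  have hball := sum_sum_ballRatio_le (M := M) t
  rw [Finset.sum_comm] at hball
  have hrevisit := sum_revisit_le (isExchangeable_of_mem_replicate (M := M)) (L := t)
    List.length_replicate.le
  rw [List.length_replicate] at hrevisit
  simp only [initErr, Finset.sum_add_distrib]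
  refine (add_le_add (add_le_add hmix hball) hrevisit).trans_eq ?_
  rw [meanErr]
  field_simp
  ring

variable (M) in
/-- The error in the three estimates for typical initial conditions: Markov's inequality for
`initErr`, and the approximation of the falling factorials in `keepProb` by powers. -/
noncomputable def errBound (t : ℕ) : ℝ := √(M.meanErr t) + 2 * t ^ 3 / M.m

theorem tvDist_condLaw_le_initErr (η : M.Conf) (x : M.HalfEdge) {t : ℕ} (ht : 1 ≤ t)
    (hL : 4 * t ≤ M.ell) :
    tvDist (M.condLaw η x t {w | Path.tau w ≤ (t : ℕ∞)}) M.unif ≤ initErr t η x := by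
  have hball := ballRatio_nonneg η x t
  have hrevisit := revisit_replicate_nonneg t η x
  rw [initErr]
  linarith [tvDist_condLaw_le η x ht hL]

theorem one_sub_initErr_le_tvDist_condLaw (η : M.Conf) (x : M.HalfEdge) (t : ℕ)
    (hpos : 0 < M.prob η x t {w | (t : ℕ∞) < Path.tau w}) :
    1 - initErr t η x ≤ tvDist (M.condLaw η x t {w | (t : ℕ∞) < Path.tau w}) M.unif := by
  have hmix := mixErr_div_alpha_nonneg t η
  have hrevisit := revisit_replicate_nonneg t η x
  have hball : ((ball η x t).card : ℝ) / M.ell ≤ ballRatio η x t := by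
    refine le_min (div_le_one_of_le₀ ?_ (Nat.cast_nonneg _)) ?_
    · rw [← card_halfEdge]
      exact_mod_cast Finset.card_le_univ _
    · gcongr
      exact le_mul_of_one_le_left (Nat.cast_nonneg _) one_le_two
  rw [initErr]
  linarith [le_tvDist_condLaw η x t hpos]

theorem abs_prob_lt_tau_sub_pow_le (η : M.Conf) (x : M.HalfEdge) {t : ℕ} (hL : 4 * t ≤ M.ell) :
    |M.prob η x t {w | (t : ℕ∞) < Path.tau w} - (1 - M.alpha) ^ (t * (t + 1) / 2)|
      ≤ initErr t η x + 2 * t ^ 3 / M.m := by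
  have hmix := mixErr_div_alpha_nonneg t η
  have hball := ballRatio_nonneg η x t
  have htm : 2 * t ≤ M.m := by
    have := M.ell_eq
    omega
  refine (abs_sub_le _ (∏ j ∈ Finset.range t, M.keepProb (j + 1)) _).trans
    (add_le_add ((abs_prob_lt_tau_sub_le η x t).trans ?_) (abs_prod_keepProb_sub_le htm))
  rw [initErr]
  linarith

theorem one_sub_errBound_le_initMeasure {t : ℕ} (hL : 4 * t ≤ M.ell) :
    1 - M.errBound t ≤ M.initMeasure {p : M.Conf × M.HalfEdge |
      (1 ≤ t → tvDist (M.condLaw p.1 p.2 t {w | Path.tau w ≤ (t : ℕ∞)}) M.unif ≤ M.errBound t) ∧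
      (0 < M.prob p.1 p.2 t {w | (t : ℕ∞) < Path.tau w} →
        1 - M.errBound t
          ≤ tvDist (M.condLaw p.1 p.2 t {w | (t : ℕ∞) < Path.tau w}) M.unif) ∧
      |M.prob p.1 p.2 t {w | (t : ℕ∞) < Path.tau w} - (1 - M.alpha) ^ (t * (t + 1) / 2)|
        ≤ M.errBound t} := by
  have hdet : √(M.meanErr t) ≤ M.errBound t := le_add_of_nonneg_right (by positivity)
  refine (sub_le_sub_left hdet 1).trans (one_sub_le_initMeasure (initErr_nonneg t)
    (Real.sqrt_pos.2 (meanErr_pos t)) ?_ fun η x hle => ⟨fun ht => ?_, fun hpos => ?_, ?_⟩)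
  · rw [Real.sq_sqrt (meanErr_pos t).le]
    exact sum_initErr_le t
  · exact (tvDist_condLaw_le_initErr η x ht hL).trans (hle.trans hdet)
  · exact (sub_le_sub_left (hle.trans hdet) 1).trans (one_sub_initErr_le_tvDist_condLaw η x t hpos)
  · exact (abs_prob_lt_tau_sub_pow_le η x hL).trans (add_le_add hle le_rfl)

/-! ### Asymptotics -/

variable (M) in
theorem card_vertices_le_m : n ≤ M.m := by
  have h : n * 2 ≤ M.ell := by
    simpa [ell] using Finset.card_nsmul_le_sum Finset.univ M.d 2 fun v _ => M.two_le_d v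
  have := M.ell_eq
  omega

theorem card_vertices_le_ell : n ≤ M.ell := by
  have := M.card_vertices_le_m
  have := M.ell_eq
  omega

theorem meanErr_le {t : ℕ} {C : ℝ} (hn : 0 < n) (hν : M.nu ≤ C) (htl : t ≤ Real.log n)
    (htC : t * Real.log (2 * C + 3) ≤ 1 / 2 * Real.log n)
    (hα : 1 ≤ M.alpha * Real.log n ^ 2) :
    M.meanErr t ≤ (52 + 16 * C) * (Real.log n ^ 8 / n) + 2 * (C + 1) * (√n)⁻¹
      + (4 * C + 6) * (Real.log n ^ 2 / n) := by
  have hn' : (0 : ℝ) < n := by exact_mod_cast hn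
  have hνC : 0 ≤ C := M.nu_nonneg.trans hν
  have hν0 := M.nu_nonneg
  have hα0 := M.alpha_pos
  have : 0 ≤ Real.log n := (Nat.cast_nonneg t).trans htl
  have hell : (n : ℝ) ≤ M.ell := by exact_mod_cast M.card_vertices_le_ell
  have hinv : 1 / M.alpha ^ 2 ≤ Real.log n ^ 4 := by
    rw [div_le_iff₀ (by positivity)]
    calc (1 : ℝ) ≤ (M.alpha * Real.log n ^ 2) ^ 2 := one_le_pow₀ hα
      _ = Real.log n ^ 4 * M.alpha ^ 2 := by ring
  have hpow : (2 * M.nu + 3) ^ t ≤ √n := by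
    calc (2 * M.nu + 3) ^ t ≤ (2 * C + 3) ^ t := by gcongr
      _ = Real.exp (t * Real.log (2 * C + 3)) := by
        rw [Real.exp_nat_mul, Real.exp_log (by positivity)]
      _ ≤ Real.exp (Real.log n / 2) := Real.exp_le_exp.2 (by linarith)
      _ = √n := by rw [Real.exp_half, Real.exp_log hn']
  rw [meanErr]
  refine add_le_add (add_le_add ?_ ?_) ?_
  · calc t ^ 4 * (52 + 16 * M.nu) / (M.alpha ^ 2 * M.ell)
        = t ^ 4 * (52 + 16 * M.nu) * (1 / M.alpha ^ 2) / M.ell := by field_simp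
      _ ≤ Real.log n ^ 4 * (52 + 16 * C) * Real.log n ^ 4 / n := by gcongr
      _ = (52 + 16 * C) * (Real.log n ^ 8 / n) := by ring
  · calc (2 * M.nu + 3) ^ t * (2 * (M.nu + 1)) / M.ell
        ≤ √n * (2 * (C + 1)) / n := by gcongr
      _ = 2 * (C + 1) * (√n)⁻¹ := by rw [← Real.sqrt_div_self]; ring
  · calc t ^ 2 * (4 * M.nu + 6) / M.ell ≤ Real.log n ^ 2 * (4 * C + 6) / n := by gcongr
      _ = (4 * C + 6) * (Real.log n ^ 2 / n) := by ring

theorem four_mul_le_ell {t : ℕ} (htl : t ≤ 1 / 2 * Real.log n) : 4 * t ≤ M.ell := by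
  have hlog : Real.log n ≤ n := Real.log_le_self n.cast_nonneg
  have ht : 2 * t ≤ n := by
    have : 2 * (t : ℝ) ≤ n := by linarith
    exact_mod_cast this
  have := M.card_vertices_le_m
  have := M.ell_eq
  omega

section Sequences

variable {N : ℕ → ℕ} {M : ∀ i, DynConfModel (N i)} {t : ℕ → ℕ}

theorem tendsto_log_atTop (hN : Tendsto N atTop atTop) :
    Tendsto (fun i => Real.log (N i)) atTop atTop :=
  Real.tendsto_log_atTop.comp (tendsto_natCast_atTop_atTop.comp hN)

theorem tendsto_log_pow_div (hN : Tendsto N atTop atTop) (r : ℕ) :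
    Tendsto (fun i => Real.log (N i) ^ r / N i) atTop (𝓝 0) :=
  Real.isLittleO_pow_log_id_atTop.tendsto_div_nhds_zero.comp
    (tendsto_natCast_atTop_atTop.comp hN)

theorem eventually_le_mul_log (hN : Tendsto N atTop atTop) {f : ℕ → ℝ}
    (hf : f =o[atTop] fun i => Real.log (N i)) {c : ℝ} (hc : 0 < c) :
    ∀ᶠ i in atTop, f i ≤ c * Real.log (N i) := by
  filter_upwards [hf.def hc, (tendsto_log_atTop hN).eventually_ge_atTop 0] with i hi hlog
  rw [Real.norm_of_nonneg hlog] at hi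
  exact (Real.le_norm_self _).trans hi

theorem tendsto_meanErr (hN : Tendsto N atTop atTop)
    (hν : IsBoundedUnder (· ≤ ·) atTop fun i => (M i).nu)
    (hα : Tendsto (fun i => (M i).alpha * Real.log (N i) ^ 2) atTop atTop)
    (ht : (fun i => (t i : ℝ)) =o[atTop] fun i => Real.log (N i)) :
    Tendsto (fun i => (M i).meanErr (t i)) atTop (𝓝 0) := by
  obtain ⟨C, hC⟩ := hν
  rw [eventually_map] at hC
  have hsqrt : Tendsto (fun i => (√(N i))⁻¹) atTop (𝓝 0) :=
    (Real.tendsto_sqrt_atTop.comp (tendsto_natCast_atTop_atTop.comp hN)).inv_tendsto_atTop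
  have hbound := (((tendsto_log_pow_div hN 8).const_mul (52 + 16 * C)).add
    (hsqrt.const_mul (2 * (C + 1)))).add ((tendsto_log_pow_div hN 2).const_mul (4 * C + 6))
  simp only [mul_zero, add_zero] at hbound
  have htC : (fun i => t i * Real.log (2 * C + 3)) =o[atTop] fun i => Real.log (N i) :=
    (ht.const_mul_left _).congr_left fun i => mul_comm _ _
  refine squeeze_zero' (Eventually.of_forall fun i => (meanErr_pos (t i)).le) ?_ hbound
  filter_upwards [hN.eventually_gt_atTop 0, hC, eventually_le_mul_log hN ht one_pos,
    eventually_le_mul_log hN htC one_half_pos, hα.eventually_ge_atTop 1]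
    with i hNi hνi hti htCi hαi
  exact meanErr_le hNi hνi (by rwa [one_mul] at hti) htCi hαi

theorem tendsto_errBound (hN : Tendsto N atTop atTop)
    (hν : IsBoundedUnder (· ≤ ·) atTop fun i => (M i).nu)
    (hα : Tendsto (fun i => (M i).alpha * Real.log (N i) ^ 2) atTop atTop)
    (ht : (fun i => (t i : ℝ)) =o[atTop] fun i => Real.log (N i)) :
    Tendsto (fun i => (M i).errBound (t i)) atTop (𝓝 0) := by
  have hcube : Tendsto (fun i => 2 * (t i : ℝ) ^ 3 / (M i).m) atTop (𝓝 0) := by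
    have hbound := (tendsto_log_pow_div hN 3).const_mul 2
    rw [mul_zero] at hbound
    refine squeeze_zero' (Eventually.of_forall fun i => by positivity) ?_ hbound
    filter_upwards [hN.eventually_gt_atTop 0, eventually_le_mul_log hN ht one_pos] with i hNi hti
    rw [one_mul] at hti
    have hm : (N i : ℝ) ≤ (M i).m := by exact_mod_cast (M i).card_vertices_le_m
    have : (0 : ℝ) < N i := by exact_mod_cast hNi
    rw [← mul_div_assoc]
    gcongr
  simpa only [errBound, Real.sqrt_zero, add_zero]
    using (tendsto_meanErr hN hν hα ht).sqrt.add hcube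

end Sequences

end DynConfModel

/-- The models are indexed by `i`, the `i`-th one having `N i` vertices with `N i → ∞`. -/
theorem mainTheorem2
    (N : ℕ → ℕ) (hN : Tendsto N atTop atTop)
    (M : ∀ i, DynConfModel (N i))
    (hR1 : (fun i => ((M i).ell : ℝ)) =Θ[atTop] fun i => (N i : ℝ))
    (hR2 : IsBoundedUnder (· ≤ ·) atTop fun i => (M i).nu)
    (hfast : Tendsto (fun i => (M i).alpha * Real.log (N i) ^ 2) atTop atTop)
    (t : ℕ → ℕ) (ht : (fun i => (t i : ℝ)) =o[atTop] fun i => Real.log (N i)) :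
    ∃ ε : ℕ → ℝ, Tendsto ε atTop (𝓝 0) ∧
      Tendsto (fun i => (M i).initMeasure {p : (M i).Conf × (M i).HalfEdge |
        (1 ≤ t i →
          tvDist ((M i).condLaw p.1 p.2 (t i) {w | DynConfModel.Path.tau w ≤ t i}) (M i).unif
            ≤ ε i) ∧
        (0 < (M i).prob p.1 p.2 (t i) {w | t i < DynConfModel.Path.tau w} →
          1 - ε i ≤
            tvDist ((M i).condLaw p.1 p.2 (t i) {w | t i < DynConfModel.Path.tau w})
              (M i).unif) ∧
        |(M i).prob p.1 p.2 (t i) {w | t i < DynConfModel.Path.tau w}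
            - (1 - (M i).alpha) ^ (t i * (t i + 1) / 2)| ≤ ε i}) atTop (𝓝 1) := by
  have herr := DynConfModel.tendsto_errBound hN hR2 hfast ht
  refine ⟨fun i => (M i).errBound (t i), herr,
    tendsto_of_tendsto_of_tendsto_of_le_of_le' (by simpa using herr.const_sub 1)
      tendsto_const_nhds ?_ (Eventually.of_forall fun i => DynConfModel.initMeasure_le_one _)⟩
  filter_upwards [DynConfModel.eventually_le_mul_log hN ht one_half_pos] with i hti
  exact DynConfModel.one_sub_errBound_le_initMeasure (DynConfModel.four_mul_le_ell hti)
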